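/- Throughout, $N\in\mathbb N$, $[s]$ is the integer part of $s$, and $V$, $W$ are real Banach spaces. For $n\ge 0$, $V^{\otimes n}$ is the completion of the algebraic tensor power for a fixed choice of admissible norms (permutations of the factors act isometrically, $\|x\otimes y\|\le\|x\|\,\|y\|$, $V^{\otimes 0}=\mathbb R$ and $V^{\otimes1}=V$ isometrically). $T_1((V))$ is the set of sequences $b=(b_0,b_1,\dots)$ with $b_n\in V^{\otimes n}$ and $b_0=1$. A process on $[0,N]$ with values in a Banach space is *rectifiable* if a.s. its paths are continuous and of bounded variation. $\int_0^N|dX_t|$ is the total variation of $X$ and $|dX_t|$ its total variation measure. Integrals $\int A_t\,dY_t$ are Riemann–Stieltjes integrals, and $[g_t]_{t=0}^N=g_N-g_0$. For a rectifiable path $X$ on $[0,N]$ and a sequence $b=(b_n)_{n\ge0}$ with $b_n\in V^{\otimes n}$, the forward ($+$) and backward ($-$) sawtooth signatures $Z^{\pm}(X,b)$ with datum $b$ are given by $Z^{\pm,0}=b_0$, $$Z^{+,1}_t=X_t-X_{[t]}+b_1,\qquad Z^{-,1}_t=X_t-X_{[t+1]}+b_1,\qquad Z^{\pm,n}_t=b_n+\int_0^t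 dX_s\otimes Z^{\pm,n-1}_s\quad(n\ge2),$$ where $X_{N+1}:=X_N$. For a rectifiable process $X$ the *optimal tensors* $b^{\pm,*}\in T_1((V))$ are defined recursively by $b^{\pm,*}_0=1$ and $$b^{\pm,*}_m=-\frac1{\mathbb E\int_0^N|dX_t|}\,\mathbb E\int_0^N Z^{\pm,m}_t(X,b^{\pm,*,<m})\,|dX_t|,\qquad m\ge1,$$ where $b^{<m}=(b_0,\dots,b_{m-1},0,0,\dots)$ (an expectation that does not exist and a quotient with zero denominator are read as $0$; if $\int_0^N|dX_t|$ has moments of all orders, all these expectations exist as Bochner integrals). Put $Z^{\pm,*}=Z^{\pm}(X,b^{\pm,*})$, the *optimal sawtooth signatures*. For $m\ge 1$, $f\in C^m(V,L(V,W))$ means that $f$ is $m$ times continuously Fréchet differentiable and that for $k\le m$ its $k$-th derivative, as a $(k+1)$-linear map, is given by a continuous map $D^kf:V\to L(V^{\otimes(k+1)},W)$. Put $$I^-_N(f,X)=\sum_{k=0}^{N-1}f(X_k)(X_{k+1}-X_k),\qquad I^+_N(f,X)=\sum_{k=0}^{N-1}f(X_{k+1})(X_{k+1}-X_k).$$ **Theorem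 1.** (i) Let $X$ be a rectifiable process on $[0,N]$ with values in a Banach space $V$. Then $b^{\pm,*}\in T_1((V))$, and $Z^{\pm,*}$ is a well-defined process with values in $T_1((V))$: a.s. all the integrals defining it exist. Its components of degree $n\neq1$ are rectifiable, and its component of degree $1$ has a.s. paths of bounded variation. Moreover $Z^{\pm,n,*}_0=b^{\pm,*}_n$ for all $n\ne1$, and also for $n=1$ in the forward case. For every Banach space $W$, almost surely, for all $m\ge1$ and all $f\in C^m(V,L(V,W))$, $$I_N^{\pm}(f,X)=\int_0^Nf(X_t)\,dX_t-[f(X_t)b^{\pm,*}_1]_{t=0}^N+\sum_{l=2}^m(-1)^l\big[D^{l-1}f(X_t)Z^{\pm,l,*}_t\big]_{t=0}^N+R^{m,\pm,*},$$ $$R^{m,\pm,*}=(-1)^{m+1}\int_0^ND^mf(X_t)\,dZ^{\pm,m+1,*}_t,$$ where both integrals exist. (ii) Let $V$ be a Hilbert space and let $V^{\otimes n}$ carry the Hilbert tensor norms. Assume that $\int_0^N|dX_t|$ has moments of all orders and is not a.s. zero. Then for every $m\ge1$ the functional $$V^{\otimes m}\ni v\mapsto\mathbb E\int_0^N\|Z^{\pm,m}_t(X,b^{\pm,*,<m}+v)\|^2\,|dX_t|$$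 is finite at $v=b^{\pm,*}_m$, and $b^{\pm,*}_m$ is its unique minimiser. Consequently $b^{\pm,*}$ is the only $b\in T_1((V))$ such that, for every $m\ge1$, $b_m$ minimises $v\mapsto\mathbb E\int_0^N\|Z^{\pm,m}_t(X,b^{<m}+v)\|^2|dX_t|$, and $Z^{\pm,*}$ is the corresponding sawtooth signature. (iii) Let $V=\mathbb R$, $X_t=t$, $N\ge1$. Let $B^\pm_l$ be the Bernoulli numbers with $B_1^\pm=\pm\frac12$ and $P_l$ the Bernoulli polynomials. Then $b^{\pm,*}_l=B^{\mp}_l/l!$ for $l\ge1$, and $Z^{\pm,l,*}_t=\frac1{l!}P_l(t-[t])$ for $l\ge1$ and $t\in[0,N]$ (with $t<N$ if $l=1$). The terms of the formula in (i) are, one by one, those of the classical Euler–Maclaurin formula, which holds for every $m\ge1$ and every $f\in C^m([0,N])$: $$\sum_{k\in[[0,N]]^\pm}f(k)=\int_0^Nf(s)\,ds+\sum_{l=1}^m\frac{B_l^\pm}{l!}\big[f^{(l-1)}(x)\big]_{x=0}^N+\frac{(-1)^{m+1}}{m!}\int_0^Nf^{(m)}(s)P_m(s-[s])\,ds,$$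 with $[[0,N]]^-=\{0,\dots,N-1\}$ and $[[0,N]]^+=\{1,\dots,N\}$. -/

import Mathlib

open MeasureTheory Set
open scoped TensorProduct ENNReal

namespace EML

/-! ### Tensor powers of a Banach space and tensor series -/

/-- A choice of admissible norms on the algebraic tensor powers `V^{⊗ n}`: permutations of the
factors act isometrically and `‖x ⊗ y‖ ≤ ‖x‖ ‖y‖`; on `V^{⊗ 0} = ℝ` and `V^{⊗ 1} = V` the norm is
the given one. -/
structure AdmissibleNorm (V : Type*) [NormedAddCommGroup V] [NormedSpace ℝ V] where
  /-- the norm on the `n`-th algebraic tensor power -/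
  nrm : ∀ n : ℕ, Seminorm ℝ (⨂[ℝ]^n V)
  definite : ∀ (n : ℕ) (x : ⨂[ℝ]^n V), nrm n x = 0 → x = 0
  perm : ∀ (n : ℕ) (σ : Equiv.Perm (Fin n)) (x : ⨂[ℝ]^n V),
    nrm n (PiTensorProduct.reindex ℝ (fun _ => V) σ x) = nrm n x
  mul_le : ∀ (m n : ℕ) (x : ⨂[ℝ]^m V) (y : ⨂[ℝ]^n V),
    nrm (m + n) (TensorPower.mulEquiv (x ⊗ₜ[ℝ] y)) ≤ nrm m x * nrm n y
  norm_zero : ∀ v : Fin 0 → V, nrm 0 (PiTensorProduct.tprod ℝ v) = 1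
  norm_one : ∀ v : V, nrm 1 (PiTensorProduct.tprod ℝ fun _ => v) = ‖v‖

namespace AdmissibleNorm

section

variable {V : Type*} [NormedAddCommGroup V] [NormedSpace ℝ V] (α : AdmissibleNorm V)

/-- The algebraic tensor power `V^{⊗ n}`, carrying the norm `α.nrm n`. -/
def Alg (_α : AdmissibleNorm V) (n : ℕ) : Type _ := ⨂[ℝ]^n V

noncomputable instance (n : ℕ) : AddCommGroup (α.Alg n) :=
  inferInstanceAs (AddCommGroup (⨂[ℝ]^n V))

noncomputable instance (n : ℕ) : Module ℝ (α.Alg n) :=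
  inferInstanceAs (Module ℝ (⨂[ℝ]^n V))

noncomputable instance (n : ℕ) : NormedAddCommGroup (α.Alg n) :=
  AddGroupNorm.toNormedAddCommGroup
    { toFun := fun x : α.Alg n => α.nrm n x
      map_zero' := map_zero (α.nrm n)
      add_le' := map_add_le_add (α.nrm n)
      neg' := map_neg_eq_map (α.nrm n)
      eq_zero_of_map_eq_zero' := α.definite n }

noncomputable instance (n : ℕ) : NormedSpace ℝ (α.Alg n) where
  norm_smul_le c x := (map_smul_eq_mul (α.nrm n) c x).le

/-- The Banach space `V^{⊗ n}`: the completion of the algebraic tensor power for the admissible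
norm. -/
abbrev T (n : ℕ) : Type _ := UniformSpace.Completion (α.Alg n)

/-- The identification of `⨂[ℝ]^n V` with its normed version. -/
noncomputable def toAlg (n : ℕ) : ⨂[ℝ]^n V ≃ₗ[ℝ] α.Alg n := LinearEquiv.refl ℝ (⨂[ℝ]^n V)

theorem norm_toAlg (n : ℕ) (x : ⨂[ℝ]^n V) : ‖α.toAlg n x‖ = α.nrm n x := rfl

/-- The pure tensor `v 0 ⊗ ⋯ ⊗ v (n - 1)` in `V^{⊗ n}`. -/
noncomputable def pure {n : ℕ} (v : Fin n → V) : α.T n :=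
  (α.toAlg n (PiTensorProduct.tprod ℝ v) : UniformSpace.Completion (α.Alg n))

/-- The scalar `1`, in degree `0`. -/
noncomputable def one : α.T 0 := α.pure Fin.elim0

/-- The canonical isometry `V → V^{⊗ 1}`. -/
noncomputable def ofV (v : V) : α.T 1 := α.pure fun _ => v

/-- `x ↦ v ⊗ x` on algebraic tensors. -/
noncomputable def prependAlg (v : V) (n : ℕ) : ⨂[ℝ]^n V →ₗ[ℝ] ⨂[ℝ]^(n + 1) V :=
  (TensorPower.cast ℝ V (Nat.add_comm 1 n)).toLinearMap ∘ₗ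
    (TensorPower.mulEquiv (R := ℝ) (M := V) (n := 1) (m := n)).toLinearMap ∘ₗ
      TensorProduct.mk ℝ (⨂[ℝ]^1 V) (⨂[ℝ]^n V) (PiTensorProduct.tprod ℝ fun _ => v)

theorem nrm_cast {m n : ℕ} (h : m = n) (x : ⨂[ℝ]^m V) :
    α.nrm n (TensorPower.cast ℝ V h x) = α.nrm m x := by
  subst h
  simp

theorem nrm_prependAlg_le (v : V) (n : ℕ) (x : ⨂[ℝ]^n V) :
    α.nrm (n + 1) (prependAlg v n x) ≤ ‖v‖ * α.nrm n x := by
  refine (α.nrm_cast _ _).le.trans ((α.mul_le 1 n _ x).trans ?_)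
  rw [α.norm_one]

/-- `x ↦ v ⊗ x` as a continuous linear map `V^{⊗ n} → V^{⊗ (n + 1)}`. -/
noncomputable def prepend (v : V) (n : ℕ) : α.T n →L[ℝ] α.T (n + 1) :=
  ContinuousLinearMap.completion
    (LinearMap.mkContinuous
      ((α.toAlg (n + 1)).toLinearMap ∘ₗ prependAlg v n ∘ₗ (α.toAlg n).symm.toLinearMap) ‖v‖
      fun x => by
        obtain ⟨y, rfl⟩ := (α.toAlg n).surjective x
        simp only [LinearMap.comp_apply, LinearEquiv.coe_coe, LinearEquiv.symm_apply_apply,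
          norm_toAlg]
        exact α.nrm_prependAlg_le v n y)

theorem prepend_pure (v : V) {n : ℕ} (w : Fin n → V) :
    α.prepend v n (α.pure w) = α.pure (Fin.cons v w : Fin (n + 1) → V) := by
  have h : prependAlg v n (PiTensorProduct.tprod ℝ w)
      = PiTensorProduct.tprod ℝ (Fin.cons v w : Fin (n + 1) → V) := by
    have := TensorPower.tprod_mul_tprod ℝ (fun _ : Fin 1 => v) w
    rw [TensorPower.gMul_def] at this
    simp only [prependAlg, LinearMap.comp_apply, LinearEquiv.coe_coe, TensorProduct.mk_apply, this,
      TensorPower.cast_tprod]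
    congr 1
    funext i
    refine Fin.cases ?_ (fun j => ?_) i
    · have : Fin.cast (Nat.add_comm 1 n).symm (0 : Fin (n + 1)) = Fin.castAdd n (0 : Fin 1) := rfl
      simp only [Function.comp_apply, this, Fin.append_left, Fin.cons_zero]
    · have : Fin.cast (Nat.add_comm 1 n).symm j.succ = Fin.natAdd 1 j := by
        ext; simp [Nat.add_comm]
      simp only [Function.comp_apply, this, Fin.append_right, Fin.cons_succ]
  unfold prepend pure
  rw [ContinuousLinearMap.completion_apply_coe]
  exact congrArg
    (fun z => ((α.toAlg (n + 1) z : α.Alg (n + 1)) : UniformSpace.Completion (α.Alg (n + 1)))) h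

/-- The set `T_1((V))` of tensor series, with `n`-th component in `V^{⊗ n}`, whose component of
degree `0` is `1`. -/
def series₁ : Set (∀ n, α.T n) := {b | b 0 = α.one}

end

/-- The norms are the Hilbert tensor norms: they come from the inner product with
`⟪v₁ ⊗ ⋯ ⊗ vₙ, w₁ ⊗ ⋯ ⊗ wₙ⟫ = ∏ ⟪vₖ, wₖ⟫`. -/
def IsHilbert {H : Type*} [NormedAddCommGroup H] [InnerProductSpace ℝ H]
    (α : AdmissibleNorm H) : Prop :=
  ∀ (n r : ℕ) (v : Fin r → Fin n → H),
    α.nrm n (∑ i, PiTensorProduct.tprod ℝ (v i)) ^ 2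
      = ∑ i, ∑ j, ∏ k, inner ℝ (v i k) (v j k)

end AdmissibleNorm

/-! ### Stieltjes integrals and total variation -/

/-- `I` is the Riemann–Stieltjes integral `∫_a^b B(A_t, dY_t)`: the tagged Riemann–Stieltjes sums
tend to `I` as the mesh tends to `0`. -/
def HasRSIntegral {E F G : Type*} [AddGroup F] [NormedAddCommGroup G]
    (B : E → F → G) (A : ℝ → E) (Y : ℝ → F) (a b : ℝ) (I : G) : Prop :=
  ∀ ε > 0, ∃ δ > 0, ∀ (n : ℕ) (t ξ : ℕ → ℝ), Monotone t → t 0 = a → t n = b →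
    (∀ i < n, ξ i ∈ Icc (t i) (t (i + 1)) ∧ t (i + 1) - t i < δ) →
    ‖(∑ i ∈ Finset.range n, B (A (ξ i)) (Y (t (i + 1)) - Y (t i))) - I‖ < ε

open Classical in
/-- The Riemann–Stieltjes integral (with value `0` if it does not exist). -/
noncomputable def rsIntegral {E F G : Type*} [AddGroup F] [NormedAddCommGroup G]
    (B : E → F → G) (A : ℝ → E) (Y : ℝ → F) (a b : ℝ) : G :=
  if h : ∃ I, HasRSIntegral B A Y a b I then h.choose else 0

open Classical in
/-- The total variation measure `|dx_t|` on `[0, N]` of a continuous path `x` of bounded variation: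
the Lebesgue–Stieltjes measure of `t ↦ ‖x‖_{1-var; [0, t]}`. -/
noncomputable def variationMeasure {V : Type*} [NormedAddCommGroup V] (N : ℕ) (x : ℝ → V) :
    Measure ℝ :=
  if h : Monotone fun t : ℝ => (eVariationOn x (Icc 0 (N : ℝ) ∩ Iic t)).toReal then
    h.stieltjesFunction.measure
  else 0

/-- A rectifiable process on `[0, N]`: a process with a.s. continuous paths of bounded
variation. -/
structure IsRectifiable {Ω E : Type*} [MeasurableSpace Ω] [NormedAddCommGroup E]
    (P : Measure Ω) (N : ℕ) (X : ℝ → Ω → E) : Prop where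
  measurable : ∀ t ∈ Icc (0 : ℝ) N, AEStronglyMeasurable (X t) P
  continuous : ∀ᵐ ω ∂P, ContinuousOn (fun t => X t ω) (Icc 0 (N : ℝ))
  boundedVariation : ∀ᵐ ω ∂P, BoundedVariationOn (fun t => X t ω) (Icc 0 (N : ℝ))

/-- The random variable `∫_0^N |dX_t|`, the total variation of the path on `[0, N]`. -/
noncomputable def totalVariation {Ω E : Type*} [NormedAddCommGroup E]
    (N : ℕ) (X : ℝ → Ω → E) (ω : Ω) : ℝ≥0∞ :=
  eVariationOn (fun t => X t ω) (Icc 0 (N : ℝ))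

/-! ### Backward and forward sums, sawtooth signatures, optimal tensors -/

/-- Backward (`-`) or forward (`+`). -/
inductive Side
  | backward
  | forward

/-- The integer point to which time `t` is sent: `[t]` in the forward case and `[t + 1]` in the
backward case (paths on `[0, N]` being extended by a constant after time `N`). -/
noncomputable def Side.anchor : Side → ℕ → ℝ → ℝ
  | .backward, N, t => (min (⌊t⌋₊ + 1) N : ℕ)
  | .forward, _, t => (⌊t⌋₊ : ℕ)

/-- The backward sum `∑ f (x_k) Δx_k` and the forward sum `∑ f (x_{k+1}) Δx_k` over
`0 ≤ k < N`. -/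
noncomputable def Side.riemannSum {V W : Type*} [NormedAddCommGroup V] [NormedSpace ℝ V]
    [NormedAddCommGroup W] [NormedSpace ℝ W] :
    Side → ℕ → (V → V →L[ℝ] W) → (ℝ → V) → W
  | .backward, N, f, x => ∑ k ∈ Finset.range N, f (x k) (x (k + 1) - x k)
  | .forward, N, f, x => ∑ k ∈ Finset.range N, f (x (k + 1)) (x (k + 1) - x k)

section

variable {V : Type*} [NormedAddCommGroup V] [NormedSpace ℝ V] (α : AdmissibleNorm V)

/-- The components of the backward / forward sawtooth signature of the path `x` with initial
datum `b`: `Z⁰ = b₀`, `Z¹_t = x_t - x_{[t]} + b₁` (resp. `x_t - x_{[t+1]} + b₁`) and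
`Zⁿ_t = bₙ + ∫_0^t dx_s ⊗ Zⁿ⁻¹_s` for `n ≥ 2`. -/
noncomputable def sawtooth (s : Side) (N : ℕ) (x : ℝ → V) (b : ∀ n, α.T n) :
    ∀ n : ℕ, ℝ → α.T n
  | 0 => fun _ => b 0
  | 1 => fun t => α.ofV (x t - x (s.anchor N t)) + b 1
  | n + 2 => fun t =>
      b (n + 2) + rsIntegral (fun z v => α.prepend v (n + 1) z) (sawtooth s N x b (n + 1)) x 0 t

/-- `b^{<m}`: the components of degree at least `m` are replaced by `0`. -/
noncomputable def trunc (b : ∀ n, α.T n) (m : ℕ) : ∀ n, α.T n :=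
  fun k => if k < m then b k else 0

/-- The optimal tensor `b^*` of the process `X`: `b^*_0 = 1` and, for `m ≥ 1`,
`b^*_m = - (E ∫ |dX_t|)⁻¹ E ∫ π_m (Z_t (X, b^{*,<m})) |dX_t|`. -/
noncomputable def optimalTensor {Ω : Type*} [MeasurableSpace Ω] (P : Measure Ω) (s : Side) (N : ℕ)
    (X : ℝ → Ω → V) : ∀ m : ℕ, α.T m
  | 0 => α.one
  | m + 1 =>
      -((∫ ω, (totalVariation N X ω).toReal ∂P)⁻¹ •
        ∫ ω, (∫ t in Icc 0 (N : ℝ),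
          sawtooth α s N (fun t => X t ω)
            (fun k => if _h : k < m + 1 then optimalTensor P s N X k else 0) (m + 1) t
          ∂(variationMeasure N fun t => X t ω)) ∂P)
  termination_by m => m

/-- The defining recursion of the optimal tensor, written with the truncation `b^{*,<m}`. -/
theorem optimalTensor_succ {Ω : Type*} [MeasurableSpace Ω] (P : Measure Ω) (s : Side) (N : ℕ)
    (X : ℝ → Ω → V) (m : ℕ) :
    optimalTensor α P s N X (m + 1) =
      -((∫ ω, (totalVariation N X ω).toReal ∂P)⁻¹ •
        ∫ ω, (∫ t in Icc 0 (N : ℝ),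
          sawtooth α s N (fun t => X t ω) (trunc α (optimalTensor α P s N X) (m + 1)) (m + 1) t
          ∂(variationMeasure N fun t => X t ω)) ∂P) := by
  rw [optimalTensor]
  rfl

/-- The optimal sawtooth signature `Z^* = Z (X, b^*)`, as a process. -/
noncomputable def optimalSawtooth {Ω : Type*} [MeasurableSpace Ω] (P : Measure Ω) (s : Side)
    (N : ℕ) (X : ℝ → Ω → V) (n : ℕ) (t : ℝ) (ω : Ω) : α.T n :=
  sawtooth α s N (fun t => X t ω) (optimalTensor α P s N X) n t

/-- The functional `v ↦ E ∫_0^N ‖π_m (Z_t (X, b^{<m} + v))‖² |dX_t|` on `V^{⊗ m}`. -/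
noncomputable def varianceFunctional {Ω : Type*} [MeasurableSpace Ω] (P : Measure Ω) (s : Side)
    (N : ℕ) (X : ℝ → Ω → V) (b : ∀ n, α.T n) (m : ℕ) (v : α.T m) : ℝ≥0∞ :=
  ∫⁻ ω, (∫⁻ t in Icc 0 (N : ℝ),
    ‖sawtooth α s N (fun t => X t ω) (trunc α b m + Pi.single m v) m t‖ₑ ^ 2
      ∂(variationMeasure N fun t => X t ω)) ∂P

/-- `f ∈ C^m(V, L(V, W))` with gradients `D k = D^k f : V → L(V^{⊗ (k+1)}, W)`, `k ≤ m`: the `k`-th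
Fréchet derivative, a `(k+1)`-linear map (the argument of `f x ∈ L(V, W)` being the last one), is
identified with a bounded operator on `V^{⊗ (k+1)}` depending continuously on the point. -/
structure IsTensorGradient {W : Type*} [NormedAddCommGroup W] [NormedSpace ℝ W] (m : ℕ)
    (f : V → V →L[ℝ] W) (D : ∀ k : ℕ, V → α.T (k + 1) →L[ℝ] W) : Prop where
  contDiff : ContDiff ℝ m f
  continuous : ∀ k ≤ m, Continuous (D k)
  apply_pure : ∀ k ≤ m, ∀ (x : V) (v : Fin (k + 1) → V),
    D k x (α.pure v) = iteratedFDeriv ℝ k f x (Fin.init v) (v (Fin.last k))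

end

/-! ### The classical formula -/

/-- The index set `[[0, N]]^- = {0, …, N - 1}` or `[[0, N]]^+ = {1, …, N}`. -/
def Side.indices : Side → ℕ → Finset ℕ
  | .backward, N => Finset.range N
  | .forward, N => Finset.Icc 1 N

/-- The Bernoulli numbers `B^±_l`, with `B^-_1 = -1/2` and `B^+_1 = 1/2`. -/
noncomputable def Side.bernoulli : Side → ℕ → ℝ
  | .backward, l => (_root_.bernoulli l : ℝ)
  | .forward, l => (_root_.bernoulli' l : ℝ)

/-- Exchange of backward and forward. -/
def Side.flip : Side → Side
  | .backward => .forward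
  | .forward => .backward

end EML

open EML

/-! The formula is repeated integration by parts, carried out path by path. On an interval `[i, i +
1]` the anchor is constant, so Z¹ has the increments of X there and ∫ f(X) dX = ∫ f(X) dZ¹. Since
dZ^{k+2} = dX ⊗ Z^{k+1}, the product rule (`IsTensorGradient.product_rule`) reads d(D^k f(X)
Z^{k+1}) = D^k f(X) dZ^{k+1} + D^{k+1} f(X) dZ^{k+2}. For k = 0, its boundary terms on `[i, i + 1]`
are a term of the Riemann sum plus an increment of f(X) b₁; summation over i gives the formula of
order 1. From degree 2 on Z is continuous, and the rule on the whole of `[0, N]` trades each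
remainder for a boundary term and the next remainder. The choice of b plays no role here
(`IsTensorGradient.formula`), and the exceptional null set is that of the non-rectifiable paths,
whatever W, m and f are.

The analytic input is the existence of the integrals. Z¹ jumps at integers, but |dX| has no atoms
because the variation function of a continuous path is continuous; so Z¹ is bounded and |dX|-almost
everywhere continuous. For such integrands `exists_hasRSIntegral` extends the increments of X to a
vector measure dominated by |dX| and gets the convergence of Riemann–Stieltjes sums from dominated
convergence of step functions. The product rule itself is proved by comparing increments up to ε
times the increment of the variation (`sub_eq_sub_of_increments`). Measurability in ω follows
because integrals and variations are limits along uniform partitions.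

For the minimisation, b_m enters the degree m component only as an additive constant
(`sawtooth_add_single`). Hilbert tensor norms satisfy the parallelogram law, so the functional is a
quadratic polynomial in v with leading coefficient E ∫ |dX|. The optimal tensor is the centre found
by completing the square, and uniqueness of the whole series follows by induction on the degree.

For X_t = t, optimality says that each Z^l has integral zero over `[0, N]`. The periodic Bernoulli
functions P_l / l! have the same property, and each one is a primitive of the preceding one. By
induction Z^l and P_l / l! differ by a constant, which has zero mean and hence vanishes
(`sawtooth_id`). The classical formula is required for functions that are C^m on `[0, N]` only, so
it is proved directly, by integration by parts against the P_l (`euler_maclaurin`). -/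

namespace EML

open Filter Topology

/-! ### Tagged partitions and Riemann–Stieltjes sums -/

/-- `t 0 ≤ ⋯ ≤ t n` is a partition of `[a, b]` with mesh less than `δ` and tags `ξ`. -/
structure IsTaggedPartition (a b δ : ℝ) (n : ℕ) (t ξ : ℕ → ℝ) : Prop where
  mono : Monotone t
  left : t 0 = a
  right : t n = b
  tag : ∀ i < n, ξ i ∈ Icc (t i) (t (i + 1))
  mesh : ∀ i < n, t (i + 1) - t i < δ

theorem hasRSIntegral_iff {E F G : Type*} [AddGroup F] [NormedAddCommGroup G]
    {B : E → F → G} {A : ℝ → E} {Y : ℝ → F} {a b : ℝ} {I : G} :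
    HasRSIntegral B A Y a b I ↔ ∀ ε > 0, ∃ δ > 0, ∀ n t ξ, IsTaggedPartition a b δ n t ξ →
      ‖(∑ i ∈ Finset.range n, B (A (ξ i)) (Y (t (i + 1)) - Y (t i))) - I‖ < ε := by
  refine forall₂_congr fun ε _ => exists_congr fun δ => and_congr_right fun _ => ?_
  refine forall_congr' fun n => forall_congr' fun t => forall_congr' fun ξ => ?_
  constructor
  · rintro h ⟨h1, h2, h3, h4, h5⟩
    exact h h1 h2 h3 fun i hi => ⟨h4 i hi, h5 i hi⟩
  · intro h h1 h2 h3 h4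
    exact h ⟨h1, h2, h3, fun i hi => (h4 i hi).1, fun i hi => (h4 i hi).2⟩

namespace IsTaggedPartition

variable {a b δ : ℝ} {n : ℕ} {t ξ : ℕ → ℝ}

theorem le (h : IsTaggedPartition a b δ n t ξ) : a ≤ b := by
  rw [← h.left, ← h.right]
  exact h.mono (Nat.zero_le n)

theorem point_mem (h : IsTaggedPartition a b δ n t ξ) {i : ℕ} (hi : i ≤ n) : t i ∈ Icc a b := by
  rw [← h.left, ← h.right]
  exact ⟨h.mono (Nat.zero_le i), h.mono hi⟩

theorem tag_mem (h : IsTaggedPartition a b δ n t ξ) {i : ℕ} (hi : i < n) : ξ i ∈ Icc a b :=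
  ⟨(h.point_mem hi.le).1.trans (h.tag i hi).1, (h.tag i hi).2.trans (h.point_mem hi).2⟩

/-- Half-open cells tile `(a, b]` exactly, even when points of the partition are repeated: each r
lies in one cell, and by `disjoint` in no other. -/
theorem exists_mem (h : IsTaggedPartition a b δ n t ξ) {r : ℝ} (hr : r ∈ Ioc a b) :
    ∃ i < n, r ∈ Ioc (t i) (t (i + 1)) := by
  obtain ⟨-, rfl, rfl, -, -⟩ := h
  clear * - hr
  induction n with
  | zero => exact absurd hr.1 (not_lt.2 hr.2)
  | succ n ih =>
    by_cases h' : r ≤ t n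
    · obtain ⟨i, hi, hri⟩ := ih ⟨hr.1, h'⟩
      exact ⟨i, hi.trans n.lt_succ_self, hri⟩
    · exact ⟨n, n.lt_succ_self, not_le.1 h', hr.2⟩

theorem disjoint (h : IsTaggedPartition a b δ n t ξ) {i j : ℕ} (hij : i ≠ j) :
    Disjoint (Ioc (t i) (t (i + 1))) (Ioc (t j) (t (j + 1))) := by
  wlog hlt : i < j generalizing i j
  · exact (this hij.symm (lt_of_le_of_ne (not_lt.1 hlt) hij.symm)).symm
  exact Set.disjoint_left.2 fun r hr hr' =>
    absurd (hr.2.trans (h.mono hlt)) (not_le.2 hr'.1)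

end IsTaggedPartition

theorem tendsto_const_div_natCast_add_one (c : ℝ) :
    Tendsto (fun k : ℕ => c / ((k : ℝ) + 1)) atTop (𝓝 0) := by
  simpa [Function.comp_def] using
    (tendsto_const_div_atTop_nhds_zero_nat c).comp (tendsto_add_atTop_nat 1)

/-- The partition of `[a, b]` into `n` intervals of equal length. -/
noncomputable def uniformPoint (a b : ℝ) (n i : ℕ) : ℝ := a + (min i n : ℕ) / n * (b - a)

/-- The truncation `min i n` freezes the sequence after index n, so that it is monotone on all of ℕ,
as tagged partitions require. -/
theorem uniformPoint_monotone {a b : ℝ} (hab : a ≤ b) (n : ℕ) : Monotone (uniformPoint a b n) := by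
  intro i j hij
  unfold uniformPoint
  have : 0 ≤ b - a := sub_nonneg.2 hab
  gcongr

theorem isTaggedPartition_uniformPoint {a b : ℝ} (hab : a ≤ b) (n : ℕ) {δ : ℝ}
    (hδ : (b - a) / (n + 1) < δ) :
    IsTaggedPartition a b δ (n + 1) (uniformPoint a b (n + 1)) (uniformPoint a b (n + 1)) where
  mono := uniformPoint_monotone hab _
  left := by simp [uniformPoint]
  right := by
    have : ((n : ℝ) + 1) ≠ 0 := by positivity
    simp [uniformPoint, this]
  tag i _ := ⟨le_rfl, uniformPoint_monotone hab _ i.le_succ⟩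
  mesh i hi := by
    refine lt_of_le_of_lt (le_of_eq ?_) hδ
    have : ((n : ℝ) + 1) ≠ 0 := by positivity
    rw [uniformPoint, uniformPoint, min_eq_left hi, min_eq_left hi.le]
    push_cast
    field_simp
    ring

theorem exists_isTaggedPartition {a b : ℝ} (hab : a ≤ b) {δ : ℝ} (hδ : 0 < δ) :
    ∃ n t ξ, IsTaggedPartition a b δ n t ξ := by
  obtain ⟨n, hn⟩ := exists_nat_gt ((b - a) / δ)
  refine ⟨_, _, _, isTaggedPartition_uniformPoint hab n ?_⟩
  have : (0 : ℝ) < n + 1 := by positivity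
  rw [div_lt_iff₀ hδ] at hn
  rw [div_lt_iff₀ this]
  nlinarith

/-- The step function with value `A (ξ i)` on `(t i, t (i + 1)]`. -/
noncomputable def stepFun {E : Type*} [AddCommMonoid E] (A : ℝ → E) (n : ℕ) (t ξ : ℕ → ℝ)
    (r : ℝ) : E :=
  ∑ i ∈ Finset.range n, (Ioc (t i) (t (i + 1))).indicator (fun _ => A (ξ i)) r

section StepFun

variable {E : Type*} [NormedAddCommGroup E] {A : ℝ → E} {a b : ℝ}

theorem stepFun_apply {δ : ℝ} {n : ℕ} {t ξ : ℕ → ℝ} (h : IsTaggedPartition a b δ n t ξ) {i : ℕ}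
    (hi : i < n) {r : ℝ} (hr : r ∈ Ioc (t i) (t (i + 1))) : stepFun A n t ξ r = A (ξ i) := by
  rw [stepFun, Finset.sum_eq_single i]
  · exact indicator_of_mem hr _
  · intro j _ hji
    exact indicator_of_notMem (Set.disjoint_left.1 (h.disjoint hji.symm) hr) _
  · exact fun h' => absurd (Finset.mem_range.2 hi) h'

theorem stronglyMeasurable_stepFun (A : ℝ → E) (n : ℕ) (t ξ : ℕ → ℝ) :
    StronglyMeasurable (stepFun A n t ξ) := by
  unfold stepFun
  exact Finset.stronglyMeasurable_fun_sum _ fun i _ =>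
    stronglyMeasurable_const.indicator measurableSet_Ioc

/-- The tag of the cell that contains r is within one mesh of r and stays in `[a, b]`, so continuity
within `[a, b]` is all that is needed. -/
theorem tendsto_stepFun {δ : ℕ → ℝ} (hδ : Tendsto δ atTop (𝓝 0)) {n : ℕ → ℕ} {t ξ : ℕ → ℕ → ℝ}
    (h : ∀ k, IsTaggedPartition a b (δ k) (n k) (t k) (ξ k)) {r : ℝ} (hr : r ∈ Ioc a b)
    (hc : ContinuousWithinAt A (Icc a b) r) :
    Tendsto (fun k => stepFun A (n k) (t k) (ξ k) r) atTop (𝓝 (A r)) := by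
  choose i hi hri using fun k => (h k).exists_mem hr
  have heq : ∀ k, stepFun A (n k) (t k) (ξ k) r = A (ξ k (i k)) :=
    fun k => stepFun_apply (h k) (hi k) (hri k)
  simp only [heq]
  refine hc.tendsto.comp (tendsto_nhdsWithin_iff.2 ⟨?_, .of_forall fun k => (h k).tag_mem (hi k)⟩)
  refine tendsto_iff_dist_tendsto_zero.2 (squeeze_zero (fun _ => dist_nonneg) (fun k => ?_) hδ)
  rw [Real.dist_eq, abs_le]
  have h1 := (h k).tag _ (hi k)
  have h2 := (h k).mesh _ (hi k)
  have h3 := hri k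
  constructor <;> linarith [h1.1, h1.2, h3.1, h3.2]

theorem aestronglyMeasurable_of_ae_continuousWithinAt {ν : Measure ℝ}
    (hab : a ≤ b) (hc : ∀ᵐ r ∂ν.restrict (Ioc a b), ContinuousWithinAt A (Icc a b) r) :
    AEStronglyMeasurable A (ν.restrict (Ioc a b)) := by
  -- The mesh bound is strict, hence the extra 1 in the numerator.
  have hδ : Tendsto (fun k : ℕ => (b - a + 1) / ((k : ℝ) + 1)) atTop (𝓝 0) :=
    tendsto_const_div_natCast_add_one _
  have h : ∀ k : ℕ, IsTaggedPartition a b ((b - a + 1) / ((k : ℝ) + 1)) (k + 1)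
      (uniformPoint a b (k + 1)) (uniformPoint a b (k + 1)) := fun k =>
    isTaggedPartition_uniformPoint hab k (div_lt_div_of_pos_right (lt_add_one _) (by positivity))
  refine aestronglyMeasurable_of_tendsto_ae (atTop : Filter ℕ)
    (fun k => (stronglyMeasurable_stepFun A (k + 1) (uniformPoint a b (k + 1))
      (uniformPoint a b (k + 1))).aestronglyMeasurable) ?_
  filter_upwards [hc, ae_restrict_mem measurableSet_Ioc] with r hr hr'
  exact tendsto_stepFun hδ h hr' hr

/-- Step functions subordinate to fine partitions approximate a bounded, almost everywhere
continuous function in `L¹`. -/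
theorem lintegral_stepFun_sub_lt {ν : Measure ℝ} [IsFiniteMeasure ν] {C : ℝ}
    (hC : ∀ r ∈ Icc a b, ‖A r‖ ≤ C)
    (hc : ∀ᵐ r ∂ν.restrict (Ioc a b), ContinuousWithinAt A (Icc a b) r) {ε : ℝ≥0∞} (hε : 0 < ε) :
    ∃ δ > 0, ∀ n t ξ, IsTaggedPartition a b δ n t ξ →
      ∫⁻ r in Ioc a b, ‖stepFun A n t ξ r - A r‖ₑ ∂ν < ε := by
  -- A failure for every δ yields a sequence of partitions with meshes tending to 0, to which
  -- dominated convergence applies.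
  by_contra! H
  choose n t ξ h hle using fun k : ℕ => H (1 / ((k : ℝ) + 1)) (by positivity)
  have hA := aestronglyMeasurable_of_ae_continuousWithinAt (h 0).le hc
  have hlim : Tendsto (fun k => ∫⁻ r in Ioc a b, ‖stepFun A (n k) (t k) (ξ k) r - A r‖ₑ ∂ν) atTop
      (𝓝 (∫⁻ r in Ioc a b, 0 ∂ν)) := by
    refine tendsto_lintegral_of_dominated_convergence' (fun _ => ENNReal.ofReal (C + C))
      (fun k => ((stronglyMeasurable_stepFun A _ _ _).aestronglyMeasurable.sub hA).enorm) ?_ ?_ ?_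
    · intro k
      filter_upwards [ae_restrict_mem measurableSet_Ioc] with r hr
      obtain ⟨i, hi, hri⟩ := (h k).exists_mem hr
      rw [stepFun_apply (h k) hi hri, ← ofReal_norm]
      refine ENNReal.ofReal_le_ofReal ((norm_sub_le _ _).trans (add_le_add ?_ ?_))
      · exact hC _ ((h k).tag_mem hi)
      · exact hC _ ⟨hr.1.le, hr.2⟩
    · simp only [lintegral_const]
      exact ENNReal.mul_ne_top ENNReal.ofReal_ne_top (measure_ne_top _ _)
    · filter_upwards [hc, ae_restrict_mem measurableSet_Ioc] with r hr hr'
      have := (tendsto_stepFun tendsto_one_div_add_atTop_nhds_zero_nat h hr' hr).sub_const (A r)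
      simpa using this.enorm
  rw [lintegral_zero] at hlim
  exact absurd (ge_of_tendsto' hlim hle) (not_le.2 hε)

end StepFun

/-! ### Riemann–Stieltjes integrals -/

section RSIntegral

variable {E F G : Type*} [NormedAddCommGroup E] [NormedSpace ℝ E] [NormedAddCommGroup F]
  [NormedSpace ℝ F] [NormedAddCommGroup G] [NormedSpace ℝ G]

/-- Both values are close to the sum over one common fine partition. When `b < a` no partition
exists and every value is an integral, so `a ≤ b` cannot be dropped. -/
theorem HasRSIntegral.unique {E F G : Type*} [AddGroup F] [NormedAddCommGroup G]
    {B : E → F → G} {A : ℝ → E} {Y : ℝ → F} {a b : ℝ} (hab : a ≤ b) {I J : G}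
    (hI : HasRSIntegral B A Y a b I) (hJ : HasRSIntegral B A Y a b J) : I = J := by
  by_contra hne
  have hpos : 0 < ‖I - J‖ / 2 := half_pos (norm_pos_iff.2 (sub_ne_zero.2 hne))
  obtain ⟨δ, hδ, h⟩ := hasRSIntegral_iff.1 hI _ hpos
  obtain ⟨δ', hδ', h'⟩ := hasRSIntegral_iff.1 hJ _ hpos
  obtain ⟨n, t, ξ, hp⟩ := exists_isTaggedPartition hab (lt_min hδ hδ')
  have h1 := h n t ξ ⟨hp.1, hp.2, hp.3, hp.4, fun i hi => (hp.5 i hi).trans_le (min_le_left _ _)⟩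
  have h2 := h' n t ξ ⟨hp.1, hp.2, hp.3, hp.4, fun i hi => (hp.5 i hi).trans_le (min_le_right _ _)⟩
  have := norm_sub_le
    ((∑ i ∈ Finset.range n, B (A (ξ i)) (Y (t (i + 1)) - Y (t i))) - J)
    ((∑ i ∈ Finset.range n, B (A (ξ i)) (Y (t (i + 1)) - Y (t i))) - I)
  rw [sub_sub_sub_cancel_left] at this
  linarith

theorem HasRSIntegral.rsIntegral_eq {E F G : Type*} [AddGroup F] [NormedAddCommGroup G]
    {B : E → F → G} {A : ℝ → E} {Y : ℝ → F} {a b : ℝ} (hab : a ≤ b) {I : G}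
    (hI : HasRSIntegral B A Y a b I) : rsIntegral B A Y a b = I := by
  have h : ∃ I, HasRSIntegral B A Y a b I := ⟨I, hI⟩
  rw [rsIntegral, dif_pos h]
  exact h.choose_spec.unique hab hI

/-- Only the terms of the sums matter, so the integrand, the integrator and the pairing may all
change type. This identifies f(x) dx with D⁰f(x) dZ¹ and, for scalar paths, tensor integrals with
ordinary ones. -/
theorem HasRSIntegral.congr {E F E' F' G : Type*} [AddGroup F] [AddGroup F']
    [NormedAddCommGroup G] {B : E → F → G} {B' : E' → F' → G} {A : ℝ → E} {A' : ℝ → E'}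
    {Y : ℝ → F} {Y' : ℝ → F'} {a b : ℝ} {I : G}
    (hI : HasRSIntegral B A Y a b I)
    (hB : ∀ r ∈ Icc a b, ∀ u ∈ Icc a b, ∀ v ∈ Icc a b,
      B' (A' r) (Y' u - Y' v) = B (A r) (Y u - Y v)) :
    HasRSIntegral B' A' Y' a b I := by
  rw [hasRSIntegral_iff] at hI ⊢
  intro ε hε
  obtain ⟨δ, hδ, h⟩ := hI ε hε
  refine ⟨δ, hδ, fun n t ξ hp => ?_⟩
  rw [Finset.sum_congr rfl fun i hi => hB _ (hp.tag_mem (Finset.mem_range.1 hi)) _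
    (hp.point_mem (Finset.mem_range.1 hi)) _ (hp.point_mem (Finset.mem_range.1 hi).le)]
  exact h n t ξ hp

theorem HasRSIntegral.map {E F G H : Type*} [AddGroup F] [NormedAddCommGroup G] [NormedSpace ℝ G]
    [NormedAddCommGroup H] [NormedSpace ℝ H]
    {B : E → F → G} {A : ℝ → E} {Y : ℝ → F} {a b : ℝ} {I : G} (L : G →L[ℝ] H)
    (hI : HasRSIntegral B A Y a b I) :
    HasRSIntegral (fun e f => L (B e f)) A Y a b (L I) := by
  rw [hasRSIntegral_iff] at hI ⊢
  intro ε hε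
  obtain ⟨δ, hδ, h⟩ := hI (ε / (‖L‖ + 1)) (by positivity)
  refine ⟨δ, hδ, fun n t ξ hp => ?_⟩
  rw [← map_sum, ← map_sub]
  refine (L.le_opNorm _).trans_lt ?_
  have := h n t ξ hp
  rw [lt_div_iff₀ (by positivity)] at this
  nlinarith [norm_nonneg ((∑ i ∈ Finset.range n, B (A (ξ i)) (Y (t (i + 1)) - Y (t i))) - I)]

/-- A fixed sequence of left-tagged sums suffices once the integral is known to exist. Measurability
in ω and independence of the integrand's value at `b` both come from here. -/
theorem HasRSIntegral.tendsto_uniformPoint {E F G : Type*} [AddGroup F] [NormedAddCommGroup G]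
    {B : E → F → G} {A : ℝ → E} {Y : ℝ → F} {a b : ℝ} (hab : a ≤ b) {I : G}
    (hI : HasRSIntegral B A Y a b I) :
    Tendsto (fun n : ℕ => ∑ i ∈ Finset.range (n + 1), B (A (uniformPoint a b (n + 1) i))
      (Y (uniformPoint a b (n + 1) (i + 1)) - Y (uniformPoint a b (n + 1) i))) atTop (𝓝 I) := by
  rw [Metric.tendsto_atTop]
  intro ε hε
  obtain ⟨δ, hδ, h⟩ := hasRSIntegral_iff.1 hI ε hε
  have hlim : Tendsto (fun k : ℕ => (b - a) / ((k : ℝ) + 1)) atTop (𝓝 0) :=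
    tendsto_const_div_natCast_add_one _
  obtain ⟨k, hk⟩ := eventually_atTop.1 (hlim.eventually (gt_mem_nhds hδ))
  refine ⟨k, fun n hn => ?_⟩
  rw [dist_eq_norm]
  exact h _ _ _ (isTaggedPartition_uniformPoint hab n (hk n hn))

theorem hasRSIntegral_self {E F G : Type*} [AddGroup F] [NormedAddCommGroup G]
    {B : E → F → G} (hB : ∀ e, B e 0 = 0) (A : ℝ → E) (Y : ℝ → F) (a : ℝ) :
    HasRSIntegral B A Y a a 0 := by
  refine hasRSIntegral_iff.2 fun ε hε => ⟨1, one_pos, fun n t ξ hp => ?_⟩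
  have : ∀ i ≤ n, t i = a := fun i hi => by
    have := hp.point_mem hi
    exact le_antisymm this.2 this.1
  rw [Finset.sum_eq_zero fun i hi => ?_, sub_zero, norm_zero]
  · exact hε
  · have hi := Finset.mem_range.1 hi
    rw [this _ hi, this _ hi.le, sub_self, hB]

/-- A bound for Riemann–Stieltjes integrals of nearly constant integrands. -/
theorem HasRSIntegral.norm_sub_le {B : E →L[ℝ] F →L[ℝ] G} {A : ℝ → E} {Y : ℝ → F} {g : ℝ → ℝ}
    {a b : ℝ} (hab : a ≤ b) {I : G} (hI : HasRSIntegral (fun e f => B e f) A Y a b I)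
    (hY : ∀ u ∈ Icc a b, ∀ v ∈ Icc a b, u ≤ v → ‖Y v - Y u‖ ≤ g v - g u)
    {c : E} {ε : ℝ} (hε : ∀ r ∈ Icc a b, ‖A r - c‖ ≤ ε) :
    ‖I - B c (Y b - Y a)‖ ≤ ‖B‖ * ε * (g b - g a) := by
  refine le_of_forall_pos_lt_add fun η hη => ?_
  obtain ⟨δ, hδ, h⟩ := hasRSIntegral_iff.1 hI η hη
  obtain ⟨n, t, ξ, hp⟩ := exists_isTaggedPartition hab hδ
  have h1 := h n t ξ hp
  have hε0 : 0 ≤ ε := (norm_nonneg _).trans (hε a ⟨le_rfl, hab⟩)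
  -- The value for the constant integrand c telescopes over the same partition, so the two are
  -- compared cell by cell.
  have h2 : ‖(∑ i ∈ Finset.range n, B (A (ξ i)) (Y (t (i + 1)) - Y (t i)))
      - B c (Y b - Y a)‖ ≤ ‖B‖ * ε * (g b - g a) := by
    have e1 : Y b - Y a = ∑ i ∈ Finset.range n, (Y (t (i + 1)) - Y (t i)) := by
      rw [Finset.sum_range_sub (fun i => Y (t i)), hp.left, hp.right]
    have e2 : g b - g a = ∑ i ∈ Finset.range n, (g (t (i + 1)) - g (t i)) := by
      rw [Finset.sum_range_sub (fun i => g (t i)), hp.left, hp.right]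
    rw [e1, e2, map_sum, ← Finset.sum_sub_distrib, Finset.mul_sum]
    refine norm_sum_le_of_le _ fun i hi => ?_
    have hi := Finset.mem_range.1 hi
    rw [← sub_apply, ← map_sub]
    refine (B.le_opNorm₂ _ _).trans ?_
    gcongr
    · exact hε _ (hp.tag_mem hi)
    · exact hY _ (hp.point_mem hi.le) _ (hp.point_mem hi) (hp.mono i.le_succ)
  have h3 := _root_.norm_sub_le
    ((∑ i ∈ Finset.range n, B (A (ξ i)) (Y (t (i + 1)) - Y (t i))) - B c (Y b - Y a))
    ((∑ i ∈ Finset.range n, B (A (ξ i)) (Y (t (i + 1)) - Y (t i))) - I)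
  rw [sub_sub_sub_cancel_left] at h3
  linarith

open VectorMeasure in
/-- Existence of Riemann–Stieltjes integrals: a bounded integrand which is almost everywhere
continuous with respect to a measure dominating the increments of the integrator has an indefinite
Riemann–Stieltjes integral. -/
theorem exists_hasRSIntegral [CompleteSpace F] [CompleteSpace G] (B : E →L[ℝ] F →L[ℝ] G)
    {A : ℝ → E} {Y : ℝ → F} {ν : Measure ℝ} [IsFiniteMeasure ν] {a b : ℝ} (hab : a ≤ b)
    (hY : ∀ u ∈ Icc a b, ∀ v ∈ Icc a b, u ≤ v → ‖Y v - Y u‖ₑ ≤ ν (Ioc u v)) {C : ℝ}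
    (hC : ∀ r ∈ Icc a b, ‖A r‖ ≤ C)
    (hc : ∀ᵐ r ∂ν.restrict (Ioc a b), ContinuousWithinAt A (Icc a b) r) :
    ∃ Φ : ℝ → G, ∀ s ∈ Icc a b, ∀ t ∈ Icc a b, s ≤ t →
      HasRSIntegral (fun e f => B e f) A Y s t (Φ t - Φ s) := by
  -- Y is extended by constants outside `[a, b]`, so that its increments are dominated by ν on every
  -- interval of the line.
  let Y' : ℝ → F := fun r => Y (projIcc a b hab r)
  have hY' : ∀ u v, u ≤ v → ‖Y' v - Y' u‖ₑ ≤ ν (Ioc u v) := by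
    intro u v huv
    refine (hY _ (projIcc a b hab u).2 _ (projIcc a b hab v).2
      (monotone_projIcc hab huv)).trans ?_
    -- Either the projected interval is a point and the increment vanishes, or it is contained in
    -- `(u, v]`.
    rcases eq_or_lt_of_le (monotone_projIcc hab huv) with h | h
    · simp [h]
    · refine measure_mono (Ioc_subset_Ioc ?_ ?_)
      · rw [coe_projIcc]
        rw [← Subtype.coe_lt_coe, coe_projIcc, coe_projIcc] at h
        rcases le_total b u with hbu | hbu
        · rw [min_eq_left hbu, min_eq_left (hbu.trans huv)] at h
          exact absurd h (lt_irrefl _)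
        · rw [min_eq_right hbu]; exact le_max_right _ _
      · rw [coe_projIcc]
        rw [← Subtype.coe_lt_coe, coe_projIcc, coe_projIcc] at h
        rcases le_total a v with hav | hav
        · exact max_le hav (min_le_right _ _)
        · have := max_eq_left ((min_le_right b v).trans hav)
          have h'' := max_eq_left ((min_le_right b u).trans (huv.trans hav))
          rw [this, h''] at h
          exact absurd h (lt_irrefl _)
  have hgen : (borel ℝ) = MeasurableSpace.generateFrom {s | ∃ u v : ℝ, u ≤ v ∧ s = Ioc u v} := by
    refine (borel_eq_generateFrom_Ioc_le ℝ).trans (congrArg _ ?_)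
    ext S
    simp only [mem_ofPred_eq, eq_comm (a := S)]
  rw [← BorelSpace.measurable_eq (α := ℝ)] at hgen
  -- The additive function (u, v] ↦ Y'(v) − Y'(u) is dominated by the finite measure ν and hence
  -- extends to a vector measure m with variation at most ν. Integrability with respect to ν then
  -- suffices throughout.
  obtain ⟨m, hm, hmν⟩ := VectorMeasure.exists_extension_of_isSetSemiring_of_le_measure_of_generateFrom
    (μ := ν) (m := AddContent.onIoc Y') IsSetSemiring.Ioc (by
      rintro s ⟨u, v, huv, rfl⟩
      rw [AddContent.onIoc_apply huv]
      exact hY' u v huv) hgen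
  have hmY : ∀ u ∈ Icc a b, ∀ v ∈ Icc a b, u ≤ v → m (Ioc u v) = Y v - Y u := by
    intro u hu v hv huv
    rw [hm _ ⟨u, v, huv, rfl⟩, AddContent.onIoc_apply huv]
    simp only [Y', projIcc_of_mem hab hu, projIcc_of_mem hab hv]
  have hvar : m.variation ≤ ν := variation_le_of_forall_enorm_le fun s _ => hmν s
  have : IsFiniteMeasure m.variation := isFiniteMeasure_of_le _ hvar
  have hAm : AEStronglyMeasurable A (ν.restrict (Ioc a b)) :=
    aestronglyMeasurable_of_ae_continuousWithinAt hab hc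
  have hAi : IntegrableOn A (Ioc a b) ν := by
    refine ⟨hAm, HasFiniteIntegral.of_bounded (C := C) ?_⟩
    filter_upwards [ae_restrict_mem measurableSet_Ioc] with r hr using hC r ⟨hr.1.le, hr.2⟩
  have hAint : ∀ s ∈ Icc a b, ∀ t ∈ Icc a b, m.IntegrableOn A (Ioc s t) := by
    intro s hs t ht
    rw [VectorMeasure.IntegrableOn, VectorMeasure.Integrable, variation_restrict measurableSet_Ioc]
    exact MeasureTheory.Integrable.mono_measure hAi ((Measure.restrict_mono (Ioc_subset_Ioc hs.1 ht.2) hvar))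
  refine ⟨fun t => ∫ᵛ r in Ioc a t, A r ∂[B; m], fun s hs t ht hst => ?_⟩
  have hsplit : (∫ᵛ r in Ioc a t, A r ∂[B; m]) - (∫ᵛ r in Ioc a s, A r ∂[B; m])
      = ∫ᵛ r in Ioc s t, A r ∂[B; m] := by
    rw [← Ioc_union_Ioc_eq_Ioc hs.1 hst, VectorMeasure.setIntegral_union
      (Ioc_disjoint_Ioc_of_le le_rfl) measurableSet_Ioc measurableSet_Ioc
      (hAint _ ⟨le_rfl, hab⟩ _ hs) (hAint _ hs _ ht), add_sub_cancel_left]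
  rw [hsplit, hasRSIntegral_iff]
  intro ε hε
  have hcst : ∀ᵐ r ∂ν.restrict (Ioc s t), ContinuousWithinAt A (Icc s t) r := by
    filter_upwards [ae_mono (Measure.restrict_mono (Ioc_subset_Ioc hs.1 ht.2) le_rfl) hc] with r hr
    exact hr.mono (Icc_subset_Icc hs.1 ht.2)
  -- The L¹ error will be multiplied by ‖B‖; the summand 1 covers the case B = 0.
  obtain ⟨δ, hδ, h⟩ := lintegral_stepFun_sub_lt (ν := ν)
    (fun r hr => hC r (Icc_subset_Icc hs.1 ht.2 hr)) hcst
    (ε := ENNReal.ofReal (ε / (‖B‖ + 1))) (ENNReal.ofReal_pos.2 (by positivity))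
  refine ⟨δ, hδ, fun n p ξ hp => ?_⟩
  -- A Riemann–Stieltjes sum is the exact integral of the step function, so its error is controlled
  -- by an L¹ distance.
  have hstep : ∫ᵛ r in Ioc s t, stepFun A n p ξ r ∂[B; m]
      = ∑ i ∈ Finset.range n, B (A (ξ i)) (Y (p (i + 1)) - Y (p i)) := by
    unfold stepFun
    rw [VectorMeasure.integral_finsetSum]
    · refine Finset.sum_congr rfl fun i hi => ?_
      have hi := Finset.mem_range.1 hi
      have hsub : Ioc s t ∩ Ioc (p i) (p (i + 1)) = Ioc (p i) (p (i + 1)) :=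
        inter_eq_right.2 (Ioc_subset_Ioc (hp.point_mem hi.le).1 (hp.point_mem hi).2)
      rw [VectorMeasure.setIntegral_indicator measurableSet_Ioc measurableSet_Ioc, hsub,
        VectorMeasure.setIntegral_const, hmY _ _ _ _ (hp.mono i.le_succ)]
      · exact Icc_subset_Icc hs.1 ht.2 (hp.point_mem hi.le)
      · exact Icc_subset_Icc hs.1 ht.2 (hp.point_mem hi)
    · intro i _
      refine Integrable.indicator ?_ measurableSet_Ioc
      have : IsFiniteMeasure (m.restrict (Ioc s t)).variation := by
        rw [variation_restrict measurableSet_Ioc]; infer_instance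
      exact integrable_const _
  have hstepint : m.IntegrableOn (stepFun A n p ξ) (Ioc s t) := by
    rw [VectorMeasure.IntegrableOn, VectorMeasure.Integrable, variation_restrict measurableSet_Ioc]
    unfold stepFun
    exact integrable_finsetSum _ fun i _ => (integrable_const _).indicator measurableSet_Ioc
  rw [← hstep, ← VectorMeasure.integral_fun_sub hstepint (hAint s hs t ht)]
  have h1 : ‖∫ᵛ r in Ioc s t, (stepFun A n p ξ r - A r) ∂[B; m]‖ₑ
      ≤ ‖B‖ₑ * ∫⁻ r in Ioc s t, ‖stepFun A n p ξ r - A r‖ₑ ∂ν := by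
    refine enorm_setIntegral_le_lintegral_enorm.trans ?_
    gcongr
  have h2 : ‖∫ᵛ r in Ioc s t, (stepFun A n p ξ r - A r) ∂[B; m]‖ₑ
      ≤ ENNReal.ofReal (‖B‖ * (ε / (‖B‖ + 1))) := by
    refine h1.trans ?_
    rw [ENNReal.ofReal_mul (norm_nonneg B), ofReal_norm]
    gcongr
    exact (h n p ξ hp).le
  rw [← ofReal_norm, ENNReal.ofReal_le_ofReal_iff (by positivity)] at h2
  refine h2.trans_lt ?_
  rw [← mul_div_assoc, div_lt_iff₀ (by positivity)]
  nlinarith [norm_nonneg B]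

/-- Riemann–Stieltjes integrals against an integrator with a bounded density. -/
theorem hasRSIntegral_integral_density [CompleteSpace E] {A : ℝ → E} {g h : ℝ → ℝ} {ν : Measure ℝ}
    [IsFiniteMeasure ν] {a b M : ℝ}
    (hg : ∀ u ∈ Icc a b, ∀ v ∈ Icc a b, u ≤ v → ∫ r in Ioc u v, h r ∂ν = g v - g u)
    (hm : AEStronglyMeasurable h (ν.restrict (Ioc a b))) (hM : ∀ r, ‖h r‖ ≤ M) {C : ℝ}
    (hC : ∀ r ∈ Icc a b, ‖A r‖ ≤ C)
    (hc : ∀ᵐ r ∂ν.restrict (Ioc a b), ContinuousWithinAt A (Icc a b) r) :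
    HasRSIntegral (fun (e : E) (c : ℝ) => c • e) A g a b (∫ r in Ioc a b, h r • A r ∂ν) := by
  rw [hasRSIntegral_iff]
  intro ε hε
  have hM0 : 0 ≤ M := (norm_nonneg _).trans (hM 0)
  have hM1 : 0 < M + 1 := by linarith
  obtain ⟨δ, hδ, hlt⟩ := lintegral_stepFun_sub_lt (ν := ν) hC hc
    (ε := ENNReal.ofReal (ε / (M + 1))) (ENNReal.ofReal_pos.2 (div_pos hε hM1))
  refine ⟨δ, hδ, fun n p ξ hp => ?_⟩
  have hh : IntegrableOn h (Ioc a b) ν :=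
    Integrable.of_bound hm M (.of_forall hM)
  have hAi : IntegrableOn (fun r => h r • A r) (Ioc a b) ν := by
    refine Integrable.of_bound
      (hm.smul (aestronglyMeasurable_of_ae_continuousWithinAt hp.le hc)) (M * C) ?_
    filter_upwards [ae_restrict_mem measurableSet_Ioc] with r hr
    rw [norm_smul]
    exact mul_le_mul (hM r) (hC r ⟨hr.1.le, hr.2⟩) (norm_nonneg _) hM0
  have hi1 : ∀ i, IntegrableOn ((Ioc (p i) (p (i + 1))).indicator fun r => h r • A (ξ i))
      (Ioc a b) ν := fun i => (hh.smul_const _).indicator measurableSet_Ioc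
  have hstepeq : (fun r => h r • stepFun A n p ξ r) = fun r => ∑ i ∈ Finset.range n,
      (Ioc (p i) (p (i + 1))).indicator (fun r => h r • A (ξ i)) r := by
    funext r
    rw [stepFun, Finset.smul_sum]
    exact Finset.sum_congr rfl fun i _ => (indicator_smul_apply _ h (fun _ => A (ξ i)) r).symm
  have hstepint : IntegrableOn (fun r => h r • stepFun A n p ξ r) (Ioc a b) ν := by
    rw [hstepeq]
    exact integrable_finsetSum _ fun i _ => hi1 i
  -- The increments of g are integrals of h, so the sum is the integral of h times the step
  -- function; the error is at most M times an L¹ distance.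
  have hstep : ∫ r in Ioc a b, h r • stepFun A n p ξ r ∂ν
      = ∑ i ∈ Finset.range n, (g (p (i + 1)) - g (p i)) • A (ξ i) := by
    rw [hstepeq, integral_finsetSum _ fun i _ => hi1 i]
    refine Finset.sum_congr rfl fun i hi => ?_
    have hi := Finset.mem_range.1 hi
    have hsub : Ioc a b ∩ Ioc (p i) (p (i + 1)) = Ioc (p i) (p (i + 1)) :=
      inter_eq_right.2 (Ioc_subset_Ioc (hp.point_mem hi.le).1 (hp.point_mem hi).2)
    rw [MeasureTheory.setIntegral_indicator measurableSet_Ioc, hsub, integral_smul_const,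
      hg _ (hp.point_mem hi.le) _ (hp.point_mem hi) (hp.mono i.le_succ)]
  rw [← hstep, ← integral_sub hstepint hAi]
  simp only [← smul_sub]
  have h1 : ‖∫ r in Ioc a b, h r • (stepFun A n p ξ r - A r) ∂ν‖ₑ
      ≤ ENNReal.ofReal M * ∫⁻ r in Ioc a b, ‖stepFun A n p ξ r - A r‖ₑ ∂ν := by
    refine (enorm_integral_le_lintegral_enorm _).trans ?_
    rw [← lintegral_const_mul' _ _ ENNReal.ofReal_ne_top]
    refine lintegral_mono fun r => ?_
    rw [enorm_smul, ← ofReal_norm (h r)]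
    gcongr
    exact hM r
  have h2 := h1.trans (mul_le_mul_right (hlt n p ξ hp).le _)
  rw [← ofReal_norm, ← ENNReal.ofReal_mul hM0, ENNReal.ofReal_le_ofReal_iff (by positivity)] at h2
  refine h2.trans_lt ?_
  rw [mul_div_assoc', div_lt_iff₀ hM1]
  nlinarith

/-- The Bochner integral against a Stieltjes measure as a Riemann–Stieltjes integral. -/
theorem hasRSIntegral_integral [CompleteSpace E] {A : ℝ → E} {g : ℝ → ℝ} {ν : Measure ℝ}
    [IsFiniteMeasure ν] {a b : ℝ}
    (hg : ∀ u ∈ Icc a b, ∀ v ∈ Icc a b, u ≤ v → ν.real (Ioc u v) = g v - g u) {C : ℝ}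
    (hC : ∀ r ∈ Icc a b, ‖A r‖ ≤ C)
    (hc : ∀ᵐ r ∂ν.restrict (Ioc a b), ContinuousWithinAt A (Icc a b) r) :
    HasRSIntegral (fun (e : E) (c : ℝ) => c • e) A g a b (∫ r in Ioc a b, A r ∂ν) := by
  have h := hasRSIntegral_integral_density (h := fun _ => 1) (g := g) (M := 1)
    (fun u hu v hv huv => by simpa using hg u hu v hv huv)
    aestronglyMeasurable_const (fun _ => by simp) hC hc
  simpa only [one_smul] using h

end RSIntegral

/-! ### Comparison of increments -/

/-- Two functions on `[a, b]` whose increments agree up to `o(g t - g s)` differ by a constant. -/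
theorem sub_eq_sub_of_increments {G : Type*} [NormedAddCommGroup G] {Φ Ψ : ℝ → G} {g : ℝ → ℝ}
    {a b : ℝ} (hab : a ≤ b)
    (h : ∀ ε > 0, ∃ δ > 0, ∀ s ∈ Icc a b, ∀ t ∈ Icc a b, s ≤ t → t - s < δ →
      ‖(Φ t - Φ s) - (Ψ t - Ψ s)‖ ≤ ε * (g t - g s)) :
    Φ b - Φ a = Ψ b - Ψ a := by
  rw [← sub_eq_zero, ← norm_le_zero_iff]
  refine le_of_forall_pos_le_add fun η hη => ?_
  -- The errors on the cells telescope to ε (g b − g a), which this choice of ε keeps below η.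
  obtain ⟨δ, hδ, h⟩ := h (η / (|g b - g a| + 1)) (by positivity)
  obtain ⟨n, t, ξ, hp⟩ := exists_isTaggedPartition hab hδ
  have e1 : (Φ b - Φ a) - (Ψ b - Ψ a) = ∑ i ∈ Finset.range n,
      ((Φ (t (i + 1)) - Φ (t i)) - (Ψ (t (i + 1)) - Ψ (t i))) := by
    rw [Finset.sum_sub_distrib, Finset.sum_range_sub (fun i => Φ (t i)),
      Finset.sum_range_sub (fun i => Ψ (t i)), hp.left, hp.right]
  have e2 : g b - g a = ∑ i ∈ Finset.range n, (g (t (i + 1)) - g (t i)) := by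
    rw [Finset.sum_range_sub (fun i => g (t i)), hp.left, hp.right]
  have : ‖(Φ b - Φ a) - (Ψ b - Ψ a)‖ ≤ η / (|g b - g a| + 1) * (g b - g a) := by
    rw [e1]
    refine le_of_le_of_eq ?_ (congrArg (η / (|g b - g a| + 1) * ·) e2.symm)
    rw [Finset.mul_sum]
    refine norm_sum_le_of_le _ fun i hi => ?_
    have hi := Finset.mem_range.1 hi
    refine h _ (hp.point_mem hi.le) _ (hp.point_mem hi) (hp.mono i.le_succ) (hp.mesh i hi)
  rw [zero_add]
  refine this.trans ?_
  rw [div_mul_eq_mul_div, div_le_iff₀ (by positivity)]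
  nlinarith [le_abs_self (g b - g a)]


/-! ### Rectifiable paths and their variation measure -/

/-- A continuous path of bounded variation on `[0, N]`. -/
structure IsRectifiablePath {V : Type*} [NormedAddCommGroup V] (N : ℕ) (x : ℝ → V) : Prop where
  continuousOn : ContinuousOn x (Icc 0 (N : ℝ))
  boundedVariationOn : BoundedVariationOn x (Icc 0 (N : ℝ))

/-- The variation of the path `x` on `[0, N] ∩ (-∞, t]`. -/
noncomputable def variationFn {V : Type*} [NormedAddCommGroup V] (N : ℕ) (x : ℝ → V) (t : ℝ) : ℝ :=
  (eVariationOn x (Icc 0 (N : ℝ) ∩ Iic t)).toReal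

namespace IsRectifiablePath

variable {V : Type*} [NormedAddCommGroup V] {N : ℕ} {x : ℝ → V}

theorem zero_mem (N : ℕ) : (0 : ℝ) ∈ Icc 0 (N : ℝ) := ⟨le_rfl, N.cast_nonneg⟩

theorem right_mem (N : ℕ) : (N : ℝ) ∈ Icc 0 (N : ℝ) := ⟨N.cast_nonneg, le_rfl⟩

theorem eVariationOn_ne_top (h : IsRectifiablePath N x) (t : ℝ) :
    eVariationOn x (Icc 0 (N : ℝ) ∩ Iic t) ≠ ∞ :=
  h.boundedVariationOn.mono inter_subset_left

theorem variationFn_mono (h : IsRectifiablePath N x) : Monotone (variationFn N x) := fun _ _ hst =>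
  ENNReal.toReal_mono (h.eVariationOn_ne_top _)
    (eVariationOn.mono x (inter_subset_inter_right _ (Iic_subset_Iic.2 hst)))

theorem variationFn_eq {t : ℝ} (ht : 0 ≤ t) :
    variationFn N x t = variationOnFromTo x (Icc 0 (N : ℝ)) 0 t := by
  rw [variationOnFromTo, if_pos ht, variationFn]
  congr 2
  ext r
  simp only [mem_inter_iff, mem_Icc, mem_Iic]
  tauto

theorem variationFn_right : variationFn N x N = (eVariationOn x (Icc 0 (N : ℝ))).toReal := by
  rw [variationFn, inter_eq_left.2 fun r hr => hr.2]

theorem variationFn_zero : variationFn N x 0 = 0 := by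
  rw [variationFn_eq le_rfl, variationOnFromTo.self]

/-- The variation function is constant outside `[0, N]`; this turns continuity on `[0, N]` into
continuity on the line. -/
theorem variationFn_projIcc (t : ℝ) :
    variationFn N x (projIcc 0 (N : ℝ) N.cast_nonneg t) = variationFn N x t := by
  rw [coe_projIcc]
  rcases le_total 0 t with ht | ht
  · rw [max_eq_right (le_min N.cast_nonneg ht), variationFn, variationFn]
    congr 2
    ext r
    simp only [mem_inter_iff, mem_Icc, mem_Iic, le_min_iff]
    tauto
  · rw [min_eq_right (ht.trans N.cast_nonneg), max_eq_left ht, variationFn_zero, variationFn,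
      eVariationOn.subsingleton, ENNReal.toReal_zero]
    intro r hr r' hr'
    have h1 := hr.1.1.antisymm (hr.2.trans ht)
    have h2 := hr'.1.1.antisymm (hr'.2.trans ht)
    rw [← h1, ← h2]

theorem norm_sub_le (h : IsRectifiablePath N x) {u v : ℝ} (hu : u ∈ Icc 0 (N : ℝ))
    (hv : v ∈ Icc 0 (N : ℝ)) (huv : u ≤ v) :
    ‖x v - x u‖ ≤ variationFn N x v - variationFn N x u := by
  rw [variationFn_eq hu.1, variationFn_eq hv.1,
    ← variationOnFromTo.add h.boundedVariationOn.locallyBoundedVariationOn (zero_mem N) hu hv,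
    add_sub_cancel_left, variationOnFromTo.eq_of_le _ _ huv, ← dist_eq_norm]
  exact (h.boundedVariationOn.mono inter_subset_left).dist_le ⟨hv, huv, le_rfl⟩ ⟨hu, le_rfl, huv⟩

/-- A one-sided jump of the variation function equals the corresponding jump of x, which is zero. -/
theorem continuous_variationFn (h : IsRectifiablePath N x) : Continuous (variationFn N x) := by
  have hc : ContinuousOn (variationOnFromTo x (Icc 0 (N : ℝ)) 0) (Icc 0 (N : ℝ)) := by
    intro t ht
    have hl := variationOnFromTo.tendsto_left (zero_mem N) ht
      h.boundedVariationOn.locallyBoundedVariationOn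
      ((h.continuousOn t ht).mono inter_subset_left)
    have hr := variationOnFromTo.tendsto_right (zero_mem N) ht
      h.boundedVariationOn.locallyBoundedVariationOn
      ((h.continuousOn t ht).mono inter_subset_left)
    rw [dist_self, sub_zero] at hl
    rw [dist_self, add_zero] at hr
    have : Icc 0 (N : ℝ) ⊆ (Icc 0 (N : ℝ) ∩ Iio t ∪ Icc 0 (N : ℝ) ∩ Ioi t) ∪ {t} := by
      intro r hr
      rcases lt_trichotomy r t with h' | h' | h'
      · exact Or.inl (Or.inl ⟨hr, h'⟩)
      · exact Or.inr h'
      · exact Or.inl (Or.inr ⟨hr, h'⟩)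
    refine ContinuousWithinAt.mono ?_ this
    refine ContinuousWithinAt.union (ContinuousWithinAt.union hl hr) continuousWithinAt_singleton
  have : variationFn N x
      = fun t => variationOnFromTo x (Icc 0 (N : ℝ)) 0 (projIcc 0 (N : ℝ) N.cast_nonneg t) := by
    funext t
    rw [← variationFn_projIcc, variationFn_eq (projIcc 0 (N : ℝ) N.cast_nonneg t).2.1]
  rw [this]
  exact hc.comp_continuous (continuous_subtype_val.comp continuous_projIcc) fun t => Subtype.prop _

theorem variationMeasure_eq (h : IsRectifiablePath N x) :
    variationMeasure N x = h.variationFn_mono.stieltjesFunction.measure := by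
  have h' : Monotone fun t : ℝ => (eVariationOn x (Icc 0 (N : ℝ) ∩ Iic t)).toReal :=
    h.variationFn_mono
  rw [variationMeasure, dif_pos h']
  rfl

theorem stieltjesFunction_apply (h : IsRectifiablePath N x) (t : ℝ) :
    h.variationFn_mono.stieltjesFunction t = variationFn N x t := by
  rw [Monotone.stieltjesFunction_eq]
  exact (h.continuous_variationFn.continuousWithinAt).rightLim_eq

theorem variationMeasure_Ioc (h : IsRectifiablePath N x) (u v : ℝ) :
    variationMeasure N x (Ioc u v) = ENNReal.ofReal (variationFn N x v - variationFn N x u) := by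
  rw [h.variationMeasure_eq, StieltjesFunction.measure_Ioc, h.stieltjesFunction_apply,
    h.stieltjesFunction_apply]

theorem variationMeasure_real_Ioc (h : IsRectifiablePath N x) {u v : ℝ} (huv : u ≤ v) :
    (variationMeasure N x).real (Ioc u v) = variationFn N x v - variationFn N x u := by
  rw [Measure.real, h.variationMeasure_Ioc,
    ENNReal.toReal_ofReal (sub_nonneg.2 (h.variationFn_mono huv))]

/-- Absence of atoms makes the jumps of Z¹ at integers negligible for |dx|. -/
theorem variationMeasure_singleton (h : IsRectifiablePath N x) (r : ℝ) :
    variationMeasure N x {r} = 0 := by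
  rw [h.variationMeasure_eq, StieltjesFunction.measure_singleton]
  have : (h.variationFn_mono.stieltjesFunction : ℝ → ℝ) = variationFn N x :=
    funext h.stieltjesFunction_apply
  rw [this, (h.continuous_variationFn.continuousWithinAt).leftLim_eq, sub_self,
    ENNReal.ofReal_zero]

theorem nullSingletonClass (h : IsRectifiablePath N x) : NullSingletonClass (variationMeasure N x) :=
  ⟨h.variationMeasure_singleton⟩

theorem isFiniteMeasure (h : IsRectifiablePath N x) : IsFiniteMeasure (variationMeasure N x) := by
  rw [h.variationMeasure_eq]
  refine StieltjesFunction.isFiniteMeasure_of_forall_abs_le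
    (C := (eVariationOn x (Icc 0 (N : ℝ))).toReal) _ fun t => ?_
  rw [h.stieltjesFunction_apply, variationFn, abs_of_nonneg ENNReal.toReal_nonneg]
  exact ENNReal.toReal_mono h.boundedVariationOn (eVariationOn.mono x inter_subset_left)

theorem variationMeasure_Icc (h : IsRectifiablePath N x) :
    variationMeasure N x (Icc 0 (N : ℝ)) = eVariationOn x (Icc 0 (N : ℝ)) := by
  have := h.nullSingletonClass
  rw [← measure_congr (Ioc_ae_eq_Icc (α := ℝ)), h.variationMeasure_Ioc, variationFn_zero, sub_zero,
    variationFn_right, ENNReal.ofReal_toReal h.boundedVariationOn]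

theorem restrict_Icc (h : IsRectifiablePath N x) :
    (variationMeasure N x).restrict (Icc 0 (N : ℝ)) =
      (variationMeasure N x).restrict (Ioc 0 (N : ℝ)) := by
  have := h.nullSingletonClass
  exact (Measure.restrict_congr_set Ioc_ae_eq_Icc).symm

theorem enorm_sub_le (h : IsRectifiablePath N x) {u v : ℝ} (hu : u ∈ Icc 0 (N : ℝ))
    (hv : v ∈ Icc 0 (N : ℝ)) (huv : u ≤ v) :
    ‖x v - x u‖ₑ ≤ variationMeasure N x (Ioc u v) := by
  rw [h.variationMeasure_Ioc, ← ofReal_norm]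
  exact ENNReal.ofReal_le_ofReal (h.norm_sub_le hu hv huv)

theorem variationFn_le (h : IsRectifiablePath N x) (t : ℝ) :
    variationFn N x t ≤ (eVariationOn x (Icc 0 (N : ℝ))).toReal :=
  ENNReal.toReal_mono h.boundedVariationOn (eVariationOn.mono x inter_subset_left)

theorem norm_sub_le_total (h : IsRectifiablePath N x) {u v : ℝ} (hu : u ∈ Icc 0 (N : ℝ))
    (hv : v ∈ Icc 0 (N : ℝ)) : ‖x v - x u‖ ≤ (eVariationOn x (Icc 0 (N : ℝ))).toReal := by
  rw [← dist_eq_norm]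
  exact h.boundedVariationOn.dist_le hv hu

end IsRectifiablePath

/-- A path whose increments are dominated by those of a monotone function has bounded variation. -/
theorem boundedVariationOn_of_norm_sub_le {E : Type*} [NormedAddCommGroup E] {y : ℝ → E}
    {g : ℝ → ℝ} {a b : ℝ} (hab : a ≤ b)
    (h : ∀ u ∈ Icc a b, ∀ v ∈ Icc a b, u ≤ v → ‖y v - y u‖ ≤ g v - g u) :
    BoundedVariationOn y (Icc a b) := by
  refine ne_top_of_le_ne_top (ENNReal.ofReal_ne_top (r := g b - g a)) ?_
  refine iSup_le fun ⟨n, u, hu, hus⟩ => ?_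
  have hg : ∀ i, 0 ≤ g (u (i + 1)) - g (u i) := fun i =>
    (norm_nonneg _).trans (h _ (hus i) _ (hus (i + 1)) (hu i.le_succ))
  calc ∑ i ∈ Finset.range n, edist (y (u (i + 1))) (y (u i))
      ≤ ∑ i ∈ Finset.range n, ENNReal.ofReal (g (u (i + 1)) - g (u i)) := by
        refine Finset.sum_le_sum fun i _ => ?_
        rw [edist_dist, dist_eq_norm]
        exact ENNReal.ofReal_le_ofReal (h _ (hus i) _ (hus (i + 1)) (hu i.le_succ))
    _ = ENNReal.ofReal (g (u n) - g (u 0)) := by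
        rw [← ENNReal.ofReal_sum_of_nonneg fun i _ => hg i, Finset.sum_range_sub fun i => g (u i)]
    _ ≤ ENNReal.ofReal (g b - g a) := by
        refine ENNReal.ofReal_le_ofReal ?_
        -- Monotonicity of g on `[a, b]` is contained in the hypothesis, norms being nonnegative.
        have h1 := (norm_nonneg _).trans (h _ ⟨le_rfl, hab⟩ _ (hus 0) (hus 0).1)
        have h2 := (norm_nonneg _).trans (h _ (hus n) _ ⟨hab, le_rfl⟩ (hus n).2)
        linarith

theorem continuousOn_of_norm_sub_le {E : Type*} [NormedAddCommGroup E] {y : ℝ → E}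
    {g : ℝ → ℝ} {a b : ℝ} (hg : ContinuousOn g (Icc a b))
    (h : ∀ u ∈ Icc a b, ∀ v ∈ Icc a b, u ≤ v → ‖y v - y u‖ ≤ g v - g u) :
    ContinuousOn y (Icc a b) := by
  intro t ht
  rw [ContinuousWithinAt, tendsto_iff_dist_tendsto_zero]
  have := tendsto_iff_dist_tendsto_zero.1 (hg t ht)
  refine squeeze_zero' (.of_forall fun _ => dist_nonneg) ?_ this
  filter_upwards [self_mem_nhdsWithin] with r hr
  rcases le_total r t with hrt | hrt
  · rw [dist_comm, dist_eq_norm, dist_comm, Real.dist_eq]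
    exact (h r hr t ht hrt).trans (le_abs_self _)
  · rw [dist_eq_norm, Real.dist_eq]
    exact (h t ht r hr hrt).trans (le_abs_self _)


/-! ### Prepending a vector to a tensor -/

namespace AdmissibleNorm

variable {V : Type*} [NormedAddCommGroup V] [NormedSpace ℝ V] (α : AdmissibleNorm V)

/-- The canonical linear map from `V` to the first tensor power. -/
noncomputable def tensorOne (V : Type*) [NormedAddCommGroup V] [NormedSpace ℝ V] :
    V →ₗ[ℝ] ⨂[ℝ]^1 V :=
  (PiTensorProduct.tprod ℝ (s := fun _ : Fin 1 => V)).toLinearMap (fun _ => 0) 0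

theorem tensorOne_apply (v : V) :
    tensorOne V v = PiTensorProduct.tprod ℝ fun _ : Fin 1 => v := by
  rw [tensorOne, MultilinearMap.toLinearMap_apply]
  congr 1
  funext i
  rw [Subsingleton.elim i 0, Function.update_self]

theorem prependAlg_eq (v : V) (n : ℕ) (x : ⨂[ℝ]^n V) :
    prependAlg v n x = TensorPower.cast ℝ V (Nat.add_comm 1 n)
      (TensorPower.mulEquiv (tensorOne V v ⊗ₜ[ℝ] x)) := by
  rw [tensorOne_apply]
  rfl

theorem prepend_coe (v : V) (n : ℕ) (a : α.Alg n) :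
    α.prepend v n a
      = ((α.toAlg (n + 1) (prependAlg v n ((α.toAlg n).symm a)) : α.Alg (n + 1)) :
          α.T (n + 1)) := by
  unfold prepend
  rw [ContinuousLinearMap.completion_apply_coe]
  rfl

/-- Algebraic tensors are dense and both sides are continuous in z, so additivity passes to the
completion. The next two facts are obtained in the same way. -/
theorem prepend_add (v w : V) (n : ℕ) (z : α.T n) :
    α.prepend (v + w) n z = α.prepend v n z + α.prepend w n z := by
  induction z using UniformSpace.Completion.induction_on with
  | hp =>
    exact isClosed_eq (α.prepend _ n).continuous
      ((α.prepend _ n).continuous.add (α.prepend _ n).continuous)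
  | ih a =>
    simp only [prepend_coe, prependAlg_eq, map_add, TensorProduct.add_tmul,
      UniformSpace.Completion.coe_add]

theorem prepend_smul (c : ℝ) (v : V) (n : ℕ) (z : α.T n) :
    α.prepend (c • v) n z = c • α.prepend v n z := by
  induction z using UniformSpace.Completion.induction_on with
  | hp => exact isClosed_eq (α.prepend _ n).continuous ((α.prepend _ n).continuous.const_smul c)
  | ih a =>
    simp only [prepend_coe, prependAlg_eq, map_smul, ← TensorProduct.smul_tmul',
      UniformSpace.Completion.coe_smul]

theorem norm_prepend_le (v : V) (n : ℕ) (z : α.T n) : ‖α.prepend v n z‖ ≤ ‖v‖ * ‖z‖ := by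
  induction z using UniformSpace.Completion.induction_on with
  | hp => exact isClosed_le (α.prepend _ n).continuous.norm (continuous_const.mul continuous_norm)
  | ih a =>
    rw [prepend_coe, UniformSpace.Completion.norm_coe, UniformSpace.Completion.norm_coe]
    exact α.nrm_prependAlg_le v n a

/-- The bilinear map `(z, v) ↦ v ⊗ z`. -/
noncomputable def prependL (n : ℕ) : α.T n →L[ℝ] V →L[ℝ] α.T (n + 1) :=
  LinearMap.mkContinuous₂
    (LinearMap.mk₂ ℝ (fun z v => α.prepend v n z) (fun z w v => map_add (α.prepend v n) z w)
      (fun c z v => map_smul (α.prepend v n) c z) (fun z v w => α.prepend_add v w n z)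
      fun c z v => α.prepend_smul c v n z) 1 fun z v => by
        rw [one_mul, mul_comm]
        exact α.norm_prepend_le v n z

@[simp]
theorem prependL_apply (n : ℕ) (z : α.T n) (v : V) : α.prependL n z v = α.prepend v n z := rfl

theorem norm_prependL_le (n : ℕ) : ‖α.prependL n‖ ≤ 1 :=
  LinearMap.mkContinuous₂_norm_le _ zero_le_one _

/-- The canonical isometry `V → V^{⊗ 1}` as a bounded operator. -/
noncomputable def ofVL : V →L[ℝ] α.T 1 :=
  LinearMap.mkContinuous
    { toFun := α.ofV
      map_add' := fun v w => by
        simp only [ofV, pure, ← tensorOne_apply, map_add, UniformSpace.Completion.coe_add]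
      map_smul' := fun c v => by
        simp only [ofV, pure, ← tensorOne_apply, map_smul, UniformSpace.Completion.coe_smul,
          RingHom.id_apply] } 1 fun v => by
    rw [one_mul, LinearMap.coe_mk, AddHom.coe_mk, ofV, pure, UniformSpace.Completion.norm_coe,
      norm_toAlg, α.norm_one]

@[simp]
theorem ofVL_apply (v : V) : α.ofVL v = α.ofV v := rfl

theorem norm_ofV (v : V) : ‖α.ofV v‖ = ‖v‖ := by
  rw [ofV, pure, UniformSpace.Completion.norm_coe, norm_toAlg, α.norm_one]

theorem prepend_zero (n : ℕ) (z : α.T n) : α.prepend 0 n z = 0 := by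
  rw [← prependL_apply, map_zero]

end AdmissibleNorm

/-- Left-tagged sums never evaluate the integrand at `b`. This absorbs the jump of Z¹ at the right
end of each interval. For `a = b` the hypothesis is void and both integrals are zero. -/
theorem HasRSIntegral.eq_of_eqOn_Ico {E F G : Type*} [NormedAddCommGroup E] [NormedSpace ℝ E]
    [NormedAddCommGroup F] [NormedSpace ℝ F] [NormedAddCommGroup G] [NormedSpace ℝ G]
    {B : E →L[ℝ] F →L[ℝ] G} {A A' : ℝ → E} {Y : ℝ → F} {a b : ℝ} (hab : a ≤ b) {I I' : G}
    (hI : HasRSIntegral (fun e f => B e f) A Y a b I)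
    (hI' : HasRSIntegral (fun e f => B e f) A' Y a b I') (h : EqOn A A' (Ico a b)) : I = I' := by
  rcases hab.eq_or_lt with rfl | hlt
  · have h0 := hasRSIntegral_self (B := fun e f => B e f) (fun e => map_zero (B e))
    rw [hI.unique le_rfl (h0 A Y a), hI'.unique le_rfl (h0 A' Y a)]
  refine tendsto_nhds_unique (hI.tendsto_uniformPoint hab) ?_
  refine (hI'.tendsto_uniformPoint hab).congr fun n => Finset.sum_congr rfl fun i hi => ?_
  have hi := Finset.mem_range.1 hi
  rw [h]
  have hn : (0 : ℝ) < n + 1 := by positivity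
  have hi' : (i : ℝ) / (n + 1) < 1 := by
    rw [div_lt_one hn]
    exact_mod_cast hi
  have h0 : (0 : ℝ) ≤ (i : ℝ) / (n + 1) := by positivity
  rw [uniformPoint, min_eq_left hi.le]
  push_cast
  constructor <;> nlinarith

/-- The integer point to which the interval `[i, i + 1]` is anchored. -/
def Side.base : Side → ℕ → ℕ
  | .backward, i => i + 1
  | .forward, i => i

/-! ### Existence of sawtooth signatures -/

section Sawtooth

variable {V : Type*} [NormedAddCommGroup V] [NormedSpace ℝ V] (α : AdmissibleNorm V)

theorem anchor_mem (s : Side) {N : ℕ} {t : ℝ} (ht : t ∈ Icc 0 (N : ℝ)) :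
    s.anchor N t ∈ Icc 0 (N : ℝ) := by
  cases s
  · exact ⟨Nat.cast_nonneg _, Nat.cast_le.2 (min_le_right _ _)⟩
  · exact ⟨Nat.cast_nonneg _, (Nat.floor_le ht.1).trans ht.2⟩

theorem anchor_congr (s : Side) {N : ℕ} {t t' : ℝ} (h : ⌊t⌋₊ = ⌊t'⌋₊) :
    s.anchor N t = s.anchor N t' := by
  cases s <;> simp only [Side.anchor, h]

theorem sawtooth_congr (s : Side) (N : ℕ) (x : ℝ → V) {b b' : ∀ n, α.T n} :
    ∀ n, (∀ k ≤ n, b k = b' k) → sawtooth α s N x b n = sawtooth α s N x b' n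
  | 0, h => by simp only [sawtooth, h 0 le_rfl]
  | 1, h => by simp only [sawtooth, h 1 le_rfl]
  | n + 2, h => by
    simp only [sawtooth, h (n + 2) le_rfl,
      sawtooth_congr s N x (n + 1) fun k hk => h k (hk.trans (Nat.le_succ _))]

theorem sawtooth_succ (s : Side) (N : ℕ) (x : ℝ → V) (b : ∀ n, α.T n) {n : ℕ} (hn : 1 ≤ n) (t : ℝ) :
    sawtooth α s N x b (n + 1) t
      = b (n + 1) + rsIntegral (fun z v => α.prepend v n z) (sawtooth α s N x b n) x 0 t := by
  obtain ⟨n, rfl⟩ := Nat.exists_eq_add_of_le' hn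
  rfl

/-- The recursion for degree m uses the datum of degree m only as an added constant. This is what
makes the variance functional quadratic in v. -/
theorem sawtooth_add_single (s : Side) (N : ℕ) (x : ℝ → V) (b : ∀ n, α.T n) {m : ℕ} (hm : 1 ≤ m)
    (v : α.T m) (t : ℝ) :
    sawtooth α s N x (trunc α b m + Pi.single m v) m t
      = sawtooth α s N x (trunc α b m) m t + v := by
  have htop : (trunc α b m + Pi.single m v : ∀ n, α.T n) m = v := by simp [trunc]
  have htop' : trunc α b m m = 0 := by simp [trunc]
  rcases hm.eq_or_lt with rfl | hm'
  · simp only [sawtooth, htop, htop', add_zero]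
  · obtain ⟨n, rfl⟩ : ∃ n, m = n + 2 := ⟨m - 2, by omega⟩
    rw [sawtooth_succ α s N x _ (by omega), sawtooth_succ α s N x _ (by omega), htop, htop',
      sawtooth_congr α s N x (n + 1) (b' := trunc α b (n + 2)) fun k hk => by
        have : k ≠ n + 2 := by omega
        simp [Pi.add_apply, Pi.single_eq_of_ne this], zero_add, add_comm v]

theorem sawtooth_eq_trunc_add (s : Side) (N : ℕ) (x : ℝ → V) (b : ∀ n, α.T n) {m : ℕ} (hm : 1 ≤ m)
    (t : ℝ) : sawtooth α s N x b m t = sawtooth α s N x (trunc α b m) m t + b m := by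
  rw [← sawtooth_add_single α s N x b hm]
  refine congrFun (sawtooth_congr α s N x m fun k hk => ?_) t
  rcases hk.eq_or_lt with rfl | hlt
  · simp [trunc]
  · simp [trunc, hlt, Pi.single_eq_of_ne hlt.ne]

/-- From degree 2 on, the integral over a degenerate interval vanishes. In degree 1 the backward
anchor of time 0 is `min 1 N`, which excludes that case. -/
theorem sawtooth_zero (s : Side) (N : ℕ) (x : ℝ → V) (b : ∀ n, α.T n) (n : ℕ)
    (h : n = 1 → s = Side.forward) : sawtooth α s N x b n 0 = b n := by
  match n with
  | 0 => rfl
  | 1 =>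
    rw [h rfl]
    simp only [sawtooth, Side.anchor, Nat.floor_zero, Nat.cast_zero, sub_self]
    rw [← AdmissibleNorm.ofVL_apply, map_zero, zero_add]
  | n + 2 =>
    simp only [sawtooth]
    rw [(hasRSIntegral_self (fun e => α.prepend_zero _ e) _ _ _).rsIntegral_eq le_rfl, add_zero]

/-- A bound for the components of the sawtooth signature of a path with total variation `K`. -/
noncomputable def sawtoothBound (b : ∀ n, α.T n) (K : ℝ) : ℕ → ℝ
  | 0 => ‖b 0‖
  | 1 => K + ‖b 1‖
  | n + 2 => ‖b (n + 2)‖ + sawtoothBound b K (n + 1) * K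

/-- The bound grows polynomially in the total variation, so moments of all orders control Z in every
degree. -/
theorem sawtoothBound_le (b : ∀ n, α.T n) (n : ℕ) :
    ∃ c : ℝ, 0 ≤ c ∧ ∀ K : ℝ, 0 ≤ K →
      0 ≤ sawtoothBound α b K n ∧ sawtoothBound α b K n ≤ c * (1 + K) ^ n := by
  induction n using Nat.twoStepInduction with
  | zero => exact ⟨‖b 0‖, norm_nonneg _, fun K _ => ⟨norm_nonneg _, by simp [sawtoothBound]⟩⟩
  | one =>
    refine ⟨1 + ‖b 1‖, by positivity, fun K hK => ⟨by unfold sawtoothBound; positivity, ?_⟩⟩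
    simp only [sawtoothBound]
    nlinarith [norm_nonneg (b 1)]
  | more n _ ih =>
    obtain ⟨c, hc, h⟩ := ih
    refine ⟨‖b (n + 2)‖ + c, by positivity, fun K hK => ?_⟩
    obtain ⟨h0, h1⟩ := h K hK
    refine ⟨by unfold sawtoothBound; positivity, ?_⟩
    have hp : 1 ≤ (1 + K) ^ (n + 2) := one_le_pow₀ (by linarith)
    have hp' : sawtoothBound α b K (n + 1) * K ≤ c * (1 + K) ^ (n + 1) * (1 + K) := by
      refine mul_le_mul h1 (by linarith) hK (by positivity)
    simp only [sawtoothBound]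
    calc ‖b (n + 2)‖ + sawtoothBound α b K (n + 1) * K
        ≤ ‖b (n + 2)‖ * (1 + K) ^ (n + 2) + c * (1 + K) ^ (n + 1) * (1 + K) :=
          add_le_add (le_mul_of_one_le_right (norm_nonneg _) hp) hp'
      _ = (‖b (n + 2)‖ + c) * (1 + K) ^ (n + 2) := by ring

variable {N : ℕ} {x : ℝ → V}

theorem norm_sawtooth_one_le (hx : IsRectifiablePath N x) (s : Side) (b : ∀ n, α.T n) {t : ℝ}
    (ht : t ∈ Icc 0 (N : ℝ)) :
    ‖sawtooth α s N x b 1 t‖ ≤ (eVariationOn x (Icc 0 (N : ℝ))).toReal + ‖b 1‖ := by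
  refine (norm_add_le _ _).trans (add_le_add_left ?_ _)
  rw [α.norm_ofV]
  exact hx.norm_sub_le_total (anchor_mem s ht) ht

/-- Discontinuities can occur only at integers, a countable set, which is null for an atomless
measure. -/
theorem ae_continuousWithinAt_sawtooth_one (hx : IsRectifiablePath N x) (s : Side)
    (b : ∀ n, α.T n) :
    ∀ᵐ r ∂(variationMeasure N x).restrict (Ioc 0 (N : ℝ)),
      ContinuousWithinAt (sawtooth α s N x b 1) (Icc 0 (N : ℝ)) r := by
  have := hx.nullSingletonClass
  have hnull : ∀ᵐ r ∂(variationMeasure N x), r ∉ range ((↑) : ℕ → ℝ) :=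
    measure_eq_zero_iff_ae_notMem.1 ((countable_range _).measure_zero _)
  filter_upwards [ae_restrict_mem measurableSet_Ioc, ae_restrict_of_ae hnull] with r hr hr'
  have hfl : (⌊r⌋₊ : ℝ) < r :=
    (Nat.floor_le hr.1.le).lt_of_ne fun h => hr' ⟨_, h⟩
  have hev : ∀ᶠ r' in 𝓝[Icc 0 (N : ℝ)] r, sawtooth α s N x b 1 r'
      = α.ofVL (x r' - x (s.anchor N r)) + b 1 := by
    refine nhdsWithin_le_nhds ?_
    filter_upwards [Ioo_mem_nhds hfl (Nat.lt_floor_add_one r)] with r' hr'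
    have : ⌊r'⌋₊ = ⌊r⌋₊ := by
      rw [Nat.floor_eq_iff ((Nat.cast_nonneg _).trans hr'.1.le)]
      exact ⟨hr'.1.le, hr'.2⟩
    simp only [sawtooth, anchor_congr s this, AdmissibleNorm.ofVL_apply]
  refine ContinuousWithinAt.congr_of_eventuallyEq ?_ hev (hev.self_of_nhdsWithin ⟨hr.1.le, hr.2⟩)
  exact (α.ofVL.continuous.continuousAt.comp_continuousWithinAt
    ((hx.continuousOn r ⟨hr.1.le, hr.2⟩).sub continuousWithinAt_const)).add continuousWithinAt_const

/-- The interval is half-open because the anchor may change at `i + 1`. -/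
theorem sawtooth_one_eq (s : Side) (b : ∀ n, α.T n) {i : ℕ} (hi : i < N) {t : ℝ}
    (ht : t ∈ Ico (i : ℝ) (i + 1 : ℕ)) :
    sawtooth α s N x b 1 t = α.ofV (x t - x (s.base i : ℕ)) + b 1 := by
  have : ⌊t⌋₊ = i := by
    rw [Nat.floor_eq_iff (i.cast_nonneg.trans ht.1)]
    exact ⟨ht.1, by exact_mod_cast ht.2⟩
  cases s
  · simp only [sawtooth, Side.anchor, Side.base, this]
    rw [min_eq_left hi]
  · simp only [sawtooth, Side.anchor, Side.base, this]

variable [CompleteSpace V]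

theorem exists_indefinite (hx : IsRectifiablePath N x) {n : ℕ} {A : ℝ → α.T n} {C : ℝ}
    (hC : ∀ r ∈ Icc 0 (N : ℝ), ‖A r‖ ≤ C)
    (hc : ∀ᵐ r ∂(variationMeasure N x).restrict (Ioc 0 (N : ℝ)),
      ContinuousWithinAt A (Icc 0 (N : ℝ)) r) :
    ∃ Φ : ℝ → α.T (n + 1), ∀ u ∈ Icc 0 (N : ℝ), ∀ v ∈ Icc 0 (N : ℝ), u ≤ v →
      HasRSIntegral (fun z v => α.prepend v n z) A x u v (Φ v - Φ u) :=
  have := hx.isFiniteMeasure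
  exists_hasRSIntegral (α.prependL n) N.cast_nonneg
    (fun _ hu _ hv huv => hx.enorm_sub_le hu hv huv) hC hc

/-- The definition integrates from 0 only; an indefinite integral gives all the increments. What is
needed in degree n is kept as a hypothesis, so that it can feed the induction on n. -/
theorem hasRSIntegral_sawtooth_of_bound (hx : IsRectifiablePath N x) (s : Side) (b : ∀ n, α.T n)
    {n : ℕ} (hn : 1 ≤ n) {C : ℝ} (hC : ∀ r ∈ Icc 0 (N : ℝ), ‖sawtooth α s N x b n r‖ ≤ C)
    (hc : ∀ᵐ r ∂(variationMeasure N x).restrict (Ioc 0 (N : ℝ)),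
      ContinuousWithinAt (sawtooth α s N x b n) (Icc 0 (N : ℝ)) r)
    {u v : ℝ} (hu : u ∈ Icc 0 (N : ℝ)) (hv : v ∈ Icc 0 (N : ℝ)) (huv : u ≤ v) :
    HasRSIntegral (fun z v => α.prepend v n z) (sawtooth α s N x b n) x u v
      (sawtooth α s N x b (n + 1) v - sawtooth α s N x b (n + 1) u) := by
  obtain ⟨Φ, hΦ⟩ := exists_indefinite α hx hC hc
  have h0 := IsRectifiablePath.zero_mem N
  rw [sawtooth_succ α s N x b hn, sawtooth_succ α s N x b hn,
    (hΦ 0 h0 u hu hu.1).rsIntegral_eq hu.1, (hΦ 0 h0 v hv hv.1).rsIntegral_eq hv.1,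
    add_sub_add_left_eq_sub, sub_sub_sub_cancel_right]
  exact hΦ u hu v hv huv

theorem norm_sawtooth_sub_le_of_bound (hx : IsRectifiablePath N x) (s : Side) (b : ∀ n, α.T n)
    {n : ℕ} (hn : 1 ≤ n) {C : ℝ} (hC : ∀ r ∈ Icc 0 (N : ℝ), ‖sawtooth α s N x b n r‖ ≤ C)
    (hc : ∀ᵐ r ∂(variationMeasure N x).restrict (Ioc 0 (N : ℝ)),
      ContinuousWithinAt (sawtooth α s N x b n) (Icc 0 (N : ℝ)) r)
    {u v : ℝ} (hu : u ∈ Icc 0 (N : ℝ)) (hv : v ∈ Icc 0 (N : ℝ)) (huv : u ≤ v) :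
    ‖sawtooth α s N x b (n + 1) v - sawtooth α s N x b (n + 1) u‖
      ≤ C * (variationFn N x v - variationFn N x u) := by
  have h := hasRSIntegral_sawtooth_of_bound α hx s b hn hC hc hu hv huv
  -- Comparison with the integrand `c = 0` gives the plain bound: supremum of the integrand times
  -- variation.
  have h1 := HasRSIntegral.norm_sub_le (B := α.prependL n) (c := 0) (ε := C) huv h
    (fun r hr r' hr' hrr => hx.norm_sub_le (Icc_subset_Icc hu.1 hv.2 hr)
      (Icc_subset_Icc hu.1 hv.2 hr') hrr)
    (fun r hr => by rw [sub_zero]; exact hC r (Icc_subset_Icc hu.1 hv.2 hr))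
  rw [map_zero, zero_apply, sub_zero] at h1
  have hC0 : 0 ≤ C := (norm_nonneg _).trans (hC u hu)
  have hg := sub_nonneg.2 (hx.variationFn_mono huv)
  refine h1.trans (mul_le_mul_of_nonneg_right ?_ hg)
  exact mul_le_of_le_one_left hC0 (α.norm_prependL_le n)

/-- The two properties are proved together because existence of the next integral needs both. From
degree 2 on, increments are at most a constant times those of the variation function, so continuity
holds everywhere. -/
theorem sawtooth_bound_and_continuity (hx : IsRectifiablePath N x) (s : Side) (b : ∀ n, α.T n)
    {n : ℕ} (hn : 1 ≤ n) :
    (∀ t ∈ Icc 0 (N : ℝ),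
      ‖sawtooth α s N x b n t‖ ≤ sawtoothBound α b (eVariationOn x (Icc 0 (N : ℝ))).toReal n) ∧
    ∀ᵐ r ∂(variationMeasure N x).restrict (Ioc 0 (N : ℝ)),
      ContinuousWithinAt (sawtooth α s N x b n) (Icc 0 (N : ℝ)) r := by
  induction n, hn using Nat.le_induction with
  | base =>
    exact ⟨fun t ht => norm_sawtooth_one_le α hx s b ht,
      ae_continuousWithinAt_sawtooth_one α hx s b⟩
  | succ n hn ih =>
    have hinc : ∀ u ∈ Icc 0 (N : ℝ), ∀ v ∈ Icc 0 (N : ℝ), u ≤ v → _ := fun u hu v hv huv =>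
      norm_sawtooth_sub_le_of_bound α hx s b hn ih.1 ih.2 hu hv huv
    constructor
    · intro t ht
      have h0 := IsRectifiablePath.zero_mem N
      have h1 := hinc 0 h0 t ht ht.1
      rw [sawtooth_zero α s N x b (n + 1) (by omega), IsRectifiablePath.variationFn_zero,
        sub_zero] at h1
      have h2 := norm_add_le (b (n + 1)) (sawtooth α s N x b (n + 1) t - b (n + 1))
      rw [add_sub_cancel] at h2
      have hK := hx.variationFn_le t
      obtain ⟨n, rfl⟩ := Nat.exists_eq_add_of_le' hn
      simp only [sawtoothBound]
      refine h2.trans (add_le_add_right (h1.trans (mul_le_mul_of_nonneg_left hK ?_)) _)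
      exact (norm_nonneg _).trans (ih.1 0 h0)
    · filter_upwards [ae_restrict_mem measurableSet_Ioc] with r hr
      refine continuousOn_of_norm_sub_le (g := fun r =>
        sawtoothBound α b (eVariationOn x (Icc 0 (N : ℝ))).toReal n * variationFn N x r) ?_ ?_ r
          ⟨hr.1.le, hr.2⟩
      · exact (hx.continuous_variationFn.const_mul _).continuousOn
      · intro u hu v hv huv
        rw [← mul_sub]
        exact hinc u hu v hv huv

theorem norm_sawtooth_le (hx : IsRectifiablePath N x) (s : Side) (b : ∀ n, α.T n) {n : ℕ}
    (hn : 1 ≤ n) {t : ℝ} (ht : t ∈ Icc 0 (N : ℝ)) :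
    ‖sawtooth α s N x b n t‖ ≤ sawtoothBound α b (eVariationOn x (Icc 0 (N : ℝ))).toReal n :=
  (sawtooth_bound_and_continuity α hx s b hn).1 t ht

theorem ae_continuousWithinAt_sawtooth (hx : IsRectifiablePath N x) (s : Side) (b : ∀ n, α.T n)
    {n : ℕ} (hn : 1 ≤ n) :
    ∀ᵐ r ∂(variationMeasure N x).restrict (Ioc 0 (N : ℝ)),
      ContinuousWithinAt (sawtooth α s N x b n) (Icc 0 (N : ℝ)) r :=
  (sawtooth_bound_and_continuity α hx s b hn).2

theorem hasRSIntegral_sawtooth (hx : IsRectifiablePath N x) (s : Side) (b : ∀ n, α.T n)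
    {n : ℕ} (hn : 1 ≤ n) {u v : ℝ} (hu : u ∈ Icc 0 (N : ℝ)) (hv : v ∈ Icc 0 (N : ℝ)) (huv : u ≤ v) :
    HasRSIntegral (fun z v => α.prepend v n z) (sawtooth α s N x b n) x u v
      (sawtooth α s N x b (n + 1) v - sawtooth α s N x b (n + 1) u) :=
  hasRSIntegral_sawtooth_of_bound α hx s b hn (fun _ ht => norm_sawtooth_le α hx s b hn ht)
    (ae_continuousWithinAt_sawtooth α hx s b hn) hu hv huv

theorem norm_sawtooth_sub_le (hx : IsRectifiablePath N x) (s : Side) (b : ∀ n, α.T n)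
    {n : ℕ} (hn : 1 ≤ n) {u v : ℝ} (hu : u ∈ Icc 0 (N : ℝ)) (hv : v ∈ Icc 0 (N : ℝ)) (huv : u ≤ v) :
    ‖sawtooth α s N x b (n + 1) v - sawtooth α s N x b (n + 1) u‖
      ≤ sawtoothBound α b (eVariationOn x (Icc 0 (N : ℝ))).toReal n
        * (variationFn N x v - variationFn N x u) :=
  norm_sawtooth_sub_le_of_bound α hx s b hn (fun _ ht => norm_sawtooth_le α hx s b hn ht)
    (ae_continuousWithinAt_sawtooth α hx s b hn) hu hv huv

theorem isRectifiablePath_sawtooth (hx : IsRectifiablePath N x) (s : Side) (b : ∀ n, α.T n)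
    {n : ℕ} (hn : 1 ≤ n) : IsRectifiablePath N (sawtooth α s N x b (n + 1)) := by
  have h : ∀ u ∈ Icc 0 (N : ℝ), ∀ v ∈ Icc 0 (N : ℝ), u ≤ v →
      ‖sawtooth α s N x b (n + 1) v - sawtooth α s N x b (n + 1) u‖
        ≤ (fun r => sawtoothBound α b (eVariationOn x (Icc 0 (N : ℝ))).toReal n
            * variationFn N x r) v
          - (fun r => sawtoothBound α b (eVariationOn x (Icc 0 (N : ℝ))).toReal n
            * variationFn N x r) u := fun u hu v hv huv => by
    rw [← mul_sub]
    exact norm_sawtooth_sub_le α hx s b hn hu hv huv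
  exact ⟨continuousOn_of_norm_sub_le (hx.continuous_variationFn.const_mul _).continuousOn h,
    boundedVariationOn_of_norm_sub_le N.cast_nonneg h⟩

end Sawtooth


/-! ### Tensor gradients along a path -/

section Gradient

variable {V : Type*} [NormedAddCommGroup V] [NormedSpace ℝ V] {α : AdmissibleNorm V}
  {W : Type*} [NormedAddCommGroup W] [NormedSpace ℝ W] {m : ℕ} {f : V → V →L[ℝ] W}
  {D : ∀ k : ℕ, V → α.T (k + 1) →L[ℝ] W}

namespace IsTensorGradient

/-- The new direction of differentiation is the first argument of the iterated derivative, which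
matches `prepend`, where the new factor stands on the left. -/
theorem hasFDerivAt_pure (hD : IsTensorGradient α m f D) {k : ℕ} (hk : k < m) (q : V)
    (v : Fin (k + 1) → V) :
    HasFDerivAt (fun q => D k q (α.pure v)) ((D (k + 1) q).comp (α.prependL (k + 1) (α.pure v))) q := by
  have hd : DifferentiableAt ℝ (iteratedFDeriv ℝ k f) q :=
    hD.contDiff.differentiable_iteratedFDeriv (by exact_mod_cast hk) q
  have h1 := ((ContinuousMultilinearMap.apply ℝ (fun _ : Fin k => V) (V →L[ℝ] W)
    (Fin.init v)).hasFDerivAt.comp q hd.hasFDerivAt)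
  have h2 := (ContinuousLinearMap.apply ℝ W (v (Fin.last k))).hasFDerivAt.comp q h1
  have heq : (fun q => D k q (α.pure v)) = fun q =>
      iteratedFDeriv ℝ k f q (Fin.init v) (v (Fin.last k)) :=
    funext fun q => hD.apply_pure k hk.le q v
  rw [heq]
  refine h2.congr_fderiv ?_
  ext h
  have h3 := hD.apply_pure (k + 1) hk q (Fin.cons h v : Fin (k + 2) → V)
  rw [iteratedFDeriv_succ_apply_left] at h3
  simp only [ContinuousLinearMap.comp_apply, AdmissibleNorm.prependL_apply, α.prepend_pure]
  rw [h3]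
  rfl

theorem hasFDerivAt_coe (hD : IsTensorGradient α m f D) {k : ℕ} (hk : k < m) (q : V)
    (z : α.Alg (k + 1)) :
    HasFDerivAt (fun q => D k q z) ((D (k + 1) q).comp (α.prependL (k + 1) (z : α.T (k + 1)))) q := by
  obtain ⟨y, rfl⟩ := (α.toAlg (k + 1)).surjective z
  induction y using PiTensorProduct.induction_on with
  | smul_tprod r v =>
    have h := (hD.hasFDerivAt_pure hk q v).const_smul r
    simp only [map_smul, UniformSpace.Completion.coe_smul, ContinuousLinearMap.comp_smul]
    exact h
  | add y y' h h' =>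
    simp only [map_add, UniformSpace.Completion.coe_add, ContinuousLinearMap.comp_add]
    exact h.add h'

/-- The mean value inequality applies for each fixed algebraic tensor z. Since η does not depend on
z and both sides are continuous in z, the estimate extends to the completion without any
differentiation there. -/
theorem exists_norm_sub_le (hD : IsTensorGradient α m f D) {k : ℕ} (hk : k < m) {K : Set V}
    (hK : IsCompact K) {ε : ℝ} (hε : 0 < ε) :
    ∃ η > 0, ∀ p ∈ K, ∀ u ∈ Metric.ball p η, ∀ v ∈ Metric.ball p η, ∀ z : α.T (k + 1),
      ‖D k v z - D k u z - D (k + 1) p (α.prepend (v - u) (k + 1) z)‖ ≤ ε * ‖z‖ * ‖v - u‖ := by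
  -- Only p is confined to K; the ball around it may leave K.
  have hunif := hK.uniformContinuousAt_of_continuousAt (D (k + 1))
    (fun p _ => (hD.continuous (k + 1) hk).continuousAt) (Metric.dist_mem_uniformity hε)
  obtain ⟨η, hη, h⟩ := Metric.mem_uniformity_dist.1 hunif
  refine ⟨η, hη, fun p hp u hu v hv z => ?_⟩
  induction z using UniformSpace.Completion.induction_on with
  | hp =>
    refine isClosed_le ?_ (by fun_prop)
    exact ((((D k v).continuous.sub (D k u).continuous).sub
      ((D (k + 1) p).continuous.comp (α.prepend (v - u) (k + 1)).continuous))).norm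
  | ih a =>
    refine Convex.norm_image_sub_le_of_norm_hasFDerivWithin_le' (f := fun q => D k q a)
      (φ := (D (k + 1) p).comp (α.prependL (k + 1) (a : α.T (k + 1)))) (s := Metric.ball p η)
      (fun q _ => (hD.hasFDerivAt_coe hk q a).hasFDerivWithinAt) (fun q hq => ?_)
      (convex_ball p η) hu hv
    rw [← ContinuousLinearMap.sub_comp]
    refine (ContinuousLinearMap.opNorm_comp_le _ _).trans ?_
    have h1 : ‖D (k + 1) q - D (k + 1) p‖ ≤ ε := by
      have : dist (D (k + 1) p) (D (k + 1) q) < ε :=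
        h (by rw [dist_comm]; exact Metric.mem_ball.1 hq) hp
      rw [← dist_eq_norm, dist_comm]
      exact this.le
    have h2 : ‖α.prependL (k + 1) (a : α.T (k + 1))‖ ≤ ‖(a : α.T (k + 1))‖ :=
      ((α.prependL (k + 1)).le_opNorm _).trans
        (mul_le_of_le_one_left (norm_nonneg _) (α.norm_prependL_le _))
    gcongr

end IsTensorGradient

end Gradient

/-! ### Increments of indefinite integrals -/

section Increments

theorem exists_forall_norm_sub_le_of_continuousOn {E : Type*} [NormedAddCommGroup E] {A : ℝ → E}
    {a b : ℝ} (hA : ContinuousOn A (Icc a b)) {ε : ℝ} (hε : 0 < ε) :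
    ∃ δ > 0, ∀ u ∈ Icc a b, ∀ v ∈ Icc a b, |v - u| < δ → ‖A v - A u‖ ≤ ε := by
  obtain ⟨δ, hδ, h⟩ := Metric.uniformContinuousOn_iff.1
    (isCompact_Icc.uniformContinuousOn_of_continuous hA) ε hε
  refine ⟨δ, hδ, fun u hu v hv huv => ?_⟩
  rw [← dist_eq_norm]
  exact (h v hv u hu (by rwa [Real.dist_eq])).le

variable {E F G : Type*} [NormedAddCommGroup E] [NormedSpace ℝ E] [NormedAddCommGroup F]
  [NormedSpace ℝ F] [NormedAddCommGroup G] [NormedSpace ℝ G]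

/-- A uniformly continuous integrand is nearly constant on short intervals. This supplies the
first-order expansions required by `sub_eq_sub_of_increments`. -/
theorem exists_forall_norm_indefinite_sub_le {B : E →L[ℝ] F →L[ℝ] G} {A : ℝ → E} {Y : ℝ → F}
    {g : ℝ → ℝ} {a b : ℝ} {Φ : ℝ → G} (hA : ContinuousOn A (Icc a b))
    (hY : ∀ u ∈ Icc a b, ∀ v ∈ Icc a b, u ≤ v → ‖Y v - Y u‖ ≤ g v - g u)
    (hΦ : ∀ u ∈ Icc a b, ∀ v ∈ Icc a b, u ≤ v →
      HasRSIntegral (fun e y => B e y) A Y u v (Φ v - Φ u)) {ε : ℝ} (hε : 0 < ε) :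
    ∃ δ > 0, ∀ u ∈ Icc a b, ∀ v ∈ Icc a b, u ≤ v → v - u < δ →
      ‖Φ v - Φ u - B (A u) (Y v - Y u)‖ ≤ ε * (g v - g u) := by
  obtain ⟨δ, hδ, h⟩ := exists_forall_norm_sub_le_of_continuousOn hA
    (ε := ε / (‖B‖ + 1)) (by positivity)
  refine ⟨δ, hδ, fun u hu v hv huv hd => ?_⟩
  have hsub : Icc u v ⊆ Icc a b := Icc_subset_Icc hu.1 hv.2
  have h1 := (hΦ u hu v hv huv).norm_sub_le huv
    (fun r hr r' hr' hrr => hY r (hsub hr) r' (hsub hr') hrr) (c := A u)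
    (ε := ε / (‖B‖ + 1)) fun r hr => h u hu r (hsub hr) (by
      rw [abs_of_nonneg (sub_nonneg.2 hr.1)]
      linarith [hr.2])
  refine h1.trans (mul_le_mul_of_nonneg_right ?_ ((norm_nonneg _).trans (hY u hu v hv huv)))
  rw [← mul_div_assoc, div_le_iff₀ (by positivity)]
  nlinarith [norm_nonneg B]

end Increments

/-! ### Integration by parts -/

section Parts

variable {V : Type*} [NormedAddCommGroup V] [NormedSpace ℝ V] {α : AdmissibleNorm V}
  {W : Type*} [NormedAddCommGroup W] [NormedSpace ℝ W] {m : ℕ} {f : V → V →L[ℝ] W}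
  {D : ∀ k : ℕ, V → α.T (k + 1) →L[ℝ] W}

/-- The product rule `d (D^k f (x) Z) = D^k f (x) dZ + D^{k+1} f (x) (dx ⊗ Z)`. -/
theorem IsTensorGradient.product_rule (hD : IsTensorGradient α m f D) {k : ℕ} (hk : k < m)
    {a b : ℝ} (hab : a ≤ b) {x : ℝ → V} {g : ℝ → ℝ} {Z : ℝ → α.T (k + 1)} {Z' : ℝ → α.T (k + 2)}
    {c c' : ℝ} {P Q : ℝ → W} (hxc : ContinuousOn x (Icc a b))
    (hx : ∀ u ∈ Icc a b, ∀ v ∈ Icc a b, u ≤ v → ‖x v - x u‖ ≤ g v - g u)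
    (hZc : ContinuousOn Z (Icc a b))
    (hZ : ∀ u ∈ Icc a b, ∀ v ∈ Icc a b, u ≤ v → ‖Z v - Z u‖ ≤ c * (g v - g u))
    (hZ' : ∀ u ∈ Icc a b, ∀ v ∈ Icc a b, u ≤ v → ‖Z' v - Z' u‖ ≤ c' * (g v - g u))
    (hZZ' : ∀ u ∈ Icc a b, ∀ v ∈ Icc a b, u ≤ v →
      HasRSIntegral (fun z v => α.prepend v (k + 1) z) Z x u v (Z' v - Z' u))
    (hP : ∀ u ∈ Icc a b, ∀ v ∈ Icc a b, u ≤ v →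
      HasRSIntegral (fun (A : α.T (k + 1) →L[ℝ] W) z => A z) (fun t => D k (x t)) Z u v (P v - P u))
    (hQ : ∀ u ∈ Icc a b, ∀ v ∈ Icc a b, u ≤ v →
      HasRSIntegral (fun (A : α.T (k + 2) →L[ℝ] W) z => A z) (fun t => D (k + 1) (x t)) Z' u v
        (Q v - Q u)) :
    D k (x b) (Z b) - D k (x a) (Z a) = (P b - P a) + (Q b - Q a) := by
  have hDk : ContinuousOn (fun t => D k (x t)) (Icc a b) :=
    (hD.continuous k hk.le).comp_continuousOn hxc
  have hDk' : ContinuousOn (fun t => D (k + 1) (x t)) (Icc a b) :=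
    (hD.continuous (k + 1) hk).comp_continuousOn hxc
  obtain ⟨C, hC⟩ := isCompact_Icc.exists_bound_of_continuousOn hZc
  obtain ⟨C', hC'⟩ := isCompact_Icc.exists_bound_of_continuousOn hDk'
  have hC0 : 0 ≤ C := (norm_nonneg _).trans (hC a ⟨le_rfl, hab⟩)
  have hC0' : 0 ≤ C' := (norm_nonneg _).trans (hC' a ⟨le_rfl, hab⟩)
  have key := sub_eq_sub_of_increments (Φ := fun t => D k (x t) (Z t)) (Ψ := fun t => P t + Q t)
    (g := g) hab ?_
  · rw [key]
    abel
  -- The increment of the difference splits into five errors, each made at most ε/5 times the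
  -- increment of g: linearisation of D^k f(x), the second-order product, the two indefinite
  -- integrals, and the replacement of dZ' by dx ⊗ Z. The absolute values of c and c' are taken
  -- because no sign is assumed.
  intro ε hε
  obtain ⟨η, hη, h1⟩ := hD.exists_norm_sub_le hk (isCompact_Icc.image_of_continuousOn hxc)
    (ε := ε / 5 / (C + 1)) (by positivity)
  obtain ⟨δ₁, hδ₁, h1'⟩ := exists_forall_norm_sub_le_of_continuousOn hxc (half_pos hη)
  obtain ⟨δ₂, hδ₂, h2⟩ := exists_forall_norm_sub_le_of_continuousOn hDk
    (ε := ε / 5 / (|c| + 1)) (by positivity)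
  obtain ⟨δ₃, hδ₃, h3⟩ := exists_forall_norm_indefinite_sub_le (g := fun t => |c| * g t)
    (B := ContinuousLinearMap.id ℝ (α.T (k + 1) →L[ℝ] W)) hDk (fun u hu v hv huv => by
      rw [← mul_sub]
      exact (hZ u hu v hv huv).trans (mul_le_mul_of_nonneg_right (le_abs_self c)
        ((norm_nonneg _).trans (hx u hu v hv huv)))) hP (ε := ε / 5 / (|c| + 1)) (by positivity)
  obtain ⟨δ₄, hδ₄, h4⟩ := exists_forall_norm_indefinite_sub_le (g := fun t => |c'| * g t)
    (B := ContinuousLinearMap.id ℝ (α.T (k + 2) →L[ℝ] W)) hDk' (fun u hu v hv huv => by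
      rw [← mul_sub]
      exact (hZ' u hu v hv huv).trans (mul_le_mul_of_nonneg_right (le_abs_self c')
        ((norm_nonneg _).trans (hx u hu v hv huv)))) hQ (ε := ε / 5 / (|c'| + 1)) (by positivity)
  obtain ⟨δ₅, hδ₅, h5⟩ := exists_forall_norm_indefinite_sub_le (B := α.prependL (k + 1)) hZc hx hZZ'
    (ε := ε / 5 / (C' + 1)) (by positivity)
  refine ⟨min δ₁ (min δ₂ (min δ₃ (min δ₄ δ₅))), by positivity, fun u hu v hv huv hd => ?_⟩
  simp only [lt_min_iff] at hd
  obtain ⟨hd1, hd2, hd3, hd4, hd5⟩ := hd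
  have habs : |v - u| = v - u := abs_of_nonneg (sub_nonneg.2 huv)
  have hg : 0 ≤ g v - g u := (norm_nonneg _).trans (hx u hu v hv huv)
  have small : ∀ {q : ℝ}, 0 ≤ q → ε / 5 / (q + 1) * q ≤ ε / 5 := fun {q} hq => by
    rw [div_mul_eq_mul_div, div_le_iff₀ (by positivity)]
    nlinarith
  have e1 : ‖D k (x v) (Z u) - D k (x u) (Z u)
      - D (k + 1) (x u) (α.prepend (x v - x u) (k + 1) (Z u))‖ ≤ ε / 5 * (g v - g u) := by
    refine (h1 (x u) (mem_image_of_mem x hu) (x u) (Metric.mem_ball_self hη) (x v) ?_ (Z u)).trans ?_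
    · rw [Metric.mem_ball, dist_eq_norm]
      exact (h1' u hu v hv (by rwa [habs])).trans_lt (half_lt_self hη)
    · have := hC u hu
      have := hx u hu v hv huv
      calc ε / 5 / (C + 1) * ‖Z u‖ * ‖x v - x u‖ ≤ ε / 5 / (C + 1) * C * (g v - g u) := by gcongr
        _ ≤ _ := mul_le_mul_of_nonneg_right (small hC0) hg
  have e2 : ‖(D k (x v) - D k (x u)) (Z v - Z u)‖ ≤ ε / 5 * (g v - g u) := by
    refine (ContinuousLinearMap.le_opNorm _ _).trans ?_
    have i1 := h2 u hu v hv (by rwa [habs])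
    have i2 : ‖Z v - Z u‖ ≤ |c| * (g v - g u) :=
      (hZ u hu v hv huv).trans (mul_le_mul_of_nonneg_right (le_abs_self c) hg)
    calc _ ≤ ε / 5 / (|c| + 1) * (|c| * (g v - g u)) := by gcongr
      _ = ε / 5 / (|c| + 1) * |c| * (g v - g u) := by ring
      _ ≤ _ := mul_le_mul_of_nonneg_right (small (abs_nonneg c)) hg
  have e3 : ‖P v - P u - D k (x u) (Z v - Z u)‖ ≤ ε / 5 * (g v - g u) := by
    refine (h3 u hu v hv huv hd3).trans ?_
    rw [← mul_sub, ← mul_assoc]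
    exact mul_le_mul_of_nonneg_right (small (abs_nonneg c)) hg
  have e4 : ‖Q v - Q u - D (k + 1) (x u) (Z' v - Z' u)‖ ≤ ε / 5 * (g v - g u) := by
    refine (h4 u hu v hv huv hd4).trans ?_
    rw [← mul_sub, ← mul_assoc]
    exact mul_le_mul_of_nonneg_right (small (abs_nonneg c')) hg
  have e5 : ‖D (k + 1) (x u) (Z' v - Z' u - α.prepend (x v - x u) (k + 1) (Z u))‖
      ≤ ε / 5 * (g v - g u) := by
    refine (ContinuousLinearMap.le_opNorm _ _).trans ?_
    have i1 := h5 u hu v hv huv hd5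
    have i2 := hC' u hu
    calc _ ≤ C' * (ε / 5 / (C' + 1) * (g v - g u)) := by
          refine mul_le_mul i2 i1 (norm_nonneg _) hC0'
      _ = ε / 5 / (C' + 1) * C' * (g v - g u) := by ring
      _ ≤ _ := mul_le_mul_of_nonneg_right (small hC0') hg
  have heq : (D k (x v) (Z v) - D k (x u) (Z u)) - ((P v + Q v) - (P u + Q u))
      = (D k (x v) (Z u) - D k (x u) (Z u)
          - D (k + 1) (x u) (α.prepend (x v - x u) (k + 1) (Z u)))
        + (D k (x v) - D k (x u)) (Z v - Z u)
        - (P v - P u - D k (x u) (Z v - Z u))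
        - (Q v - Q u - D (k + 1) (x u) (Z' v - Z' u))
        - D (k + 1) (x u) (Z' v - Z' u - α.prepend (x v - x u) (k + 1) (Z u)) := by
    simp only [map_sub, sub_apply]
    abel
  rw [heq]
  have t1 := norm_sub_le (D k (x v) (Z u) - D k (x u) (Z u)
          - D (k + 1) (x u) (α.prepend (x v - x u) (k + 1) (Z u))
        + (D k (x v) - D k (x u)) (Z v - Z u)
        - (P v - P u - D k (x u) (Z v - Z u))
        - (Q v - Q u - D (k + 1) (x u) (Z' v - Z' u)))
        (D (k + 1) (x u) (Z' v - Z' u - α.prepend (x v - x u) (k + 1) (Z u)))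
  have t2 := norm_sub_le (D k (x v) (Z u) - D k (x u) (Z u)
          - D (k + 1) (x u) (α.prepend (x v - x u) (k + 1) (Z u))
        + (D k (x v) - D k (x u)) (Z v - Z u)
        - (P v - P u - D k (x u) (Z v - Z u)))
        (Q v - Q u - D (k + 1) (x u) (Z' v - Z' u))
  have t3 := norm_sub_le (D k (x v) (Z u) - D k (x u) (Z u)
          - D (k + 1) (x u) (α.prepend (x v - x u) (k + 1) (Z u))
        + (D k (x v) - D k (x u)) (Z v - Z u))
        (P v - P u - D k (x u) (Z v - Z u))
  have t4 := norm_add_le (D k (x v) (Z u) - D k (x u) (Z u)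
          - D (k + 1) (x u) (α.prepend (x v - x u) (k + 1) (Z u)))
        ((D k (x v) - D k (x u)) (Z v - Z u))
  linarith

end Parts

/-! ### The Euler–Maclaurin formula along a path -/

section Formula

variable {V : Type*} [NormedAddCommGroup V] [NormedSpace ℝ V] [CompleteSpace V]
  {α : AdmissibleNorm V} {W : Type*} [NormedAddCommGroup W] [NormedSpace ℝ W]
  {m : ℕ} {f : V → V →L[ℝ] W} {D : ∀ k : ℕ, V → α.T (k + 1) →L[ℝ] W} {N : ℕ} {x : ℝ → V}

theorem exists_indefinite_apply [CompleteSpace W] {F : Type*} [NormedAddCommGroup F] [NormedSpace ℝ F]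
    [CompleteSpace F] {A : ℝ → F →L[ℝ] W} {Y : ℝ → F} (hA : ContinuousOn A (Icc 0 (N : ℝ)))
    (hY : IsRectifiablePath N Y) :
    ∃ Φ : ℝ → W, ∀ u ∈ Icc 0 (N : ℝ), ∀ v ∈ Icc 0 (N : ℝ), u ≤ v →
      HasRSIntegral (fun (A : F →L[ℝ] W) z => A z) A Y u v (Φ v - Φ u) := by
  have := hY.isFiniteMeasure
  obtain ⟨C, hC⟩ := isCompact_Icc.exists_bound_of_continuousOn hA
  refine exists_hasRSIntegral (ContinuousLinearMap.id ℝ (F →L[ℝ] W)) N.cast_nonneg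
    (fun _ hu _ hv huv => hY.enorm_sub_le hu hv huv) hC ?_
  filter_upwards [ae_restrict_mem measurableSet_Ioc] with r hr using hA r ⟨hr.1.le, hr.2⟩

/-- The identity of order `1` on the interval `[i, i + 1]`. -/
theorem IsTensorGradient.formula_interval (hx : IsRectifiablePath N x) (s : Side)
    (b : ∀ n, α.T n) (hD : IsTensorGradient α m f D) (hm : 1 ≤ m) {P Q : ℝ → W}
    (hP : ∀ u ∈ Icc 0 (N : ℝ), ∀ v ∈ Icc 0 (N : ℝ), u ≤ v →
      HasRSIntegral (fun (A : V →L[ℝ] W) z => A z) (fun t => f (x t)) x u v (P v - P u))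
    (hQ : ∀ u ∈ Icc 0 (N : ℝ), ∀ v ∈ Icc 0 (N : ℝ), u ≤ v →
      HasRSIntegral (fun (A : α.T 2 →L[ℝ] W) z => A z) (fun t => D 1 (x t)) (sawtooth α s N x b 2)
        u v (Q v - Q u)) {i : ℕ} (hi : i < N) :
    D 0 (x (i + 1 : ℕ)) (α.ofV (x (i + 1 : ℕ) - x (s.base i : ℕ)) + b 1)
      - D 0 (x i) (α.ofV (x i - x (s.base i : ℕ)) + b 1)
      = (P (i + 1 : ℕ) - P i) + (Q (i + 1 : ℕ) - Q i) := by
  have hle : (i : ℝ) ≤ (i + 1 : ℕ) := Nat.cast_le.2 i.le_succ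
  have hsub : Icc (i : ℝ) (i + 1 : ℕ) ⊆ Icc 0 (N : ℝ) :=
    Icc_subset_Icc i.cast_nonneg (Nat.cast_le.2 hi)
  have hD0 : ∀ q v, D 0 q (α.ofV v) = f q v := fun q v => by
    rw [AdmissibleNorm.ofV, hD.apply_pure 0 (Nat.zero_le m), iteratedFDeriv_zero_apply]
  -- The anchor stays at the base point on the closed interval. This removes the jump at `i + 1` and
  -- makes Z continuous, as the product rule demands.
  let Z : ℝ → α.T 1 := fun t => α.ofVL (x t - x (s.base i : ℕ)) + b 1
  have hZsub : ∀ u v, Z v - Z u = α.ofV (x v - x u) := fun u v => by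
    simp only [Z, add_sub_add_right_eq_sub, ← map_sub, sub_sub_sub_cancel_right]
    rfl
  have hZc : ContinuousOn Z (Icc (i : ℝ) (i + 1 : ℕ)) :=
    (α.ofVL.continuous.comp_continuousOn
      ((hx.continuousOn.mono hsub).sub continuousOn_const)).add continuousOn_const
  obtain ⟨C, hC⟩ : ∃ C, ∀ t ∈ Icc (i : ℝ) (i + 1 : ℕ), ‖Z t‖ ≤ C :=
    isCompact_Icc.exists_bound_of_continuousOn hZc
  obtain ⟨Φ, hΦ⟩ : ∃ Φ : ℝ → α.T 2, ∀ u ∈ Icc (i : ℝ) (i + 1 : ℕ), ∀ v ∈ Icc (i : ℝ) (i + 1 : ℕ),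
      u ≤ v → HasRSIntegral (fun z v => α.prepend v 1 z) Z x u v (Φ v - Φ u) := by
    have := hx.isFiniteMeasure
    refine exists_hasRSIntegral (α.prependL 1) hle
      (fun _ hu _ hv huv => hx.enorm_sub_le (hsub hu) (hsub hv) huv) hC ?_
    filter_upwards [ae_restrict_mem measurableSet_Ioc] with r hr using hZc r ⟨hr.1.le, hr.2⟩
  have hZ2 : ∀ u ∈ Icc (i : ℝ) (i + 1 : ℕ), ∀ v ∈ Icc (i : ℝ) (i + 1 : ℕ), u ≤ v →
      HasRSIntegral (fun z v => α.prepend v 1 z) Z x u v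
        (sawtooth α s N x b 2 v - sawtooth α s N x b 2 u) := by
    intro u hu v hv huv
    have h1 := hasRSIntegral_sawtooth α hx s b le_rfl (hsub hu) (hsub hv) huv
    -- The integrals of the continuous version and of Z¹ itself coincide, the integrands agreeing
    -- except possibly at the right end.
    have : sawtooth α s N x b 2 v - sawtooth α s N x b 2 u = Φ v - Φ u :=
      HasRSIntegral.eq_of_eqOn_Ico (B := α.prependL 1) huv h1 (hΦ u hu v hv huv) fun t ht =>
        sawtooth_one_eq α s b hi ⟨hu.1.trans ht.1, ht.2.trans_le hv.2⟩
    rw [this]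
    exact hΦ u hu v hv huv
  have := hD.product_rule (k := 0) hm hle (g := variationFn N x) (Z := Z)
    (Z' := sawtooth α s N x b 2) (c := 1) (P := P) (Q := Q) (hx.continuousOn.mono hsub)
    (fun u hu v hv huv => hx.norm_sub_le (hsub hu) (hsub hv) huv) hZc
    (fun u hu v hv huv => by
      rw [hZsub, α.norm_ofV, one_mul]
      exact hx.norm_sub_le (hsub hu) (hsub hv) huv)
    (fun u hu v hv huv => norm_sawtooth_sub_le α hx s b le_rfl (hsub hu) (hsub hv) huv) hZ2
    -- Z and x have the same increments, so ∫ f(x) dx is also the integral of D⁰f(x) against Z.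
    (fun u hu v hv huv => (hP u (hsub hu) v (hsub hv) huv).congr
      (B' := fun (A : α.T 1 →L[ℝ] W) z => A z) (A' := fun t => D 0 (x t)) (Y' := Z)
      fun r _ t _ t' _ => by rw [hZsub, hD0])
    (fun u hu v hv huv => hQ u (hsub hu) v (hsub hv) huv)
  simpa only [Z, AdmissibleNorm.ofVL_apply] using this

/-- With base `i + 1` the tensor Z is b₁ at the right end and −Δx + b₁ at the left end; with base
`i` it is Δx + b₁ and b₁. The boundary terms are thus f at the left, respectively right, end applied
to Δx, plus an increment of f(x) b₁. The rest telescopes. -/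
theorem IsTensorGradient.formula_one (hx : IsRectifiablePath N x) (s : Side)
    (b : ∀ n, α.T n) (hD : IsTensorGradient α m f D) (hm : 1 ≤ m) {P Q : ℝ → W}
    (hP : ∀ u ∈ Icc 0 (N : ℝ), ∀ v ∈ Icc 0 (N : ℝ), u ≤ v →
      HasRSIntegral (fun (A : V →L[ℝ] W) z => A z) (fun t => f (x t)) x u v (P v - P u))
    (hQ : ∀ u ∈ Icc 0 (N : ℝ), ∀ v ∈ Icc 0 (N : ℝ), u ≤ v →
      HasRSIntegral (fun (A : α.T 2 →L[ℝ] W) z => A z) (fun t => D 1 (x t)) (sawtooth α s N x b 2)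
        u v (Q v - Q u)) :
    s.riemannSum N f x = (P N - P 0) - (D 0 (x N) (b 1) - D 0 (x 0) (b 1)) + (Q N - Q 0) := by
  have hD0 : ∀ q v, D 0 q (α.ofV v) = f q v := fun q v => by
    rw [AdmissibleNorm.ofV, hD.apply_pure 0 (Nat.zero_le m), iteratedFDeriv_zero_apply]
  have hterm : s.riemannSum N f x = ∑ i ∈ Finset.range N,
      (((P (i + 1 : ℕ) - P i) + (Q (i + 1 : ℕ) - Q i))
        - (D 0 (x (i + 1 : ℕ)) (b 1) - D 0 (x i) (b 1))) := by
    cases s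
    all_goals
      refine Finset.sum_congr rfl fun i hi => ?_
      rw [← hD.formula_interval hx _ b hm hP hQ (Finset.mem_range.1 hi)]
      simp only [Side.base, sub_self, map_add, hD0, map_zero, Nat.cast_add, Nat.cast_one]
      -- Only the backward case contains the increment with the opposite sign.
      try rw [← neg_sub (x (i + 1)) (x i), map_neg]
      abel
  rw [hterm, Finset.sum_sub_distrib, Finset.sum_add_distrib,
    Finset.sum_range_sub fun i : ℕ => P i, Finset.sum_range_sub fun i : ℕ => Q i,
    Finset.sum_range_sub fun i : ℕ => D 0 (x i) (b 1), Nat.cast_zero]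
  abel

/-- The generalised Euler–Maclaurin formula along a rectifiable path, for an arbitrary initial
datum. -/
theorem IsTensorGradient.formula [CompleteSpace W] (hx : IsRectifiablePath N x) (s : Side)
    (b : ∀ n, α.T n) (hm : 1 ≤ m) (hD : IsTensorGradient α m f D) :
    ∃ J R : W,
      HasRSIntegral (fun (A : V →L[ℝ] W) v => A v) (fun t => f (x t)) x 0 N J ∧
      HasRSIntegral (fun (A : α.T (m + 1) →L[ℝ] W) z => A z) (fun t => D m (x t))
        (sawtooth α s N x b (m + 1)) 0 N R ∧
      s.riemannSum N f x
        = J - (D 0 (x N) (b 1) - D 0 (x 0) (b 1))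
          + ∑ j ∈ Finset.range (m - 1), (-1 : ℝ) ^ (j + 2) •
              (D (j + 1) (x N) (sawtooth α s N x b (j + 2) N)
                - D (j + 1) (x 0) (sawtooth α s N x b (j + 2) 0))
          + (-1 : ℝ) ^ (m + 1) • R := by
  have h0 := IsRectifiablePath.zero_mem N
  have hN := IsRectifiablePath.right_mem N
  obtain ⟨P, hP⟩ := exists_indefinite_apply
    (hD.contDiff.continuous.comp_continuousOn hx.continuousOn) hx
  -- `Q k` is an indefinite integral of D^{k+1} f(x) against Z^{k+2}; beyond the smoothness of f it
  -- is a dummy value.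
  have hQ : ∀ k, ∃ Q : ℝ → W, k + 1 ≤ m → ∀ u ∈ Icc 0 (N : ℝ), ∀ v ∈ Icc 0 (N : ℝ), u ≤ v →
      HasRSIntegral (fun (A : α.T (k + 1 + 1) →L[ℝ] W) z => A z) (fun t => D (k + 1) (x t))
        (sawtooth α s N x b (k + 1 + 1)) u v (Q v - Q u) := fun k => by
    by_cases hk : k + 1 ≤ m
    · obtain ⟨Q, hQ⟩ := exists_indefinite_apply
        ((hD.continuous (k + 1) hk).comp_continuousOn hx.continuousOn)
        (isRectifiablePath_sawtooth α hx s b (n := k + 1) (by omega))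
      exact ⟨Q, fun _ => hQ⟩
    · exact ⟨0, fun h => absurd h hk⟩
  choose Q hQ using hQ
  obtain ⟨m, rfl⟩ := Nat.exists_eq_add_of_le' hm
  refine ⟨P N - P 0, Q m N - Q m 0, hP 0 h0 N hN N.cast_nonneg,
    hQ m le_rfl 0 h0 N hN N.cast_nonneg, ?_⟩
  rw [hD.formula_one hx s b hm hP (hQ 0 hm), add_assoc]
  congr 1
  -- Each step applies the product rule to D^{n+1} f(x) Z^{n+2}, replacing `Q n` by a boundary term
  -- minus `Q (n + 1)`, whence the alternating signs.
  have hrec : ∀ n ≤ m, Q 0 N - Q 0 0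
      = ∑ j ∈ Finset.range n, (-1 : ℝ) ^ (j + 2) •
              (D (j + 1) (x N) (sawtooth α s N x b (j + 2) N)
                - D (j + 1) (x 0) (sawtooth α s N x b (j + 2) 0))
          + (-1 : ℝ) ^ (n + 2) • (Q n N - Q n 0) := by
    intro n hn
    induction n with
    | zero => simp
    | succ n ih =>
      have hpr := hD.product_rule (k := n + 1) (by omega) N.cast_nonneg (g := variationFn N x)
        (Z := sawtooth α s N x b (n + 2)) (Z' := sawtooth α s N x b (n + 3)) (P := Q n)
        (Q := Q (n + 1)) hx.continuousOn (fun u hu v hv huv => hx.norm_sub_le hu hv huv)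
        (isRectifiablePath_sawtooth α hx s b (n := n + 1) (by omega)).continuousOn
        (fun u hu v hv huv => norm_sawtooth_sub_le α hx s b (by omega) hu hv huv)
        (fun u hu v hv huv => norm_sawtooth_sub_le α hx s b (by omega) hu hv huv)
        (fun u hu v hv huv => hasRSIntegral_sawtooth α hx s b (by omega) hu hv huv)
        (hQ n (by omega)) (hQ (n + 1) (by omega))
      rw [ih (by omega), Finset.sum_range_succ, add_assoc, hpr, smul_add, add_assoc]
      congr 2
      rw [pow_succ (-1 : ℝ) (n + 2), mul_neg_one, neg_smul, add_neg_cancel, add_zero]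
  exact hrec m le_rfl

end Formula


/-! ### Measurability of path functionals -/

/-- φ rounds down to the partition. Monotone rounding cannot increase variation, and x ∘ φ converges
to x, as needed for the semicontinuity argument on variations. -/
theorem exists_uniformPoint_approx {a b : ℝ} (hab : a ≤ b) (n : ℕ) :
    ∃ φ : ℝ → ℝ, Monotone φ ∧ (∀ r, φ r ∈ uniformPoint a b (n + 1) '' Iic (n + 1)) ∧
      ∀ r ∈ Icc a b, |φ r - r| ≤ (b - a) / (n + 1) := by
  rcases hab.eq_or_lt with rfl | hlt
  · refine ⟨fun _ => a, monotone_const, fun r => ⟨0, by simp, by simp [uniformPoint]⟩, ?_⟩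
    rintro r ⟨h1, h2⟩
    rw [le_antisymm h1 h2]
    simp
  have hba : 0 < b - a := sub_pos.2 hlt
  have hn : (0 : ℝ) < n + 1 := by positivity
  refine ⟨fun r => uniformPoint a b (n + 1) (min ⌊(r - a) / (b - a) * (n + 1)⌋₊ (n + 1)), ?_,
    fun r => ⟨_, mem_Iic.2 (min_le_right _ _), rfl⟩, ?_⟩
  · intro r r' hr
    refine uniformPoint_monotone hab _ (min_le_min_right _ (Nat.floor_mono ?_))
    gcongr
  · rintro r ⟨h1, h2⟩
    have h0 : 0 ≤ (r - a) / (b - a) * (n + 1) :=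
      mul_nonneg (div_nonneg (sub_nonneg.2 h1) hba.le) hn.le
    have hle : (r - a) / (b - a) * (n + 1) ≤ (n + 1 : ℕ) := by
      push_cast
      exact mul_le_of_le_one_left hn.le ((div_le_one hba).2 (by linarith))
    have hfl : ⌊(r - a) / (b - a) * (n + 1)⌋₊ ≤ n + 1 := Nat.floor_le_of_le hle
    have h3 := Nat.floor_le h0
    have h4 := Nat.lt_floor_add_one ((r - a) / (b - a) * (n + 1))
    simp only [uniformPoint, min_eq_left hfl]
    set k : ℝ := (⌊(r - a) / (b - a) * (n + 1)⌋₊ : ℝ)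
    have e : a + k / ((n + 1 : ℕ) : ℝ) * (b - a) - r
        = (k - (r - a) / (b - a) * (n + 1)) * ((b - a) / (n + 1)) := by
      push_cast
      field_simp
      ring
    rw [e, abs_mul, abs_of_pos (div_pos hba hn)]
    refine mul_le_of_le_one_left (div_pos hba hn).le (abs_le.2 ⟨by linarith, by linarith⟩)

/-- The variation of a continuous path is the limit of its variations along uniform partitions. -/
theorem tendsto_sum_edist_uniformPoint {E : Type*} [PseudoEMetricSpace E] {x : ℝ → E} {a b : ℝ}
    (hab : a ≤ b) (hx : ContinuousOn x (Icc a b)) :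
    Tendsto (fun n : ℕ => ∑ i ∈ Finset.range (n + 1),
      edist (x (uniformPoint a b (n + 1) (i + 1))) (x (uniformPoint a b (n + 1) i))) atTop
      (𝓝 (eVariationOn x (Icc a b))) := by
  have hp : ∀ n : ℕ, IsTaggedPartition a b ((b - a) / (n + 1) + 1) (n + 1)
      (uniformPoint a b (n + 1)) (uniformPoint a b (n + 1)) := fun n =>
    isTaggedPartition_uniformPoint hab n (lt_add_one _)
  have hmem : ∀ n i, uniformPoint a b (n + 1) i ∈ Icc a b := fun n i => by
    have h1 := (hp n).point_mem (min_le_right i (n + 1))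
    simpa [uniformPoint] using h1
  choose φ hφ hφi hφd using exists_uniformPoint_approx hab
  have hφI : ∀ n r, φ n r ∈ Icc a b := fun n r => by
    obtain ⟨i, -, hi⟩ := hφi n r
    exact hi ▸ hmem n i
  -- The lower estimate is semicontinuity of the variation along x ∘ φ_n → x, whose variation is at
  -- most the sum over the partition; the upper estimate holds for every partition.
  refine tendsto_order.2 ⟨fun c hc => ?_, fun c hc => .of_forall fun n => ?_⟩
  · have hlim : ∀ r ∈ Icc a b, Tendsto (fun n => (x ∘ φ n) r) atTop (𝓝 (x r)) := fun r hr => by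
      refine (hx r hr).tendsto.comp (tendsto_nhdsWithin_iff.2 ⟨?_, .of_forall fun n => hφI n r⟩)
      refine tendsto_iff_dist_tendsto_zero.2 (squeeze_zero (fun _ => dist_nonneg)
        (fun n => hφd n r hr) (tendsto_const_div_natCast_add_one _))
    filter_upwards [eVariationOn.lowerSemicontinuous_aux hlim hc] with n hn
    refine hn.trans_le ?_
    refine (eVariationOn.comp_le_of_monotoneOn x (s := uniformPoint a b (n + 1) '' Iic (n + 1))
      (φ n) ((hφ n).monotoneOn _) fun r _ => hφi n r).trans ?_
    rw [eVariationOn.image_range_of_monotone x (hp n).mono]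
    exact (Finset.sum_congr rfl fun i _ => edist_comm _ _).le
  · exact (eVariationOn.sum_le (hp n).mono (hmem n)).trans_lt hc

/-- A bound of integrals against the total variation measure. -/
theorem norm_setIntegral_le {V E : Type*} [NormedAddCommGroup V] [NormedAddCommGroup E] [NormedSpace ℝ E] {N : ℕ} {x : ℝ → V}
    (hx : IsRectifiablePath N x) {A : ℝ → E} {C : ℝ} (hC : ∀ r ∈ Icc 0 (N : ℝ), ‖A r‖ ≤ C) :
    ‖∫ r in Icc 0 (N : ℝ), A r ∂(variationMeasure N x)‖
      ≤ C * (eVariationOn x (Icc 0 (N : ℝ))).toReal := by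
  have := hx.isFiniteMeasure
  rw [← hx.variationMeasure_Icc]
  exact norm_setIntegral_le_of_norm_le_const (measure_lt_top _ _) hC

theorem integrableOn_of_ae_continuousWithinAt {V E : Type*} [NormedAddCommGroup V] [NormedAddCommGroup E] {N : ℕ} {x : ℝ → V}
    (hx : IsRectifiablePath N x) {A : ℝ → E} {C : ℝ} (hC : ∀ r ∈ Icc 0 (N : ℝ), ‖A r‖ ≤ C)
    (hc : ∀ᵐ r ∂(variationMeasure N x).restrict (Ioc 0 (N : ℝ)),
      ContinuousWithinAt A (Icc 0 (N : ℝ)) r) :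
    IntegrableOn A (Icc 0 (N : ℝ)) (variationMeasure N x) := by
  have := hx.isFiniteMeasure
  rw [IntegrableOn, hx.restrict_Icc]
  refine Integrable.of_bound (aestronglyMeasurable_of_ae_continuousWithinAt N.cast_nonneg hc) C ?_
  filter_upwards [ae_restrict_mem measurableSet_Ioc] with r hr
  exact hC r (Ioc_subset_Icc_self hr)

section RandomPaths

variable {Ω : Type*} [MeasurableSpace Ω] {P : Measure Ω}

theorem aestronglyMeasurable_of_hasRSIntegral {E F G : Type*}
    [NormedAddCommGroup E] [NormedSpace ℝ E] [NormedAddCommGroup F] [NormedSpace ℝ F]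
    [NormedAddCommGroup G] [NormedSpace ℝ G] (B : E →L[ℝ] F →L[ℝ] G) {A : ℝ → Ω → E}
    {Y : ℝ → Ω → F} {a b : ℝ} (hab : a ≤ b) {I : Ω → G}
    (hA : ∀ r ∈ Icc a b, AEStronglyMeasurable (A r) P)
    (hY : ∀ r ∈ Icc a b, AEStronglyMeasurable (Y r) P)
    (hI : ∀ᵐ ω ∂P, HasRSIntegral (fun e f => B e f) (fun r => A r ω) (fun r => Y r ω) a b (I ω)) :
    AEStronglyMeasurable I P := by
  have hmem : ∀ (n : ℕ), ∀ i ≤ n + 1, uniformPoint a b (n + 1) i ∈ Icc a b := fun n i hi =>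
    (isTaggedPartition_uniformPoint hab n (lt_add_one _)).point_mem hi
  refine aestronglyMeasurable_of_tendsto_ae (atTop : Filter ℕ)
    (f := fun n ω => ∑ i ∈ Finset.range (n + 1), B (A (uniformPoint a b (n + 1) i) ω)
      (Y (uniformPoint a b (n + 1) (i + 1)) ω - Y (uniformPoint a b (n + 1) i) ω))
    (fun n => ?_) ?_
  · refine Finset.aestronglyMeasurable_fun_sum _ fun i hi => ?_
    have hi := Finset.mem_range.1 hi
    exact B.aestronglyMeasurable_comp₂ (hA _ (hmem n i hi.le))
      ((hY _ (hmem n _ hi)).sub (hY _ (hmem n i hi.le)))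
  · filter_upwards [hI] with ω hω
    exact hω.tendsto_uniformPoint hab

namespace IsRectifiable

variable {V : Type*} [NormedAddCommGroup V] {N : ℕ} {X : ℝ → Ω → V}

theorem ae_isRectifiablePath (h : IsRectifiable P N X) :
    ∀ᵐ ω ∂P, IsRectifiablePath N fun t => X t ω := by
  filter_upwards [h.continuous, h.boundedVariation] with ω h1 h2
  exact ⟨h1, h2⟩

theorem aemeasurable_eVariationOn (h : IsRectifiable P N X) {t : ℝ} (ht : t ∈ Icc 0 (N : ℝ)) :
    AEMeasurable (fun ω => eVariationOn (fun r => X r ω) (Icc 0 t)) P := by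
  have hmem : ∀ (n : ℕ), ∀ i ≤ n + 1, uniformPoint 0 t (n + 1) i ∈ Icc 0 (N : ℝ) := fun n i hi =>
    Icc_subset_Icc_right ht.2
      ((isTaggedPartition_uniformPoint ht.1 n (lt_add_one _)).point_mem hi)
  refine aemeasurable_of_tendsto_metrizable_ae (atTop : Filter ℕ)
    (f := fun n ω => ∑ i ∈ Finset.range (n + 1), edist (X (uniformPoint 0 t (n + 1) (i + 1)) ω)
      (X (uniformPoint 0 t (n + 1) i) ω)) (fun n => ?_) ?_
  · refine Finset.aemeasurable_fun_sum _ fun i hi => ?_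
    have hi := Finset.mem_range.1 hi
    exact (h.measurable _ (hmem n _ hi)).edist (h.measurable _ (hmem n _ hi.le))
  · filter_upwards [h.continuous] with ω hω
    exact tendsto_sum_edist_uniformPoint ht.1 (hω.mono (Icc_subset_Icc_right ht.2))

theorem aemeasurable_totalVariation (h : IsRectifiable P N X) :
    AEMeasurable (totalVariation N X) P :=
  h.aemeasurable_eVariationOn (IsRectifiablePath.right_mem N)

theorem aemeasurable_variationFn (h : IsRectifiable P N X) {t : ℝ} (ht : t ∈ Icc 0 (N : ℝ)) :
    AEMeasurable (fun ω => variationFn N (fun r => X r ω) t) P := by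
  have : Icc 0 (N : ℝ) ∩ Iic t = Icc 0 t := by
    ext r
    exact ⟨fun hr => ⟨hr.1.1, hr.2⟩, fun hr => ⟨⟨hr.1, hr.2.trans ht.2⟩, hr.2⟩⟩
  simp only [variationFn, this]
  exact (h.aemeasurable_eVariationOn ht).ennreal_toReal

/-- The integral against the random measure |dX| is a Riemann–Stieltjes integral against the
variation function, so it is an almost sure limit of measurable sums and no measurability of the
measure in ω is needed. -/
theorem aestronglyMeasurable_integral {E : Type*} [NormedAddCommGroup E] [NormedSpace ℝ E]
    [CompleteSpace E] (h : IsRectifiable P N X) {A : ℝ → Ω → E} {C : Ω → ℝ}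
    (hA : ∀ r ∈ Icc 0 (N : ℝ), AEStronglyMeasurable (A r) P)
    (hC : ∀ᵐ ω ∂P, ∀ r ∈ Icc 0 (N : ℝ), ‖A r ω‖ ≤ C ω)
    (hc : ∀ᵐ ω ∂P, ∀ᵐ r ∂(variationMeasure N fun t => X t ω).restrict (Ioc 0 (N : ℝ)),
      ContinuousWithinAt (fun r => A r ω) (Icc 0 (N : ℝ)) r) :
    AEStronglyMeasurable
      (fun ω => ∫ r in Icc 0 (N : ℝ), A r ω ∂(variationMeasure N fun t => X t ω)) P := by
  refine aestronglyMeasurable_of_hasRSIntegral (ContinuousLinearMap.lsmul ℝ ℝ).flip N.cast_nonneg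
    hA (Y := fun t ω => variationFn N (fun r => X r ω) t)
    (fun t ht => (h.aemeasurable_variationFn ht).aestronglyMeasurable) ?_
  filter_upwards [h.ae_isRectifiablePath, hC, hc] with ω hx hC hc
  have := hx.isFiniteMeasure
  rw [hx.restrict_Icc]
  exact hasRSIntegral_integral (fun u _ v _ huv => hx.variationMeasure_real_Ioc huv) hC hc

/-- A random variable dominated by a polynomial of the total variation is integrable. -/
theorem integrable_of_norm_le [IsProbabilityMeasure P] {E : Type*} [NormedAddCommGroup E]
    (h : IsRectifiable P N X)
    (hX : ∀ p : ℕ, ∫⁻ ω, totalVariation N X ω ^ p ∂P < ∞) {f : Ω → E}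
    (hf : AEStronglyMeasurable f P) {c : ℝ} {p : ℕ}
    (hle : ∀ᵐ ω ∂P, ‖f ω‖ ≤ c * (1 + (totalVariation N X ω).toReal) ^ p) : Integrable f P := by
  have hK : Integrable (fun ω => (totalVariation N X ω).toReal ^ p) P := by
    simp only [← ENNReal.toReal_pow]
    exact integrable_toReal_of_lintegral_ne_top (h.aemeasurable_totalVariation.pow_const p)
      (hX p).ne
  -- Convexity gives (1 + K)^p ≤ 2^{p−1} (1 + K^p), so the moment of order p suffices.
  have hg : Integrable (fun ω => |c| * (2 ^ (p - 1) *
      (1 ^ p + (totalVariation N X ω).toReal ^ p))) P :=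
    (((integrable_const _).add hK).const_mul _).const_mul _
  refine hg.mono' hf ?_
  filter_upwards [hle] with ω hω
  refine hω.trans ?_
  refine (mul_le_mul_of_nonneg_right (le_abs_self c) (by positivity)).trans ?_
  exact mul_le_mul_of_nonneg_left (add_pow_le zero_le_one ENNReal.toReal_nonneg p) (abs_nonneg c)

theorem integrable_totalVariation [IsProbabilityMeasure P] (h : IsRectifiable P N X)
    (hX : ∀ p : ℕ, ∫⁻ ω, totalVariation N X ω ^ p ∂P < ∞) :
    Integrable (fun ω => (totalVariation N X ω).toReal) P :=
  integrable_toReal_of_lintegral_ne_top h.aemeasurable_totalVariation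
    (by simpa using (hX 1).ne)

theorem integral_totalVariation_pos (h : IsRectifiable P N X)
    (hX : ∀ p : ℕ, ∫⁻ ω, totalVariation N X ω ^ p ∂P < ∞)
    (h0 : ∫⁻ ω, totalVariation N X ω ∂P ≠ 0) :
    0 < ∫ ω, (totalVariation N X ω).toReal ∂P := by
  have hfin : ∫⁻ ω, totalVariation N X ω ∂P < ∞ := by simpa using hX 1
  rw [integral_toReal h.aemeasurable_totalVariation
    (ae_lt_top' h.aemeasurable_totalVariation hfin.ne)]
  exact ENNReal.toReal_pos h0 hfin.ne

end IsRectifiable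

/-! ### Sawtooth signatures of processes -/

variable {V : Type*} [NormedAddCommGroup V] [NormedSpace ℝ V] (α : AdmissibleNorm V)
  {N : ℕ} {X : ℝ → Ω → V}

theorem optimalTensor_mem_series₁ (P : Measure Ω) (s : Side) (N : ℕ) (X : ℝ → Ω → V) :
    optimalTensor α P s N X ∈ α.series₁ := by
  rw [AdmissibleNorm.series₁, mem_ofPred_eq, optimalTensor]

theorem aestronglyMeasurable_sawtooth [CompleteSpace V] (h : IsRectifiable P N X) (s : Side)
    (b : ∀ n, α.T n) (n : ℕ) {t : ℝ} (ht : t ∈ Icc 0 (N : ℝ)) :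
    AEStronglyMeasurable (fun ω => sawtooth α s N (fun r => X r ω) b n t) P := by
  match n with
  | 0 => exact aestronglyMeasurable_const
  | 1 =>
    simp only [sawtooth, ← AdmissibleNorm.ofVL_apply]
    exact (α.ofVL.continuous.comp_aestronglyMeasurable
      ((h.measurable t ht).sub (h.measurable _ (anchor_mem s ht)))).add
      aestronglyMeasurable_const
  | n + 2 =>
    -- Measurability is inherited from degree `n + 1` through the integral over `[0, t]`; the value
    -- at 0 is deterministic.
    have key : AEStronglyMeasurable (fun ω => sawtooth α s N (fun r => X r ω) b (n + 2) t
        - sawtooth α s N (fun r => X r ω) b (n + 2) 0) P := by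
      refine aestronglyMeasurable_of_hasRSIntegral (α.prependL (n + 1)) ht.1
        (A := fun r ω => sawtooth α s N (fun r => X r ω) b (n + 1) r) (Y := X)
        (fun r hr => aestronglyMeasurable_sawtooth h s b (n + 1)
          (Icc_subset_Icc_right ht.2 hr))
        (fun r hr => h.measurable r (Icc_subset_Icc_right ht.2 hr)) ?_
      filter_upwards [h.ae_isRectifiablePath] with ω hx
      exact hasRSIntegral_sawtooth α hx s b n.succ_pos (IsRectifiablePath.zero_mem N) ht ht.1
    have e : ∀ ω, sawtooth α s N (fun r => X r ω) b (n + 2) 0 = b (n + 2) := fun ω =>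
      sawtooth_zero α s N _ b (n + 2) (by omega)
    simp only [e] at key
    refine (key.add (aestronglyMeasurable_const (b := b (n + 2)))).congr (.of_forall fun ω => ?_)
    exact sub_add_cancel _ _

theorem isRectifiable_sawtooth [CompleteSpace V] (h : IsRectifiable P N X) (s : Side)
    (b : ∀ n, α.T n) {n : ℕ} (hn : n ≠ 1) :
    IsRectifiable P N fun t ω => sawtooth α s N (fun r => X r ω) b n t := by
  have hpath : ∀ᵐ ω ∂P, IsRectifiablePath N fun t => sawtooth α s N (fun r => X r ω) b n t := by
    filter_upwards [h.ae_isRectifiablePath] with ω hx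
    match n with
    | 0 => exact ⟨continuousOn_const, by
        rw [BoundedVariationOn, eVariationOn.constant_on]
        · exact ENNReal.zero_ne_top
        · rintro _ ⟨_, _, rfl⟩ _ ⟨_, _, rfl⟩
          rfl⟩
    | n + 2 => exact isRectifiablePath_sawtooth α hx s b n.succ_pos
  exact ⟨fun t ht => aestronglyMeasurable_sawtooth α h s b n ht, hpath.mono fun _ h => h.1,
    hpath.mono fun _ h => h.2⟩

theorem monotoneOn_anchor (s : Side) (N : ℕ) : Monotone (s.anchor N) := by
  intro t t' h
  have := Nat.floor_mono h
  cases s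
  · exact Nat.cast_le.2 (min_le_min_right _ (Nat.succ_le_succ this))
  · exact Nat.cast_le.2 this

/-- Z¹ is a difference of x and x composed with the monotone anchor map; the sum of the two
variation functions dominates its increments. -/
theorem boundedVariationOn_sawtooth_one {x : ℝ → V} (hx : IsRectifiablePath N x) (s : Side)
    (b : ∀ n, α.T n) : BoundedVariationOn (sawtooth α s N x b 1) (Icc 0 (N : ℝ)) := by
  refine boundedVariationOn_of_norm_sub_le N.cast_nonneg
    (g := fun t => variationFn N x t + variationFn N x (s.anchor N t)) fun u hu v hv huv => ?_
  have h1 := hx.norm_sub_le hu hv huv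
  have h2 := hx.norm_sub_le (anchor_mem s hu) (anchor_mem s hv) (monotoneOn_anchor s N huv)
  have e : sawtooth α s N x b 1 v - sawtooth α s N x b 1 u
      = α.ofV ((x v - x u) - (x (s.anchor N v) - x (s.anchor N u))) := by
    simp only [sawtooth, ← AdmissibleNorm.ofVL_apply, map_sub]
    abel
  rw [e, α.norm_ofV]
  refine (_root_.norm_sub_le _ _).trans ?_
  linarith

theorem integrableOn_sawtooth [CompleteSpace V] {x : ℝ → V} (hx : IsRectifiablePath N x) (s : Side)
    (b : ∀ n, α.T n) {m : ℕ} (hm : 1 ≤ m) :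
    IntegrableOn (sawtooth α s N x b m) (Icc 0 (N : ℝ)) (variationMeasure N x) :=
  integrableOn_of_ae_continuousWithinAt hx (fun _ hr => norm_sawtooth_le α hx s b hm hr)
    (ae_continuousWithinAt_sawtooth α hx s b hm)

theorem integrable_integral_sawtooth [CompleteSpace V] [IsProbabilityMeasure P]
    (h : IsRectifiable P N X) (hX : ∀ p : ℕ, ∫⁻ ω, totalVariation N X ω ^ p ∂P < ∞) (s : Side)
    (b : ∀ n, α.T n) {m : ℕ} (hm : 1 ≤ m) :
    Integrable (fun ω => ∫ t in Icc 0 (N : ℝ), sawtooth α s N (fun t => X t ω) b m t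
      ∂(variationMeasure N fun t => X t ω)) P := by
  obtain ⟨c, hc0, hc⟩ := sawtoothBound_le α b m
  -- Z contributes the power m of 1 + K and the mass of |dX| one further factor.
  refine h.integrable_of_norm_le hX (c := c) (p := m + 1)
    (h.aestronglyMeasurable_integral (A := fun t ω => sawtooth α s N (fun t => X t ω) b m t)
      (C := fun ω => sawtoothBound α b (totalVariation N X ω).toReal m)
      (fun r hr => aestronglyMeasurable_sawtooth α h s b m hr) ?_ ?_) ?_
  · filter_upwards [h.ae_isRectifiablePath] with ω hx r hr
    exact norm_sawtooth_le α hx s b hm hr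
  · filter_upwards [h.ae_isRectifiablePath] with ω hx
    exact ae_continuousWithinAt_sawtooth α hx s b hm
  · filter_upwards [h.ae_isRectifiablePath] with ω hx
    have hK : 0 ≤ (totalVariation N X ω).toReal := ENNReal.toReal_nonneg
    refine (norm_setIntegral_le hx fun r hr => norm_sawtooth_le α hx s b hm hr).trans ?_
    rw [pow_succ, ← mul_assoc]
    exact mul_le_mul (hc _ hK).2 (by rw [totalVariation]; linarith) hK (by positivity)

theorem integrable_integral_norm_sq_sawtooth [CompleteSpace V] [IsProbabilityMeasure P]
    (h : IsRectifiable P N X) (hX : ∀ p : ℕ, ∫⁻ ω, totalVariation N X ω ^ p ∂P < ∞) (s : Side)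
    (b : ∀ n, α.T n) {m : ℕ} (hm : 1 ≤ m) :
    Integrable (fun ω => ∫ t in Icc 0 (N : ℝ), ‖sawtooth α s N (fun t => X t ω) b m t‖ ^ 2
      ∂(variationMeasure N fun t => X t ω)) P := by
  obtain ⟨c, hc0, hc⟩ := sawtoothBound_le α b m
  have hle : ∀ {ω}, IsRectifiablePath N (fun t => X t ω) → ∀ r ∈ Icc 0 (N : ℝ),
      ‖‖sawtooth α s N (fun t => X t ω) b m r‖ ^ 2‖
        ≤ sawtoothBound α b (totalVariation N X ω).toReal m ^ 2 := fun hx r hr => by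
    rw [norm_pow, norm_norm]
    exact pow_le_pow_left₀ (norm_nonneg _) (norm_sawtooth_le α hx s b hm hr) 2
  refine h.integrable_of_norm_le hX (c := c ^ 2) (p := m * 2 + 1)
    (h.aestronglyMeasurable_integral
      (A := fun t ω => ‖sawtooth α s N (fun t => X t ω) b m t‖ ^ 2)
      (C := fun ω => sawtoothBound α b (totalVariation N X ω).toReal m ^ 2)
      (fun r hr => (aestronglyMeasurable_sawtooth α h s b m hr).norm.pow 2) ?_ ?_) ?_
  · filter_upwards [h.ae_isRectifiablePath] with ω hx
    exact hle hx
  · filter_upwards [h.ae_isRectifiablePath] with ω hx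
    filter_upwards [ae_continuousWithinAt_sawtooth α hx s b hm] with r hr
    exact hr.norm.pow 2
  · filter_upwards [h.ae_isRectifiablePath] with ω hx
    have hK : 0 ≤ (totalVariation N X ω).toReal := ENNReal.toReal_nonneg
    refine (norm_setIntegral_le hx (hle hx)).trans ?_
    rw [pow_succ (1 + _), ← mul_assoc, pow_mul, ← mul_pow]
    exact mul_le_mul (pow_le_pow_left₀ (hc _ hK).1 (hc _ hK).2 2)
      (by rw [totalVariation]; linarith) hK (by positivity)

end RandomPaths


/-! ### Hilbert tensor norms -/

namespace AdmissibleNorm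

/-- Scalars are absorbed into the first factor, which requires positive degree. The Hilbert
condition is stated for plain sums of pure tensors. -/
theorem exists_eq_sum_tprod {V : Type*} [NormedAddCommGroup V] [NormedSpace ℝ V] {n : ℕ}
    (x : ⨂[ℝ]^(n + 1) V) :
    ∃ (r : ℕ) (v : Fin r → Fin (n + 1) → V), x = ∑ i, PiTensorProduct.tprod ℝ (v i) := by
  induction x using PiTensorProduct.induction_on with
  | smul_tprod c v =>
    refine ⟨1, fun _ => Function.update v 0 (c • v 0), ?_⟩
    rw [Fin.sum_univ_one, MultilinearMap.map_update_smul, Function.update_eq_self]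
  | add x y hx hy =>
    obtain ⟨r, v, rfl⟩ := hx
    obtain ⟨q, w, rfl⟩ := hy
    refine ⟨r + q, Fin.append v w, ?_⟩
    simp only [Fin.sum_univ_add, Fin.append_left, Fin.append_right]

variable {H : Type*} [NormedAddCommGroup H] [InnerProductSpace ℝ H] {α : AdmissibleNorm H}

theorem IsHilbert.nrm_parallelogram (hα : α.IsHilbert) {n : ℕ} (x y : ⨂[ℝ]^(n + 1) H) :
    α.nrm (n + 1) (x + y) ^ 2 + α.nrm (n + 1) (x - y) ^ 2
      = 2 * (α.nrm (n + 1) x ^ 2 + α.nrm (n + 1) y ^ 2) := by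
  obtain ⟨r, v, rfl⟩ := exists_eq_sum_tprod x
  obtain ⟨q, w, rfl⟩ := exists_eq_sum_tprod y
  -- A sign change of the first factors writes −y as a sum of pure tensors; the four squared norms
  -- are then double sums and the cross terms cancel.
  let w' : Fin q → Fin (n + 1) → H := fun j => Function.update (w j) 0 ((-1 : ℝ) • w j 0)
  have hw' : ∀ j, PiTensorProduct.tprod ℝ (w' j) = -PiTensorProduct.tprod ℝ (w j) := fun j => by
    rw [MultilinearMap.map_update_smul, Function.update_eq_self, neg_one_smul]
  have hinner : ∀ (u : Fin (n + 1) → H) (j : Fin q),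
      ∏ k, inner ℝ (u k) (w' j k) = -∏ k, inner ℝ (u k) (w j k) := fun u j => by
    simp only [w', Fin.prod_univ_succ, Function.update_self, inner_smul_right, ne_eq,
      Fin.succ_ne_zero, not_false_eq_true, Function.update_of_ne]
    ring
  have hinner' : ∀ (u : Fin (n + 1) → H) (j : Fin q),
      ∏ k, inner ℝ (w' j k) (u k) = -∏ k, inner ℝ (w j k) (u k) := fun u j => by
    simp only [real_inner_comm (u _)]
    exact hinner u j
  have e1 : ∑ i, PiTensorProduct.tprod ℝ (v i) + ∑ j, PiTensorProduct.tprod ℝ (w j)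
      = ∑ i, PiTensorProduct.tprod ℝ (Fin.append v w i) := by
    simp only [Fin.sum_univ_add, Fin.append_left, Fin.append_right]
  have e2 : ∑ i, PiTensorProduct.tprod ℝ (v i) - ∑ j, PiTensorProduct.tprod ℝ (w j)
      = ∑ i, PiTensorProduct.tprod ℝ (Fin.append v w' i) := by
    simp only [Fin.sum_univ_add, Fin.append_left, Fin.append_right, hw', Finset.sum_neg_distrib,
      sub_eq_add_neg]
  rw [e1, e2, hα (n + 1) _ _, hα (n + 1) _ _, hα (n + 1) _ _, hα (n + 1) _ _]
  simp only [Fin.sum_univ_add, Fin.append_left, Fin.append_right, hinner, hinner',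
    Finset.sum_add_distrib, Finset.sum_neg_distrib]
  ring

theorem IsHilbert.parallelogram (hα : α.IsHilbert) {n : ℕ} (x y : α.T (n + 1)) :
    ‖x + y‖ * ‖x + y‖ + ‖x - y‖ * ‖x - y‖ = 2 * (‖x‖ * ‖x‖ + ‖y‖ * ‖y‖) := by
  induction x, y using UniformSpace.Completion.induction_on₂ with
  | hp => exact isClosed_eq (by fun_prop) (by fun_prop)
  | ih a b =>
    rw [← UniformSpace.Completion.coe_add, ← UniformSpace.Completion.coe_sub]
    simp only [UniformSpace.Completion.norm_coe, ← pow_two]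
    exact hα.nrm_parallelogram a b

end AdmissibleNorm

/-! ### The variance functional -/

section Variance

variable {Ω : Type*} [MeasurableSpace Ω] {P : Measure Ω} [IsProbabilityMeasure P] {N : ℕ}

section

variable {V : Type*} [NormedAddCommGroup V] [NormedSpace ℝ V] [CompleteSpace V]
  (α : AdmissibleNorm V) {X : ℝ → Ω → V}

theorem integrableOn_norm_sq_sawtooth {x : ℝ → V} (hx : IsRectifiablePath N x) (s : Side)
    (b : ∀ n, α.T n) {m : ℕ} (hm : 1 ≤ m) :
    IntegrableOn (fun t => ‖sawtooth α s N x b m t‖ ^ 2) (Icc 0 (N : ℝ))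
      (variationMeasure N x) := by
  refine integrableOn_of_ae_continuousWithinAt hx
    (C := sawtoothBound α b (eVariationOn x (Icc 0 (N : ℝ))).toReal m ^ 2) (fun r hr => ?_) ?_
  · rw [norm_pow, norm_norm]
    exact pow_le_pow_left₀ (norm_nonneg _) (norm_sawtooth_le α hx s b hm hr) 2
  · filter_upwards [ae_continuousWithinAt_sawtooth α hx s b hm] with r hr
    exact hr.norm.pow 2

/-- The moments make the Bochner integrals meaningful, so the functional is finite and can be
expanded algebraically. -/
theorem varianceFunctional_eq (h : IsRectifiable P N X)
    (hX : ∀ p : ℕ, ∫⁻ ω, totalVariation N X ω ^ p ∂P < ∞) (s : Side)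
    (b : ∀ n, α.T n) {m : ℕ} (hm : 1 ≤ m) (v : α.T m) :
    varianceFunctional α P s N X b m v = ENNReal.ofReal (∫ ω, (∫ t in Icc 0 (N : ℝ),
      ‖sawtooth α s N (fun t => X t ω) (trunc α b m) m t + v‖ ^ 2
        ∂(variationMeasure N fun t => X t ω)) ∂P) := by
  simp only [← sawtooth_add_single α s N _ b hm]
  rw [ofReal_integral_eq_lintegral_ofReal (integrable_integral_norm_sq_sawtooth α h hX s _ hm)
    (.of_forall fun ω => integral_nonneg fun t => sq_nonneg _)]
  refine lintegral_congr_ae ?_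
  filter_upwards [h.ae_isRectifiablePath] with ω hx
  rw [ofReal_integral_eq_lintegral_ofReal (integrableOn_norm_sq_sawtooth α hx s _ hm)
    (.of_forall fun t => sq_nonneg _)]
  refine lintegral_congr fun t => ?_
  rw [ENNReal.ofReal_pow (norm_nonneg _), ofReal_norm]

theorem integral_norm_add_sq {E : Type*} [NormedAddCommGroup E] [InnerProductSpace ℝ E]
    [CompleteSpace E] {T : Type*} [MeasurableSpace T] {ν : Measure T} [IsFiniteMeasure ν]
    {A : T → E} (hA : Integrable A ν) (hA2 : Integrable (fun t => ‖A t‖ ^ 2) ν) (v : E) :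
    ∫ t, ‖A t + v‖ ^ 2 ∂ν
      = ∫ t, ‖A t‖ ^ 2 ∂ν + 2 * inner ℝ v (∫ t, A t ∂ν) + ν.real univ * ‖v‖ ^ 2 := by
  have h1 : Integrable (fun t => inner ℝ v (A t)) ν := hA.const_inner v
  simp only [norm_add_sq_real, real_inner_comm v]
  have h2 : Integrable (fun t => ‖A t‖ ^ 2 + 2 * inner ℝ v (A t)) ν := hA2.add (h1.const_mul 2)
  rw [integral_add h2 (integrable_const _),
    integral_add hA2 (h1.const_mul 2), integral_const_mul, integral_inner hA, integral_const,
    smul_eq_mul]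

end

variable {H : Type*} [NormedAddCommGroup H] [InnerProductSpace ℝ H] [CompleteSpace H]
  {α : AdmissibleNorm H} {X : ℝ → Ω → H}

/-- Expansion of the variance functional around the optimal tensor. -/
theorem AdmissibleNorm.IsHilbert.varianceFunctional_optimalTensor (hα : α.IsHilbert)
    (h : IsRectifiable P N X)
    (hX : ∀ p : ℕ, ∫⁻ ω, totalVariation N X ω ^ p ∂P < ∞)
    (h0 : ∫⁻ ω, totalVariation N X ω ∂P ≠ 0) (s : Side) {m : ℕ} (hm : 1 ≤ m) :
    ∃ c : ℝ, 0 ≤ c ∧ ∀ v, varianceFunctional α P s N X (optimalTensor α P s N X) m v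
      = ENNReal.ofReal (c + (∫ ω, (totalVariation N X ω).toReal ∂P)
          * ‖v - optimalTensor α P s N X m‖ ^ 2) := by
  obtain ⟨m, rfl⟩ := Nat.exists_eq_add_of_le' hm
  have hS := h.integral_totalVariation_pos hX h0
  set S := ∫ ω, (totalVariation N X ω).toReal ∂P
  set b := optimalTensor α P s N X with hb
  let Z : Ω → ℝ → α.T (m + 1) := fun ω => sawtooth α s N (fun t => X t ω) (trunc α b (m + 1)) (m + 1)
  let ν : Ω → Measure ℝ := fun ω => (variationMeasure N fun t => X t ω).restrict (Icc 0 (N : ℝ))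
  let M : α.T (m + 1) := ∫ ω, (∫ t, Z ω t ∂ν ω) ∂P
  have hM : b (m + 1) = -(S⁻¹ • M) := optimalTensor_succ α P s N X m
  have hM' : M = -(S • b (m + 1)) := by
    rw [hM, smul_neg, smul_inv_smul₀ hS.ne', neg_neg]
  -- By Jordan and von Neumann, the parallelogram law yields an inner product inducing the given
  -- norm.
  let _ : InnerProductSpace ℝ (α.T (m + 1)) := InnerProductSpace.ofNorm ℝ hα.parallelogram
  have hI1 : Integrable (fun ω => ∫ t, Z ω t ∂ν ω) P :=
    integrable_integral_sawtooth α h hX s _ hm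
  have hI2 : Integrable (fun ω => ∫ t, ‖Z ω t‖ ^ 2 ∂ν ω) P :=
    integrable_integral_norm_sq_sawtooth α h hX s _ hm
  have hexp : ∀ v, ∫ ω, (∫ t, ‖Z ω t + v‖ ^ 2 ∂ν ω) ∂P
      = ∫ ω, (∫ t, ‖Z ω t‖ ^ 2 ∂ν ω) ∂P + 2 * inner ℝ v M + S * ‖v‖ ^ 2 := fun v => by
    have h1 : Integrable (fun ω => inner ℝ v (∫ t, Z ω t ∂ν ω)) P := hI1.const_inner v
    have h2 : Integrable (fun ω => (∫ t, ‖Z ω t‖ ^ 2 ∂ν ω) + 2 * inner ℝ v (∫ t, Z ω t ∂ν ω)) P :=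
      hI2.add (h1.const_mul 2)
    rw [← integral_inner hI1, ← integral_const_mul, ← integral_mul_const,
      ← integral_add hI2 (h1.const_mul 2),
      ← integral_add h2 ((h.integrable_totalVariation hX).mul_const _)]
    refine integral_congr_ae ?_
    filter_upwards [h.ae_isRectifiablePath] with ω hx
    have := hx.isFiniteMeasure
    rw [integral_norm_add_sq (integrableOn_sawtooth α hx s _ hm)
      (integrableOn_norm_sq_sawtooth α hx s _ hm)]
    congr 2
    rw [Measure.real, Measure.restrict_apply_univ, hx.variationMeasure_Icc, totalVariation]
  -- Since M = −S b_m, this is completion of the square in the quadratic polynomial `hexp`.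
  have hsq : ∀ v, ∫ ω, (∫ t, ‖Z ω t + v‖ ^ 2 ∂ν ω) ∂P
      = ∫ ω, (∫ t, ‖Z ω t + b (m + 1)‖ ^ 2 ∂ν ω) ∂P + S * ‖v - b (m + 1)‖ ^ 2 := fun v => by
    rw [hexp, hexp, hM', norm_sub_sq_real, inner_neg_right, inner_neg_right, inner_smul_right,
      inner_smul_right, real_inner_self_eq_norm_sq]
    ring
  refine ⟨∫ ω, (∫ t, ‖Z ω t + b (m + 1)‖ ^ 2 ∂ν ω) ∂P,
    integral_nonneg fun ω => integral_nonneg fun t => sq_nonneg _, fun v => ?_⟩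
  rw [varianceFunctional_eq α h hX s b hm, ← hsq]

theorem AdmissibleNorm.IsHilbert.varianceFunctional_lt (hα : α.IsHilbert)
    (h : IsRectifiable P N X)
    (hX : ∀ p : ℕ, ∫⁻ ω, totalVariation N X ω ^ p ∂P < ∞)
    (h0 : ∫⁻ ω, totalVariation N X ω ∂P ≠ 0) (s : Side) {m : ℕ} (hm : 1 ≤ m) {v : α.T m}
    (hv : v ≠ optimalTensor α P s N X m) :
    varianceFunctional α P s N X (optimalTensor α P s N X) m (optimalTensor α P s N X m)
      < varianceFunctional α P s N X (optimalTensor α P s N X) m v := by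
  obtain ⟨c, hc, hF⟩ := hα.varianceFunctional_optimalTensor h hX h0 s hm
  have hpos : 0 < (∫ ω, (totalVariation N X ω).toReal ∂P)
      * ‖v - optimalTensor α P s N X m‖ ^ 2 :=
    mul_pos (h.integral_totalVariation_pos hX h0) (pow_pos (norm_pos_iff.2 (sub_ne_zero.2 hv)) 2)
  rw [hF, hF, sub_self, _root_.norm_zero]
  refine (ENNReal.ofReal_lt_ofReal_iff (by linarith)).2 ?_
  linarith

/-- Agreement below degree m makes the two functionals of degree m equal, and the strict minimum
then forces agreement in degree m. -/
theorem AdmissibleNorm.IsHilbert.eq_optimalTensor (hα : α.IsHilbert) (h : IsRectifiable P N X)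
    (hX : ∀ p : ℕ, ∫⁻ ω, totalVariation N X ω ^ p ∂P < ∞)
    (h0 : ∫⁻ ω, totalVariation N X ω ∂P ≠ 0) (s : Side) {b : ∀ n, α.T n} (hb : b ∈ α.series₁)
    (hmin : ∀ m ≥ 1, ∀ v, varianceFunctional α P s N X b m (b m)
      ≤ varianceFunctional α P s N X b m v) :
    b = optimalTensor α P s N X := by
  funext m
  induction m using Nat.strong_induction_on with
  | h m ih =>
    rcases Nat.eq_zero_or_pos m with rfl | hm
    · exact hb.trans (optimalTensor_mem_series₁ α P s N X).symm
    · by_contra hne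
      have htr : trunc α b m = trunc α (optimalTensor α P s N X) m := by
        funext k
        by_cases hk : k < m
        · simp only [trunc, hk, if_true, ih k hk]
        · simp only [trunc, hk, if_false]
      have hF : ∀ v, varianceFunctional α P s N X b m v
          = varianceFunctional α P s N X (optimalTensor α P s N X) m v := fun v => by
        simp only [varianceFunctional, htr]
      have h1 := hmin m hm (optimalTensor α P s N X m)
      rw [hF, hF] at h1
      exact (hα.varianceFunctional_lt h hX h0 s hm hne).not_ge h1

end Variance


/-! ### Periodised Bernoulli polynomials -/

/-- The normalised periodic Bernoulli function `P_l (t - [t]) / l!`. -/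
noncomputable def periodicBernoulli (l : ℕ) (t : ℝ) : ℝ :=
  bernoulliFun l (Int.fract t) / l.factorial

theorem exists_norm_periodicBernoulli_le (l : ℕ) : ∃ M, ∀ t, ‖periodicBernoulli l t‖ ≤ M := by
  obtain ⟨M, hM⟩ := (isCompact_Icc (a := (0 : ℝ)) (b := 1)).exists_bound_of_continuousOn
    ((continuous_bernoulliFun l).div_const (l.factorial : ℝ)).continuousOn
  exact ⟨M, fun t => hM _ ⟨Int.fract_nonneg t, (Int.fract_lt_one t).le⟩⟩

theorem measurable_periodicBernoulli (l : ℕ) : Measurable (periodicBernoulli l) :=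
  ((continuous_bernoulliFun l).measurable.comp measurable_fract).div_const _

theorem intervalIntegrable_periodicBernoulli (l : ℕ) (a b : ℝ) :
    IntervalIntegrable (periodicBernoulli l) volume a b := by
  obtain ⟨M, hM⟩ := exists_norm_periodicBernoulli_le l
  exact intervalIntegrable_const.mono_fun' (measurable_periodicBernoulli l).aestronglyMeasurable
    (.of_forall hM)

theorem ae_continuousAt_periodicBernoulli (l : ℕ) : ∀ᵐ t, ContinuousAt (periodicBernoulli l) t := by
  have hnull : ∀ᵐ r : ℝ, r ∉ range ((↑) : ℤ → ℝ) :=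
    measure_eq_zero_iff_ae_notMem.1 ((countable_range _).measure_zero _)
  filter_upwards [hnull] with t ht
  exact ((continuous_bernoulliFun l).continuousAt.comp
    (continuousAt_fract fun h => ht ⟨_, h.symm⟩)).div_const _

/-- B_l takes equal values at 0 and 1 unless l = 1, so the periodic extension has no jump. -/
theorem continuous_periodicBernoulli {l : ℕ} (hl : l ≠ 1) : Continuous (periodicBernoulli l) :=
  (ContinuousOn.comp_fract'' (continuous_bernoulliFun l).continuousOn
    (bernoulliFun_endpoints_eq_of_ne_one hl).symm).div_const _

/-- The integer part is locally constant to the right of every point, integers included. Right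
derivatives and continuity suffice for the fundamental theorem of calculus. -/
theorem hasDerivWithinAt_periodicBernoulli (l : ℕ) (t : ℝ) :
    HasDerivWithinAt (periodicBernoulli (l + 1)) (periodicBernoulli l t) (Ioi t) t := by
  have h := (((hasDerivAt_bernoulliFun (l + 1) (Int.fract t)).comp_sub_const t ⌊t⌋).div_const
    ((l + 1).factorial : ℝ)).hasDerivWithinAt (s := Ioi t)
  have e : ((l + 1 : ℕ) : ℝ) * bernoulliFun (l + 1 - 1) (Int.fract t) / ((l + 1).factorial : ℝ)
      = periodicBernoulli l t := by
    have : ((l : ℝ) + 1) ≠ 0 := by positivity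
    rw [periodicBernoulli, Nat.factorial_succ, Nat.add_sub_cancel]
    push_cast
    field_simp
  rw [e] at h
  refine h.congr_of_eventuallyEq ?_ rfl
  filter_upwards [Ioo_mem_nhdsGT (Int.lt_floor_add_one t)] with r hr
  have : ⌊r⌋ = ⌊t⌋ := Int.floor_eq_iff.2 ⟨(Int.floor_le t).trans hr.1.le, hr.2⟩
  rw [periodicBernoulli, Int.fract, this]

theorem integral_periodicBernoulli {l : ℕ} (hl : 1 ≤ l) (a b : ℝ) :
    ∫ t in a..b, periodicBernoulli l t = periodicBernoulli (l + 1) b - periodicBernoulli (l + 1) a :=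
  intervalIntegral.integral_eq_sub_of_hasDeriv_right
    (continuous_periodicBernoulli (by omega)).continuousOn
    (fun t _ => hasDerivWithinAt_periodicBernoulli l t)
    (intervalIntegrable_periodicBernoulli l a b)

theorem periodicBernoulli_natCast (l n : ℕ) :
    periodicBernoulli l n = (bernoulli l : ℝ) / l.factorial := by
  rw [periodicBernoulli, Int.fract_natCast, bernoulliFun_eval_zero]

theorem Side.bernoulli_of_ne_one (s : Side) {l : ℕ} (hl : l ≠ 1) :
    s.bernoulli l = (_root_.bernoulli l : ℝ) := by
  cases s
  · rfl
  · rw [Side.bernoulli, bernoulli_eq_bernoulli'_of_ne_one hl]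

theorem Side.bernoulli_one (s : Side) : s.bernoulli 1 = -s.flip.bernoulli 1 := by
  cases s <;> norm_num [Side.bernoulli, Side.flip]

/-- Odd Bernoulli numbers vanish from index 3 on; this absorbs the alternating signs of the
generalised formula. -/
theorem neg_one_pow_mul_bernoulli {l : ℕ} (hl : 2 ≤ l) :
    (-1 : ℝ) ^ l * (bernoulli l : ℝ) = bernoulli l := by
  rcases l.even_or_odd with h | h
  · rw [h.neg_one_pow, one_mul]
  · rw [bernoulli_eq_zero_of_odd h (by omega), Rat.cast_zero, mul_zero]

/-! ### Integrals along the path `t ↦ t` -/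

theorem hasRSIntegral_volume {E : Type*} [NormedAddCommGroup E] [NormedSpace ℝ E] [CompleteSpace E]
    {A : ℝ → E} {a b C : ℝ} (hab : a ≤ b) (hC : ∀ r ∈ Icc a b, ‖A r‖ ≤ C)
    (hc : ∀ᵐ r ∂volume.restrict (Ioc a b), ContinuousWithinAt A (Icc a b) r) :
    HasRSIntegral (fun (e : E) (c : ℝ) => c • e) A (fun t => t) a b (∫ t in a..b, A t) := by
  have h := hasRSIntegral_integral (ν := volume.restrict (Ioc a b)) (A := A) (g := fun t => t)
    (fun u hu v hv huv => ?_) hC (by rwa [Measure.restrict_restrict_of_subset subset_rfl])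
  · rwa [Measure.restrict_restrict_of_subset subset_rfl,
      ← intervalIntegral.integral_of_le hab] at h
  · rw [Measure.real, Measure.restrict_eq_self _ (Ioc_subset_Ioc hu.1 hv.2), Real.volume_Ioc,
      ENNReal.toReal_ofReal (sub_nonneg.2 huv)]

theorem hasRSIntegral_periodicBernoulli {E : Type*} [NormedAddCommGroup E] [NormedSpace ℝ E]
    [CompleteSpace E] {A : ℝ → E} {a b : ℝ} (hab : a ≤ b) (hA : ContinuousOn A (Icc a b)) {l : ℕ}
    (hl : 1 ≤ l) :
    HasRSIntegral (fun (e : E) (c : ℝ) => c • e) A (periodicBernoulli (l + 1)) a b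
      (∫ t in a..b, periodicBernoulli l t • A t) := by
  obtain ⟨M, hM⟩ := exists_norm_periodicBernoulli_le l
  obtain ⟨C, hC⟩ := isCompact_Icc.exists_bound_of_continuousOn hA
  have h := hasRSIntegral_integral_density (ν := volume.restrict (Ioc a b)) (A := A)
    (g := periodicBernoulli (l + 1)) (h := periodicBernoulli l)
    (fun u hu v hv huv => ?_) (measurable_periodicBernoulli l).aestronglyMeasurable hM hC ?_
  · rwa [Measure.restrict_restrict_of_subset subset_rfl,
      ← intervalIntegral.integral_of_le hab] at h
  · rw [Measure.restrict_restrict_of_subset (Ioc_subset_Ioc hu.1 hv.2),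
      ← intervalIntegral.integral_of_le huv, integral_periodicBernoulli hl]
  · rw [Measure.restrict_restrict_of_subset subset_rfl]
    filter_upwards [ae_restrict_mem measurableSet_Ioc] with r hr using hA r ⟨hr.1.le, hr.2⟩

theorem isRectifiablePath_id (N : ℕ) : IsRectifiablePath N fun t : ℝ => t :=
  ⟨continuousOn_id, boundedVariationOn_of_norm_sub_le N.cast_nonneg (g := id)
    fun _ _ _ _ huv => (Real.norm_of_nonneg (sub_nonneg.2 huv)).le⟩

theorem variationFn_id {N : ℕ} {t : ℝ} (ht : t ∈ Icc 0 (N : ℝ)) :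
    variationFn N (fun t : ℝ => t) t = t := by
  have e : Icc 0 (N : ℝ) ∩ Iic t = Icc 0 (N : ℝ) ∩ Icc 0 t := by
    ext r
    simp only [mem_inter_iff, mem_Icc, mem_Iic]
    tauto
  rw [variationFn, e, (monotone_id.monotoneOn _).eVariationOn_eq (f := fun t : ℝ => t)
    (IsRectifiablePath.zero_mem N) ht, sub_zero, ENNReal.toReal_ofReal ht.1]

theorem restrict_variationMeasure_id (N : ℕ) :
    (variationMeasure N fun t : ℝ => t).restrict (Icc 0 (N : ℝ))
      = volume.restrict (Ioc 0 (N : ℝ)) := by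
  have hx := isRectifiablePath_id N
  have := hx.isFiniteMeasure
  rw [hx.restrict_Icc]
  refine Measure.ext_of_Ioc _ _ fun a b _ => ?_
  rw [Measure.restrict_apply measurableSet_Ioc, Measure.restrict_apply measurableSet_Ioc,
    Ioc_inter_Ioc]
  rcases le_or_gt (max a 0) (min b (N : ℝ)) with h | h
  · rw [hx.variationMeasure_Ioc, Real.volume_Ioc,
      variationFn_id ⟨(le_max_right _ _).trans h, min_le_right _ _⟩,
      variationFn_id ⟨le_max_right _ _, h.trans (min_le_right _ _)⟩]
  · rw [Ioc_eq_empty_of_le h.le, measure_empty, measure_empty]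

/-! ### The optimal sawtooth signature of `t ↦ t` -/

section Classical

variable {Ω : Type*} [MeasurableSpace Ω] (P : Measure Ω) [IsProbabilityMeasure P] {N : ℕ}
  (α : AdmissibleNorm ℝ)

theorem prepend_smul_pure_one (v c : ℝ) (n : ℕ) :
    α.prepend v n (c • α.pure fun _ => (1 : ℝ)) = (v * c) • α.pure fun _ => (1 : ℝ) := by
  have h : (Fin.cons 1 (fun _ => 1) : Fin (n + 1) → ℝ) = fun _ => 1 :=
    funext fun i => by refine Fin.cases ?_ (fun j => ?_) i <;> simp
  have hv : v = v • (1 : ℝ) := by simp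
  rw [hv, α.prepend_smul, map_smul, α.prepend_pure, h, smul_smul, smul_eq_mul, mul_one]

theorem ofV_eq_smul_pure_one (v : ℝ) : α.ofV v = v • α.pure fun _ => (1 : ℝ) := by
  have hv : v = v • (1 : ℝ) := by simp
  rw [← α.ofVL_apply, hv, map_smul, α.ofVL_apply, smul_eq_mul, mul_one]
  rfl

/-- The optimal tensor is minus the mean of the component with zero top datum, so adding it produces
zero mean. -/
theorem integral_sawtooth_id (hN : 1 ≤ N) (s : Side) {l : ℕ} (hl : 1 ≤ l) :
    ∫ t in (0 : ℝ)..N,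
      sawtooth α s N (fun t => t) (optimalTensor α P s N fun t _ => t) l t = 0 := by
  obtain ⟨l, rfl⟩ := Nat.exists_eq_add_of_le' hl
  have hx := isRectifiablePath_id N
  have := hx.isFiniteMeasure
  have hN0 : (N : ℝ) ≠ 0 := by positivity
  set b := optimalTensor α P s N fun t _ => t with hb
  have htv : ∀ ω : Ω, (totalVariation N (fun (t : ℝ) (_ : Ω) => t) ω).toReal = N := fun ω => by
    rw [totalVariation, ← IsRectifiablePath.variationFn_right,
      variationFn_id (IsRectifiablePath.right_mem N)]
  have h1 := optimalTensor_succ α P s N (fun t _ => t) l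
  simp only [htv, integral_const, probReal_univ, one_smul, ← hb, restrict_variationMeasure_id,
    ← intervalIntegral.integral_of_le N.cast_nonneg] at h1
  have h2 : IntervalIntegrable (sawtooth α s N (fun t => t) (trunc α b (l + 1)) (l + 1)) volume
      0 N := by
    have h3 := integrableOn_sawtooth α hx s (trunc α b (l + 1)) hl
    rw [IntegrableOn, restrict_variationMeasure_id] at h3
    exact (intervalIntegrable_iff_integrableOn_Ioc_of_le N.cast_nonneg).2 h3
  simp only [sawtooth_eq_trunc_add α s N _ b hl]
  rw [intervalIntegral.integral_add h2 intervalIntegrable_const, intervalIntegral.integral_const,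
    h1, smul_neg, sub_zero, smul_inv_smul₀ hN0, add_neg_cancel]

/-- The periodic Bernoulli function has zero integral because its primitive takes equal values at 0
and N. Hence N w = 0. The endpoint N is left out, since the backward identity of degree 1 fails
there. -/
theorem eq_zero_of_sawtooth_id (hN : 1 ≤ N) (s : Side) {l : ℕ} (hl : 1 ≤ l) {w : α.T l}
    (h : ∀ t ∈ Ico 0 (N : ℝ),
      sawtooth α s N (fun t => t) (optimalTensor α P s N fun t _ => t) l t
        = (periodicBernoulli l t • α.pure fun _ => (1 : ℝ)) + w) : w = 0 := by
  have hN0 : (N : ℝ) ≠ 0 := by positivity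
  have h0 := integral_sawtooth_id P α hN s hl
  have hne : ∀ᵐ t : ℝ, t ≠ N := by simp [ae_iff, measure_singleton]
  rw [intervalIntegral.integral_congr_ae (g := fun t =>
      (periodicBernoulli l t • α.pure fun _ => (1 : ℝ)) + w)
      (by
        filter_upwards [hne] with t ht htN
        rw [uIoc_of_le N.cast_nonneg] at htN
        exact h t ⟨htN.1.le, lt_of_le_of_ne htN.2 ht⟩),
    intervalIntegral.integral_add
      ((intervalIntegrable_periodicBernoulli l 0 N).smul_continuousOn continuousOn_const)
      intervalIntegrable_const, intervalIntegral.integral_smul_const,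
    integral_periodicBernoulli hl, periodicBernoulli_natCast, ← Nat.cast_zero,
    periodicBernoulli_natCast, sub_self, zero_smul, zero_add,
    intervalIntegral.integral_const, Nat.cast_zero, sub_zero] at h0
  exact (smul_eq_zero.1 h0).resolve_left hN0

theorem hasRSIntegral_periodicBernoulli_id {l : ℕ} (hl : 1 ≤ l) {t : ℝ} (ht : 0 ≤ t) :
    HasRSIntegral (fun z v => α.prepend v l z)
      (fun r => periodicBernoulli l r • α.pure fun _ : Fin l => (1 : ℝ)) (fun r => r) 0 t
      ((periodicBernoulli (l + 1) t - periodicBernoulli (l + 1) 0) •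
        α.pure fun _ : Fin (l + 1) => (1 : ℝ)) := by
  obtain ⟨M, hM⟩ := exists_norm_periodicBernoulli_le l
  have h := (hasRSIntegral_volume ht (fun r _ => hM r)
    (ae_restrict_of_ae ((ae_continuousAt_periodicBernoulli l).mono fun _ h =>
      h.continuousWithinAt))).map
    ((ContinuousLinearMap.id ℝ ℝ).smulRight (α.pure fun _ : Fin (l + 1) => (1 : ℝ)))
  rw [integral_periodicBernoulli hl] at h
  refine h.congr fun r _ u _ v _ => ?_
  rw [prepend_smul_pure_one]
  rfl

/-- The optimal tensors and the optimal sawtooth signature of `t ↦ t`. -/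
theorem sawtooth_id (hN : 1 ≤ N) (s : Side) {l : ℕ} (hl : 1 ≤ l) :
    (∀ t ∈ Icc 0 (N : ℝ), (l = 1 → t < N) →
      sawtooth α s N (fun t => t) (optimalTensor α P s N fun t _ => t) l t
        = periodicBernoulli l t • α.pure fun _ => (1 : ℝ)) ∧
    optimalTensor α P s N (fun t _ => t) l
      = (s.flip.bernoulli l / l.factorial) • α.pure fun _ => (1 : ℝ) := by
  have hx := isRectifiablePath_id N
  set b := optimalTensor α P s N fun t _ => t with hb
  induction l, hl using Nat.le_induction with
  | base =>
    -- The sawtooth is first identified up to a constant; zero mean then removes the constant and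
    -- thereby determines b₁.
    have hZ : ∀ t ∈ Ico 0 (N : ℝ), sawtooth α s N (fun t => t) b 1 t
        = (periodicBernoulli 1 t • α.pure fun _ => (1 : ℝ))
          + (b 1 - s.flip.bernoulli 1 • α.pure fun _ => (1 : ℝ)) := fun t ht => by
      have hfl : (⌊t⌋ : ℝ) = ⌊t⌋₊ := (natCast_floor_eq_intCast_floor ht.1).symm
      have hlt : ⌊t⌋₊ + 1 ≤ N := (Nat.floor_lt ht.1).2 ht.2
      have e : t - s.anchor N t = periodicBernoulli 1 t - s.flip.bernoulli 1 := by
        rw [periodicBernoulli, bernoulliFun_one, Int.fract, hfl]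
        cases s
        · simp only [Side.anchor, Side.flip, Side.bernoulli, min_eq_left hlt]
          norm_num
          ring
        · simp only [Side.anchor, Side.flip, Side.bernoulli]
          norm_num
      simp only [sawtooth, ofV_eq_smul_pure_one, e, sub_smul]
      abel
    have hw := eq_zero_of_sawtooth_id P α hN s le_rfl hZ
    refine ⟨fun t ht h1 => ?_, ?_⟩
    · rw [hZ t ⟨ht.1, h1 rfl⟩, hw, add_zero]
    · rw [sub_eq_zero.1 hw, Nat.factorial_one, Nat.cast_one, div_one]
  | succ l hl ih =>
    have hZ : ∀ t ∈ Icc 0 (N : ℝ), sawtooth α s N (fun t => t) b (l + 1) t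
        = (periodicBernoulli (l + 1) t • α.pure fun _ => (1 : ℝ))
          + (b (l + 1) - periodicBernoulli (l + 1) 0 • α.pure fun _ => (1 : ℝ)) := fun t ht => by
      have h1 := hasRSIntegral_sawtooth α hx s b hl (IsRectifiablePath.zero_mem N) ht ht.1
      -- For l = 1 the induction hypothesis does not cover r = N, but the right end of the interval
      -- is irrelevant.
      have h2 := HasRSIntegral.eq_of_eqOn_Ico (B := α.prependL l) ht.1 h1
        (hasRSIntegral_periodicBernoulli_id α hl ht.1) fun r hr =>
          ih.1 r ⟨hr.1, hr.2.le.trans ht.2⟩ fun _ => hr.2.trans_le ht.2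
      rw [sawtooth_zero α s N _ b (l + 1) (by omega), sub_smul] at h2
      rw [sub_eq_iff_eq_add.1 h2]
      abel
    have hw := eq_zero_of_sawtooth_id P α hN s (by omega) fun t ht => hZ t ⟨ht.1, ht.2.le⟩
    refine ⟨fun t ht _ => by rw [hZ t ht, hw, add_zero], ?_⟩
    rw [sub_eq_zero.1 hw, ← Nat.cast_zero, periodicBernoulli_natCast,
      Side.bernoulli_of_ne_one _ (by omega)]

end Classical


/-! ### The terms of the formula along `t ↦ t` -/

theorem Side.riemannSum_id {W : Type*} [NormedAddCommGroup W] [NormedSpace ℝ W] (s : Side) (N : ℕ)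
    (f : ℝ → ℝ →L[ℝ] W) :
    s.riemannSum N f (fun t => t) = ∑ k ∈ s.indices N, f k 1 := by
  cases s
  · simp [Side.riemannSum, Side.indices]
  · simp only [Side.riemannSum, Side.indices, add_sub_cancel_left]
    rw [Finset.range_eq_Ico, ← Finset.Ico_add_one_right_eq_Icc,
      ← Finset.sum_Ico_add' (fun k : ℕ => f k 1) 0 N 1]
    simp

section Terms

variable {W : Type*} [NormedAddCommGroup W] [NormedSpace ℝ W] {α : AdmissibleNorm ℝ} {m : ℕ}
  {f : ℝ → ℝ →L[ℝ] W} {D : ∀ k : ℕ, ℝ → α.T (k + 1) →L[ℝ] W}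

theorem IsTensorGradient.apply_pure_one (hD : IsTensorGradient α m f D) {k : ℕ} (hk : k ≤ m)
    (t : ℝ) :
    D k t (α.pure fun _ => (1 : ℝ)) = iteratedDeriv k (fun t => f t 1) t := by
  have h := (ContinuousLinearMap.apply ℝ W (1 : ℝ)).iteratedFDeriv_comp_left
    (hD.contDiff.contDiffAt (x := t)) (i := k) (by exact_mod_cast hk)
  have e : (ContinuousLinearMap.apply ℝ W (1 : ℝ)) ∘ f = fun t => f t 1 := rfl
  rw [e] at h
  rw [hD.apply_pure k hk, iteratedDeriv_eq_iteratedFDeriv, h]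
  rfl

variable {Ω : Type*} [MeasurableSpace Ω] (P : Measure Ω) [IsProbabilityMeasure P] {N : ℕ}

theorem IsTensorGradient.hasRSIntegral_id [CompleteSpace W] (hD : IsTensorGradient α m f D)
    {a b : ℝ} (hab : a ≤ b) :
    HasRSIntegral (fun (A : ℝ →L[ℝ] W) v => A v) f (fun t => t) a b (∫ t in a..b, f t 1) := by
  have hc : Continuous fun t => f t 1 := hD.contDiff.continuous.clm_apply continuous_const
  obtain ⟨C, hC⟩ := (isCompact_Icc (a := a) (b := b)).exists_bound_of_continuousOn hc.continuousOn
  refine (hasRSIntegral_volume hab hC (.of_forall fun _ => hc.continuousWithinAt)).congr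
    fun r _ u _ v _ => ?_
  rw [← map_smul, smul_eq_mul, mul_one]

theorem IsTensorGradient.boundary_one (hD : IsTensorGradient α m f D) (hN : 1 ≤ N) (s : Side) :
    -(D 0 N (optimalTensor α P s N (fun t _ => t) 1)
        - D 0 0 (optimalTensor α P s N (fun t _ => t) 1))
      = s.bernoulli 1 • (f N 1 - f 0 1) := by
  rw [(sawtooth_id P α hN s le_rfl).2, map_smul, map_smul, hD.apply_pure_one m.zero_le,
    hD.apply_pure_one m.zero_le, iteratedDeriv_zero, s.bernoulli_one, Nat.factorial_one,
    Nat.cast_one, div_one, ← smul_sub, neg_smul]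

theorem IsTensorGradient.boundary (hD : IsTensorGradient α m f D) (hN : 1 ≤ N) (s : Side) {j : ℕ}
    (hj : j < m - 1) (ω : Ω) :
    (-1 : ℝ) ^ (j + 2) •
        (D (j + 1) N (optimalSawtooth α P s N (fun t _ => t) (j + 2) N ω)
          - D (j + 1) 0 (optimalSawtooth α P s N (fun t _ => t) (j + 2) 0 ω))
      = (s.bernoulli (j + 2) / (j + 2).factorial) •
        (iteratedDeriv (j + 1) (fun t => f t 1) N - iteratedDeriv (j + 1) (fun t => f t 1) 0) := by
  have hZ := (sawtooth_id P α hN s (l := j + 2) (by omega)).1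
  have hjm : j + 1 ≤ m := by omega
  have hZ0 := hZ 0 (IsRectifiablePath.zero_mem N) (by omega)
  have hZN := hZ N (IsRectifiablePath.right_mem N) (by omega)
  rw [← Nat.cast_zero (R := ℝ), periodicBernoulli_natCast, Nat.cast_zero] at hZ0
  rw [periodicBernoulli_natCast] at hZN
  rw [optimalSawtooth, optimalSawtooth, hZ0, hZN, map_smul, map_smul, hD.apply_pure_one hjm,
    hD.apply_pure_one hjm, s.bernoulli_of_ne_one (by omega), ← smul_sub, smul_smul,
    ← mul_div_assoc, neg_one_pow_mul_bernoulli (by omega)]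

theorem IsTensorGradient.hasRSIntegral_remainder [CompleteSpace W] (hD : IsTensorGradient α m f D)
    (hm : 1 ≤ m) (hN : 1 ≤ N) (s : Side) (ω : Ω) :
    HasRSIntegral (fun (A : α.T (m + 1) →L[ℝ] W) z => A z) (D m)
      (fun t => optimalSawtooth α P s N (fun t _ => t) (m + 1) t ω) 0 N
      ((m.factorial : ℝ)⁻¹ • ∫ t in (0 : ℝ)..N,
        bernoulliFun m (Int.fract t) • iteratedDeriv m (fun t => f t 1) t) := by
  have hc : Continuous fun t => D m t (α.pure fun _ => (1 : ℝ)) :=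
    (hD.continuous m le_rfl).clm_apply continuous_const
  have h := hasRSIntegral_periodicBernoulli N.cast_nonneg hc.continuousOn hm (a := 0) (b := N)
  have e : (m.factorial : ℝ)⁻¹ • ∫ t in (0 : ℝ)..N,
        bernoulliFun m (Int.fract t) • iteratedDeriv m (fun t => f t 1) t
      = ∫ t in (0 : ℝ)..N, periodicBernoulli m t • D m t (α.pure fun _ => (1 : ℝ)) := by
    rw [← intervalIntegral.integral_smul]
    simp only [hD.apply_pure_one le_rfl, smul_smul, periodicBernoulli, div_eq_inv_mul]
  rw [e]
  refine h.congr fun r _ u hu v hv => ?_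
  have hZ := (sawtooth_id P α hN s (l := m + 1) (by omega)).1
  rw [optimalSawtooth, optimalSawtooth, hZ u hu (by omega), hZ v hv (by omega), ← sub_smul,
    map_smul]

end Terms

/-! ### The classical Euler–Maclaurin formula -/

section EulerMaclaurin

variable {f : ℝ → ℝ} {m N : ℕ}

theorem hasDerivWithinAt_iteratedDerivWithin {b : ℝ} (hb : 0 < b)
    (hf : ContDiffOn ℝ m f (Icc 0 b)) {l : ℕ} (hl : l < m) {t : ℝ} (ht : t ∈ Ioo 0 b) :
    HasDerivWithinAt (iteratedDerivWithin l f (Icc 0 b))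
      (iteratedDerivWithin (l + 1) f (Icc 0 b) t) (Ioi t) t := by
  have h := hf.differentiableOn_iteratedDerivWithin (m := l) (by exact_mod_cast hl)
    (uniqueDiffOn_Icc hb) t (Ioo_subset_Icc_self ht)
  rw [iteratedDerivWithin_succ]
  exact (h.hasDerivWithinAt.hasDerivAt (Icc_mem_nhds ht.1 ht.2)).hasDerivWithinAt

theorem intervalIntegrable_mul_periodicBernoulli {g : ℝ → ℝ} {a b : ℝ} (hab : a ≤ b)
    (hg : ContinuousOn g (Icc a b)) (l : ℕ) :
    IntervalIntegrable (fun t => g t * periodicBernoulli l t) volume a b :=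
  (intervalIntegrable_periodicBernoulli l a b).continuousOn_mul (by rwa [uIcc_of_le hab])

/-- Integration by parts over the whole interval: for `l ≥ 1` the next periodic Bernoulli function
is continuous, with the same value at 0 and N. -/
theorem integral_mul_periodicBernoulli {g g' : ℝ → ℝ} (hg : ContinuousOn g (Icc 0 (N : ℝ)))
    (hg' : ContinuousOn g' (Icc 0 (N : ℝ)))
    (hd : ∀ t ∈ Ioo 0 (N : ℝ), HasDerivWithinAt g (g' t) (Ioi t) t) {l : ℕ} (hl : 1 ≤ l) :
    ∫ t in (0 : ℝ)..N, g t * periodicBernoulli l t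
      = bernoulli (l + 1) / (l + 1).factorial * (g N - g 0)
        - ∫ t in (0 : ℝ)..N, g' t * periodicBernoulli (l + 1) t := by
  have h1 := intervalIntegrable_mul_periodicBernoulli N.cast_nonneg hg' (l + 1)
  have h2 := intervalIntegrable_mul_periodicBernoulli N.cast_nonneg hg l
  have h := intervalIntegral.integral_eq_sub_of_hasDeriv_right
    (f := fun t => g t * periodicBernoulli (l + 1) t) (a := 0) (b := N)
    (by
      rw [uIcc_of_le N.cast_nonneg]
      exact hg.mul (continuous_periodicBernoulli (by omega)).continuousOn)
    (fun t ht => (hd t (by simpa using ht)).mul (hasDerivWithinAt_periodicBernoulli l t))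
    (h1.add h2)
  rw [intervalIntegral.integral_add h1 h2, ← Nat.cast_zero, periodicBernoulli_natCast,
    periodicBernoulli_natCast, Nat.cast_zero] at h
  linear_combination h

/-- P₁ jumps at integers, so the integration by parts is made on each unit interval, where the
continuous function t − k − 1/2 replaces it. Its end values ±1/2 produce the trapezoidal sum. -/
theorem integral_mul_periodicBernoulli_one {g g' : ℝ → ℝ} (hg : ContinuousOn g (Icc 0 (N : ℝ)))
    (hg' : ContinuousOn g' (Icc 0 (N : ℝ)))
    (hd : ∀ t ∈ Ioo 0 (N : ℝ), HasDerivWithinAt g (g' t) (Ioi t) t) :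
    ∫ t in (0 : ℝ)..N, g' t * periodicBernoulli 1 t
      = ∑ k ∈ Finset.range N, (g k + g (k + 1 : ℕ)) / 2 - ∫ t in (0 : ℝ)..N, g t := by
  have hsub : ∀ k < N, Icc (k : ℝ) (k + 1 : ℕ) ⊆ Icc 0 (N : ℝ) := fun k hk =>
    Icc_subset_Icc k.cast_nonneg (Nat.cast_le.2 hk)
  have hle : ∀ k : ℕ, (k : ℝ) ≤ (k + 1 : ℕ) := fun k => Nat.cast_le.2 k.le_succ
  have h1 : ∀ k < N, IntervalIntegrable (fun t => g' t * periodicBernoulli 1 t) volume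
      (k : ℝ) (k + 1 : ℕ) := fun k hk =>
    intervalIntegrable_mul_periodicBernoulli (hle k) (hg'.mono (hsub k hk)) 1
  have h2 : ∀ k < N, IntervalIntegrable g volume (k : ℝ) (k + 1 : ℕ) := fun k hk =>
    (hg.mono (hsub k hk)).intervalIntegrable_of_Icc (hle k)
  have e1 := intervalIntegral.sum_integral_adjacent_intervals (a := fun k : ℕ => (k : ℝ)) h1
  have e2 := intervalIntegral.sum_integral_adjacent_intervals (a := fun k : ℕ => (k : ℝ)) h2
  rw [Nat.cast_zero] at e1 e2
  rw [← e1, ← e2, ← Finset.sum_sub_distrib]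
  refine Finset.sum_congr rfl fun k hk => ?_
  have hk := Finset.mem_range.1 hk
  have h := intervalIntegral.integral_eq_sub_of_hasDeriv_right
    (f := fun t => g t * (t - k - 1 / 2)) (a := (k : ℝ)) (b := (k + 1 : ℕ))
    (f' := fun t => g' t * periodicBernoulli 1 t + g t)
    (by
      rw [uIcc_of_le (hle k)]
      exact (hg.mono (hsub k hk)).mul (by fun_prop))
    (fun t ht => by
      rw [min_eq_left (hle k), max_eq_right (hle k)] at ht
      have hd1 := hd t ⟨k.cast_nonneg.trans_lt ht.1, ht.2.trans_le (Nat.cast_le.2 hk)⟩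
      have hd2 : HasDerivWithinAt (fun t : ℝ => t - k - 1 / 2) 1 (Ioi t) t :=
        ((hasDerivWithinAt_id t _).sub_const _).sub_const _
      have hfr : Int.fract t = t - k := by
        rw [Int.fract, Int.floor_eq_iff (z := k) |>.2 ⟨ht.1.le, by exact_mod_cast ht.2⟩]
        rfl
      convert! hd1.mul hd2 using 1
      rw [periodicBernoulli, bernoulliFun_one, hfr]
      simp)
    ((h1 k hk).add (h2 k hk))
  rw [intervalIntegral.integral_add (h1 k hk) (h2 k hk)] at h
  push_cast at h ⊢
  linear_combination h

/-- A one-sided sum differs from the trapezoidal sum by half the total increment, with the sign of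
B₁^±. -/
theorem Side.sum_indices (s : Side) (N : ℕ) (g : ℝ → ℝ) :
    ∑ k ∈ s.indices N, g k
      = ∑ k ∈ Finset.range N, (g k + g (k + 1 : ℕ)) / 2 + s.bernoulli 1 * (g N - g 0) := by
  have h1 : ∑ k ∈ Finset.range N, (g (k + 1 : ℕ) - g k) = g N - g 0 := by
    rw [Finset.sum_range_sub fun k : ℕ => g k, Nat.cast_zero]
  rw [← h1, Finset.mul_sum, ← Finset.sum_add_distrib]
  cases s
  · refine Finset.sum_congr rfl fun k _ => ?_
    simp only [Side.bernoulli, _root_.bernoulli_one]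
    push_cast
    ring
  · rw [Side.indices, ← Finset.Ico_add_one_right_eq_Icc,
      ← Finset.sum_Ico_add' (fun k : ℕ => g k) 0 N 1, ← Finset.range_eq_Ico]
    refine Finset.sum_congr rfl fun k _ => ?_
    simp only [Side.bernoulli, bernoulli'_one]
    push_cast
    ring

/-- The Euler–Maclaurin formula for functions of class `C^m` on `[0, N]`. -/
theorem euler_maclaurin (s : Side) (hN : 1 ≤ N) (hm : 1 ≤ m)
    (hf : ContDiffOn ℝ m f (Icc 0 (N : ℝ))) :
    ∑ k ∈ s.indices N, f k
      = (∫ t in (0 : ℝ)..N, f t)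
        + ∑ l ∈ Finset.Icc 1 m, s.bernoulli l / l.factorial *
            (iteratedDerivWithin (l - 1) f (Icc 0 (N : ℝ)) N
              - iteratedDerivWithin (l - 1) f (Icc 0 (N : ℝ)) 0)
        + (-1 : ℝ) ^ (m + 1) * ∫ t in (0 : ℝ)..N,
            iteratedDerivWithin m f (Icc 0 (N : ℝ)) t * periodicBernoulli m t := by
  have hN0 : (0 : ℝ) < N := Nat.cast_pos.2 hN
  have hcont : ∀ l ≤ m, ContinuousOn (iteratedDerivWithin l f (Icc 0 (N : ℝ))) (Icc 0 (N : ℝ)) :=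
    fun l hl => hf.continuousOn_iteratedDerivWithin (by exact_mod_cast hl) (uniqueDiffOn_Icc hN0)
  have hderiv := fun l (hl : l < m) t ht =>
    hasDerivWithinAt_iteratedDerivWithin (t := t) hN0 hf hl ht
  -- Only continuity and right derivatives of the iterated derivatives are carried along, since
  -- these hypotheses restrict to smaller m in the induction.
  clear hf
  induction m, hm using Nat.le_induction with
  | base =>
    have h := integral_mul_periodicBernoulli_one (hcont 0 zero_le_one) (hcont 1 le_rfl)
      (hderiv 0 zero_lt_one)
    rw [Finset.Icc_self, Finset.sum_singleton, h]
    simp only [iteratedDerivWithin_zero, Nat.sub_self, s.sum_indices]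
    norm_num
    ring
  | succ m hm ih =>
    have h := integral_mul_periodicBernoulli (hcont m m.le_succ) (hcont (m + 1) le_rfl)
      (hderiv m m.lt_succ_self) hm
    rw [ih (fun l hl => hcont l (hl.trans m.le_succ)) (fun l hl => hderiv l (hl.trans m.lt_succ_self)),
      Finset.sum_Icc_succ_top (by omega), h, s.bernoulli_of_ne_one (l := m + 1) (by omega),
      Nat.add_sub_cancel]
    have e := neg_one_pow_mul_bernoulli (l := m + 1) (by omega)
    rw [pow_succ (-1 : ℝ) (m + 1)]
    linear_combination ((iteratedDerivWithin m f (Icc 0 (N : ℝ)) N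
      - iteratedDerivWithin m f (Icc 0 (N : ℝ)) 0) / ((m + 1).factorial : ℝ)) * e

end EulerMaclaurin

end EML

theorem theorem1 {Ω : Type*} [MeasurableSpace Ω] (P : Measure Ω) [IsProbabilityMeasure P]
    (N : ℕ) (s : Side) :
    -- the generalised Euler–Maclaurin formula in Banach spaces
    (∀ (V : Type*) [NormedAddCommGroup V] [NormedSpace ℝ V] [CompleteSpace V]
        (α : AdmissibleNorm V) (X : ℝ → Ω → V), IsRectifiable P N X →
      -- `b^*` belongs to `T_1((V))`, as does `Z^*_t`
      optimalTensor α P s N X ∈ α.series₁ ∧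
      (∀ t ω, (fun n => optimalSawtooth α P s N X n t ω) ∈ α.series₁) ∧
      -- if the total variation has moments of all orders, then the expectations that define
      -- `b^*` exist
      ((∀ p : ℕ, ∫⁻ ω, totalVariation N X ω ^ p ∂P < ∞) → ∀ m ≥ 1,
        (∀ᵐ ω ∂P, IntegrableOn
          (fun t => sawtooth α s N (fun t => X t ω) (trunc α (optimalTensor α P s N X) m) m t)
          (Icc 0 (N : ℝ)) (variationMeasure N fun t => X t ω)) ∧
        Integrable (fun ω => ∫ t in Icc 0 (N : ℝ),
          sawtooth α s N (fun t => X t ω) (trunc α (optimalTensor α P s N X) m) m t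
            ∂(variationMeasure N fun t => X t ω)) P) ∧
      -- `Z^*` is the sawtooth signature with initial datum `b^*`
      (∀ t ω, optimalSawtooth α P s N X 1 t ω
        = α.ofV (X t ω - X (s.anchor N t) ω) + optimalTensor α P s N X 1) ∧
      (∀ᵐ ω ∂P, ∀ n ≥ 1, ∀ t ∈ Icc (0 : ℝ) N,
        HasRSIntegral (fun z v => α.prepend v n z) (fun r => optimalSawtooth α P s N X n r ω)
          (fun r => X r ω) 0 t
          (optimalSawtooth α P s N X (n + 1) t ω - optimalTensor α P s N X (n + 1))) ∧
      (∀ n, (n = 1 → s = Side.forward) → ∀ ω,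
        optimalSawtooth α P s N X n 0 ω = optimalTensor α P s N X n) ∧
      -- `Z^*` is rectifiable; its first component is of bounded variation, with jumps at integers
      (∀ n, n ≠ 1 → IsRectifiable P N (optimalSawtooth α P s N X n)) ∧
      (∀ t ∈ Icc (0 : ℝ) N, AEStronglyMeasurable (optimalSawtooth α P s N X 1 t) P) ∧
      (∀ᵐ ω ∂P, BoundedVariationOn (fun t => optimalSawtooth α P s N X 1 t ω)
        (Icc 0 (N : ℝ))) ∧
      -- the formula with its remainder
      (∀ (W : Type*) [NormedAddCommGroup W] [NormedSpace ℝ W] [CompleteSpace W],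
        ∀ᵐ ω ∂P, ∀ m ≥ 1, ∀ (f : V → V →L[ℝ] W) (D : ∀ k : ℕ, V → α.T (k + 1) →L[ℝ] W),
          IsTensorGradient α m f D →
          ∃ J R : W,
            HasRSIntegral (fun (A : V →L[ℝ] W) v => A v) (fun t => f (X t ω))
              (fun t => X t ω) 0 N J ∧
            HasRSIntegral (fun (A : α.T (m + 1) →L[ℝ] W) z => A z) (fun t => D m (X t ω))
              (fun t => optimalSawtooth α P s N X (m + 1) t ω) 0 N R ∧
            s.riemannSum N f (fun t => X t ω)
              = J
                - (D 0 (X N ω) (optimalTensor α P s N X 1)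
                    - D 0 (X 0 ω) (optimalTensor α P s N X 1))
                + ∑ j ∈ Finset.range (m - 1), (-1 : ℝ) ^ (j + 2) •
                    (D (j + 1) (X N ω) (optimalSawtooth α P s N X (j + 2) N ω)
                      - D (j + 1) (X 0 ω) (optimalSawtooth α P s N X (j + 2) 0 ω))
                + (-1 : ℝ) ^ (m + 1) • R)) ∧
    -- for Hilbert spaces, `b^*` is the unique solution of the recursive minimisation problem
    (∀ (H : Type*) [NormedAddCommGroup H] [InnerProductSpace ℝ H] [CompleteSpace H]
        (α : AdmissibleNorm H), α.IsHilbert → ∀ X : ℝ → Ω → H, IsRectifiable P N X →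
      (∀ p : ℕ, ∫⁻ ω, totalVariation N X ω ^ p ∂P < ∞) →
      ∫⁻ ω, totalVariation N X ω ∂P ≠ 0 →
      (∀ m ≥ 1,
        varianceFunctional α P s N X (optimalTensor α P s N X) m (optimalTensor α P s N X m) < ∞ ∧
        ∀ v ≠ optimalTensor α P s N X m,
          varianceFunctional α P s N X (optimalTensor α P s N X) m (optimalTensor α P s N X m)
            < varianceFunctional α P s N X (optimalTensor α P s N X) m v) ∧
      (∀ b ∈ α.series₁,
        (∀ m ≥ 1, ∀ v, varianceFunctional α P s N X b m (b m)
          ≤ varianceFunctional α P s N X b m v) →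
        b = optimalTensor α P s N X ∧
        ∀ n t ω, sawtooth α s N (fun t => X t ω) b n t = optimalSawtooth α P s N X n t ω)) ∧
    -- for `V = ℝ` and `X_t = t` the formula is the classical one
    (N ≥ 1 → ∀ α : AdmissibleNorm ℝ,
      (∀ l ≥ 1, optimalTensor α P s N (fun t _ => t) l
        = (s.flip.bernoulli l / l.factorial) • α.pure fun _ => (1 : ℝ)) ∧
      (∀ l ≥ 1, ∀ t ∈ Icc (0 : ℝ) N, (l = 1 → t < N) → ∀ ω,
        optimalSawtooth α P s N (fun t _ => t) l t ω
          = (bernoulliFun l (Int.fract t) / l.factorial) • α.pure fun _ => (1 : ℝ)) ∧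
      -- each term of the generalised formula is the corresponding term of the classical one
      (∀ (W : Type*) [NormedAddCommGroup W] [NormedSpace ℝ W] [CompleteSpace W],
        ∀ m ≥ 1, ∀ (f : ℝ → ℝ →L[ℝ] W) (D : ∀ k : ℕ, ℝ → α.T (k + 1) →L[ℝ] W),
          IsTensorGradient α m f D → ∀ ω : Ω,
          s.riemannSum N f (fun t => t) = ∑ k ∈ s.indices N, f k 1 ∧
          HasRSIntegral (fun (A : ℝ →L[ℝ] W) v => A v) f (fun t => t) 0 N
            (∫ t in (0 : ℝ)..N, f t 1) ∧
          -(D 0 N (optimalTensor α P s N (fun t _ => t) 1)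
              - D 0 0 (optimalTensor α P s N (fun t _ => t) 1))
            = s.bernoulli 1 • (f N 1 - f 0 1) ∧
          (∀ j < m - 1, (-1 : ℝ) ^ (j + 2) •
              (D (j + 1) N (optimalSawtooth α P s N (fun t _ => t) (j + 2) N ω)
                - D (j + 1) 0 (optimalSawtooth α P s N (fun t _ => t) (j + 2) 0 ω))
            = (s.bernoulli (j + 2) / (j + 2).factorial) •
              (iteratedDeriv (j + 1) (fun t => f t 1) N
                - iteratedDeriv (j + 1) (fun t => f t 1) 0)) ∧
          HasRSIntegral (fun (A : α.T (m + 1) →L[ℝ] W) z => A z) (D m)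
            (fun t => optimalSawtooth α P s N (fun t _ => t) (m + 1) t ω) 0 N
            ((m.factorial : ℝ)⁻¹ • ∫ t in (0 : ℝ)..N,
              bernoulliFun m (Int.fract t) • iteratedDeriv m (fun t => f t 1) t)) ∧
      -- the classical Euler–Maclaurin formula
      (∀ m : ℕ, m ≥ 1 → ∀ f : ℝ → ℝ, ContDiffOn ℝ m f (Icc 0 (N : ℝ)) →
        ∑ k ∈ s.indices N, f k
          = (∫ t in (0 : ℝ)..N, f t)
            + ∑ l ∈ Finset.Icc 1 m, s.bernoulli l / l.factorial *
                (iteratedDerivWithin (l - 1) f (Icc 0 (N : ℝ)) N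
                  - iteratedDerivWithin (l - 1) f (Icc 0 (N : ℝ)) 0)
            + (-1 : ℝ) ^ (m + 1) / m.factorial * ∫ t in (0 : ℝ)..N,
                iteratedDerivWithin m f (Icc 0 (N : ℝ)) t * bernoulliFun m (Int.fract t))) := by
  refine ⟨fun V _ _ _ α X hX => ⟨optimalTensor_mem_series₁ α P s N X,
    fun _ _ => optimalTensor_mem_series₁ α P s N X, fun hp m hm => ⟨?_, ?_⟩, fun _ _ => rfl, ?_,
    fun n hn ω => sawtooth_zero α s N _ _ n hn, fun n hn => isRectifiable_sawtooth α hX s _ hn,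
    fun t ht => aestronglyMeasurable_sawtooth α hX s _ 1 ht, ?_, fun W _ _ _ => ?_⟩, ?_, ?_⟩
  · filter_upwards [hX.ae_isRectifiablePath] with ω hx
    exact integrableOn_sawtooth α hx s _ hm
  · exact integrable_integral_sawtooth α hX hp s _ hm
  · filter_upwards [hX.ae_isRectifiablePath] with ω hx n hn t ht
    have h := hasRSIntegral_sawtooth α hx s (optimalTensor α P s N X) hn
      (IsRectifiablePath.zero_mem N) ht ht.1
    rwa [sawtooth_zero α s N _ _ (n + 1) (by omega)] at h
  · filter_upwards [hX.ae_isRectifiablePath] with ω hx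
    exact boundedVariationOn_sawtooth_one α hx s _
  -- The exceptional set depends only on the path, so m, f and D may be chosen after ω.
  · filter_upwards [hX.ae_isRectifiablePath] with ω hx m hm f D hD
    exact hD.formula hx s _ hm
  · intro H _ _ _ α hα X hX hp h0
    refine ⟨fun m hm => ⟨?_, fun v hv => hα.varianceFunctional_lt hX hp h0 s hm hv⟩,
      fun b hb hmin => ?_⟩
    · rw [varianceFunctional_eq α hX hp s _ hm]
      exact ENNReal.ofReal_lt_top
    · obtain rfl := hα.eq_optimalTensor hX hp h0 s hb hmin
      exact ⟨rfl, fun _ _ _ => rfl⟩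
  · intro hN α
    refine ⟨fun l hl => (sawtooth_id P α hN s hl).2,
      fun l hl t ht h _ => (sawtooth_id P α hN s hl).1 t ht h,
      fun W _ _ _ m hm f D hD ω => ⟨s.riemannSum_id N f, hD.hasRSIntegral_id N.cast_nonneg,
        hD.boundary_one P hN s, fun j hj => hD.boundary P hN s hj ω,
        hD.hasRSIntegral_remainder P hm hN s ω⟩, fun m hm f hf => ?_⟩
    rw [euler_maclaurin s hN hm hf, div_mul_eq_mul_div, mul_div_assoc,
      ← intervalIntegral.integral_div]
    simp only [periodicBernoulli, mul_div_assoc]
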